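/- **Setting.** Let $d\ge 1$ and $\Theta=\{\eta\in\mathbb R^d: |\eta|=1,\ \eta_1\ge 0\}$. Let $(X_i,Y_i)_{i\ge1}$ be i.i.d. copies of $(X,Y)\in\mathbb R^d\times\mathbb R$ with $Y=m_0(\theta_0^\top X)+\epsilon$, $\theta_0\in\Theta$. Let $P_X$ be the law of $X$, $\chi$ its support, and let $D$ be the smallest interval containing $\{\theta^\top x:\theta\in\Theta,\ x\in\chi\}$ (for $d\ge2$ and $\chi$ compact this set is itself an interval). Let $\mathcal R$ be the class of convex functions on $D$ that have an absolutely continuous first derivative on $D$, $J^2(m)=\int_D m''(t)^2\,dt\in[0,\infty]$, and $\|g\|^2=\int g^2\,dP_X$. For a random $\hat\lambda_n\neq0$, possibly data dependent, let $(\hat m,\hat\theta)=(\hat m_n,\hat\theta_n)\in\mathcal R\times\Theta$ be any minimizer over $(m,\theta)\in\mathcal R\times\Theta$ of $$\frac1n\sum_{i=1}^n\{Y_i-m(\theta^\top X_i)\}^2+\hat\lambda_n^2J^2(m).$$ **Assumptions.** * (A0) $\theta_{0,1}>0$, and for some $d_1\in\{1,\dots,d\}$ the vector $(X_1,\dots,X_{d_1})$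 has a joint Lebesgue density and $X_{d_1+1},\dots,X_d$ are discrete. There exist a nonempty open interval $\mathcal I$ and vectors $c_0,\dots,c_{d-d_1}\in\mathbb R^{d-d_1}$ such that $c_l-c_0$ ($1\le l\le d-d_1$) are linearly independent and $\mathcal I\subset\bigcap_{l=0}^{d-d_1}\{\theta_0^\top x: x\in\chi,\ (x_{d_1+1},\dots,x_d)=c_l\}$. * (A1) $\chi$ is compact. * (A2) $\mathbb E(\epsilon\mid X)=0$ a.s., and for some $K_1>0$, $K_1\mathbb E[\exp(\epsilon^2/K_1)-1\mid X]\le1$ a.s. * (A3) $\mathbb E[XX^\top\{m_0'(\theta_0^\top X)\}^2]$ is nonsingular. * (A4) $\mathrm{Var}(X)$ is positive definite. * (P1) $m_0\in\mathcal R$, $m_0$ is bounded on $D$, and $J(m_0)<\infty$. * (P2) $\hat\lambda_n^{-1}=O_p(n^{2/5})$ and $\hat\lambda_n=o_p(n^{-1/4})$. * (N) The conditional distribution of $X$ given $\theta_0^\top X$ is nondegenerate: for almost every $t$ (with respect to the law of $\theta_0^\top X$), the law of $X$ given $\theta_0^\top X=t$ is not concentrated on a proper affine subspace of the hyperplane $\{x:\theta_0^\top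 x=t\}$. **Theorem.** Under (A0)–(A4), (P1)–(P2) and (N), $$|\hat\theta-\theta_0|=O_p(\hat\lambda_n)\qquad\text{and}\qquad\|\hat m\circ\theta_0-m_0\circ\theta_0\|=O_p(\hat\lambda_n).$$ Here $U_n=O_p(V_n)$ means that for every $\varepsilon>0$ there is $C$ with $P(|U_n|>C|V_n|)\le\varepsilon$ for all large $n$, and $U_n=o_p(V_n)$ that $P(|U_n|>c|V_n|)\to0$ for every $c>0$; $P$ is outer probability where measurability is not given. -/

import Mathlib

open MeasureTheory ProbabilityTheory Filter Topology
open scoped ENNReal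

noncomputable section

namespace ConvexSingleIndex

/-- The index parameter space: unit vectors with nonnegative first coordinate. -/
def Theta (d : ℕ) [NeZero d] : Set (EuclideanSpace ℝ (Fin d)) :=
  {η | ‖η‖ = 1 ∧ 0 ≤ η 0}

/-- The index set of the link functions: the smallest interval that contains all the values
`θᵀx`, `x ∈ chi`, `θ ∈ Θ`. For `d ≥ 2` the set of these values is itself an interval around `0`
(when `chi` is compact and nonempty), so the hull only matters for `d = 1`. -/
def indexSet {d : ℕ} [NeZero d] (chi : Set (EuclideanSpace ℝ (Fin d))) : Set ℝ :=
  convexHull ℝ {t | ∃ θ ∈ Theta d, ∃ x ∈ chi, t = inner ℝ θ x}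

/-- The class `𝓡` of convex functions on `D` whose first derivative (one-sided at endpoints of
`D`) exists and is absolutely continuous on `D`. Only the values on `D` matter. -/
def LinkClass (D : Set ℝ) : Set (ℝ → ℝ) :=
  {m | ConvexOn ℝ D m ∧ DifferentiableOn ℝ m D ∧
    ∀ s ∈ D, ∀ t ∈ D, AbsolutelyContinuousOnInterval (derivWithin m D) s t}

/-- The squared roughness `J²(m) = ∫_D (m'')²`, with value `∞` allowed. -/
def roughnessSq (D : Set ℝ) (m : ℝ → ℝ) : ℝ≥0∞ :=
  ∫⁻ t in D, ENNReal.ofReal ((derivWithin (derivWithin m D) D t) ^ 2)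

variable {d : ℕ} [NeZero d]

/-- `Q_n(m, θ) = n⁻¹ ∑ (y_i - m(θᵀx_i))²`, the sample being `(x_i, y_i)`, `i < n`. -/
def empLoss (n : ℕ) (x : ℕ → EuclideanSpace ℝ (Fin d)) (y : ℕ → ℝ)
    (m : ℝ → ℝ) (θ : EuclideanSpace ℝ (Fin d)) : ℝ :=
  (1 / (n : ℝ)) * ∑ i ∈ Finset.range n, (y i - m (inner ℝ θ (x i))) ^ 2

/-- The penalized loss `Q_n(m, θ) + lam² J²(m)`, with value `∞` allowed. -/
def penLoss (D : Set ℝ) (n : ℕ) (x : ℕ → EuclideanSpace ℝ (Fin d)) (y : ℕ → ℝ) (lam : ℝ)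
    (m : ℝ → ℝ) (θ : EuclideanSpace ℝ (Fin d)) : ℝ≥0∞ :=
  ENNReal.ofReal (empLoss n x y m θ) + ENNReal.ofReal (lam ^ 2) * roughnessSq D m

/-- `(m, θ)` is a penalized least squares estimate: a minimizer of the penalized loss over
`𝓡 × Θ`. -/
def IsPLSE (D : Set ℝ) (n : ℕ) (x : ℕ → EuclideanSpace ℝ (Fin d)) (y : ℕ → ℝ) (lam : ℝ)
    (m : ℝ → ℝ) (θ : EuclideanSpace ℝ (Fin d)) : Prop :=
  m ∈ LinkClass D ∧ θ ∈ Theta d ∧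
    ∀ m' ∈ LinkClass D, ∀ θ' ∈ Theta d, penLoss D n x y lam m θ ≤ penLoss D n x y lam m' θ'

/-- The `L²(PX)` norm of a real function. -/
def l2Norm (PX : Measure (EuclideanSpace ℝ (Fin d)))
    (g : EuclideanSpace ℝ (Fin d) → ℝ) : ℝ :=
  Real.sqrt (∫ x, (g x) ^ 2 ∂PX)

variable {Ω : Type*} [MeasurableSpace Ω]

/-- `U_n = O_p(V_n)`. On nonmeasurable sets `P` is the outer probability. -/
def IsBigOp (P : Measure Ω) (U V : ℕ → Ω → ℝ) : Prop :=
  ∀ ε : ℝ, 0 < ε → ∃ C : ℝ, ∀ᶠ n in atTop,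
    P {ω | C * |V n ω| < |U n ω|} ≤ ENNReal.ofReal ε

/-- `U_n = o_p(V_n)`. -/
def IsLittleOp (P : Measure Ω) (U V : ℕ → Ω → ℝ) : Prop :=
  ∀ c : ℝ, 0 < c → Tendsto (fun n => P {ω | c * |V n ω| < |U n ω|}) atTop (𝓝 0)

/-- The first `d₁ ≥ 1` covariates have a joint Lebesgue density, the remaining ones are discrete,
the first coordinate of `θ₀` is positive, and there are `d - d₁ + 1` affinely independent values
of the discrete covariates for which the sets of values of the index `θ₀ᵀx` share an open
interval. -/
def IdentifiableDesign (P : Measure Ω) (X : Ω → EuclideanSpace ℝ (Fin d))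
    (θ₀ : EuclideanSpace ℝ (Fin d)) : Prop :=
  0 < θ₀ 0 ∧
  ∃ d₁ : ℕ, 1 ≤ d₁ ∧ d₁ ≤ d ∧
    (P.map (fun ω (j : {j : Fin d // (j : ℕ) < d₁}) => X ω j)) ≪ volume ∧
    (∀ j : Fin d, d₁ ≤ (j : ℕ) → ∃ S : Set ℝ, S.Countable ∧ ∀ᵐ ω ∂P, X ω j ∈ S) ∧
    ∃ (a b : ℝ) (c : Fin (d - d₁ + 1) → {j : Fin d // d₁ ≤ (j : ℕ)} → ℝ), a < b ∧
      LinearIndependent ℝ (fun l : Fin (d - d₁) => c l.succ - c 0) ∧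
      Set.Ioo a b ⊆ ⋂ l, {t | ∃ x ∈ (P.map X).support,
        (∀ j : {j : Fin d // d₁ ≤ (j : ℕ)}, x j = c l j) ∧ t = inner ℝ θ₀ x}

/-- Conditionally on `X`, the error `e` has mean zero and is uniformly sub-Gaussian. -/
def SubGaussianError (P : Measure Ω) (X : Ω → EuclideanSpace ℝ (Fin d)) (e : Ω → ℝ) : Prop :=
  (∃ K : ℝ, 0 < K ∧ Integrable (fun ω => Real.exp (e ω ^ 2 / K)) P ∧
    ∀ᵐ ω ∂P,
      K * (P[fun ω' => Real.exp (e ω' ^ 2 / K) - 1 | MeasurableSpace.comap X inferInstance]) ω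
        ≤ 1) ∧
  P[e | MeasurableSpace.comap X inferInstance] =ᵐ[P] 0

/-- The matrix `E[X Xᵀ m'(θᵀX)²]`, with the derivative of `m` taken within `D`. -/
def weightedMoment (P : Measure Ω) (X : Ω → EuclideanSpace ℝ (Fin d)) (D : Set ℝ)
    (m : ℝ → ℝ) (θ : EuclideanSpace ℝ (Fin d)) : Matrix (Fin d) (Fin d) ℝ :=
  Matrix.of fun i j => ∫ ω, X ω i * X ω j * (derivWithin m D (inner ℝ θ (X ω))) ^ 2 ∂P

/-- The covariance matrix of `X`. -/
def covMatrix (P : Measure Ω) (X : Ω → EuclideanSpace ℝ (Fin d)) :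
    Matrix (Fin d) (Fin d) ℝ :=
  Matrix.of fun i j => cov[fun ω => X ω i, fun ω => X ω j; P]

/-- The conditional distribution of `X` given `θᵀX` is nondegenerate: for almost every `t`, no
linear functional other than the multiples of `θᵀx` is almost surely constant under the law of
`X` given `θᵀX = t`, i.e. that law is not carried by a proper affine subspace of the hyperplane
`{θᵀx = t}`. -/
def NondegenerateGivenIndex (P : Measure Ω) [IsFiniteMeasure P]
    (X : Ω → EuclideanSpace ℝ (Fin d)) (θ : EuclideanSpace ℝ (Fin d)) : Prop :=
  ∀ᵐ t ∂(P.map (fun ω => inner ℝ θ (X ω))),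
    ∀ v : EuclideanSpace ℝ (Fin d), v ∉ Submodule.span ℝ {θ} →
      ¬ ∃ a : ℝ, ∀ᵐ x ∂(condDistrib X (fun ω => (inner ℝ θ (X ω) : ℝ)) P t), inner ℝ v x = a

end ConvexSingleIndex

end

/-!
Write `T_θ = θᵀX`, `u = n^{1/5}`, and `‖·‖_n` for the empirical norm. The criterion at the estimators
is at most its value at `(m₀, θ₀)`, which gives the basic inequality
`‖m̂ ∘ T_θ̂ - m₀ ∘ T_θ₀‖_n² + λ² J²(m̂) ≤ 2 (ε, m̂ ∘ T_θ̂ - m₀ ∘ T_θ₀)_n + λ² J²(m₀)`.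
A bound for the noise term, a comparison of `‖·‖_n` with the population norm, and the stability of the
model under identification turn it into the rates.

**Noise.** A link of finite roughness is a primitive `m = prim a c g`, where `g` has increments
controlled by an energy of size `J²` (`IsLink`, `exists_prim_of_mem_linkClass`). For one index `θ`, the
range of `T_θ` is cut into `N ≈ u` cells of length and mass `O(1 / N)` (`IsKnots`), and `m` is the sum of
a piecewise linear function, from a space of dimension `2 N`, and a Taylor remainder. Conditionally on
the covariates the errors are sub-Gaussian (`IsSubG`), so that a chi-square bound controls their inner
products with the whole space (`IsSubG.measure_span_le`). The remainder is a mixture of step functions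
on the cells (`IsKnots.taylorRem_eq_integral`), to which the same quadratic bound applies. Together
(`IsSubG.measure_noise_le`), with probability `1 - O(N exp (-N))`,
`|(ε, m ∘ T_θ - m₀ ∘ T_θ₀)_n| ≲ u⁻² ‖m ∘ T_θ - m₀ ∘ T_θ₀‖_n + u⁻⁴ J(m)` for all `m` at once. No chaining
is needed. The failure probability is so small that a union bound extends this to a `1 / n`-net of the
indices, and the Lipschitz continuity of the links to all `θ`.

**Basic inequality.** Since `u⁻² = n^{-2/5} = O_p(λ)`, it follows (`exists_basic_bound`) that the
empirical error is `O_p(λ)` and that `J(m̂) = O_p(1)`. The value and the slope of `m̂` at the left endpoint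
are bounded because the variances of the `T_θ` are bounded from below. Hence `m̂` lies in a fixed ball of
links.

**Norms.** A ball of links has a cover of cardinality `exp (O(N))` with a resolution of order `N⁻²`,
found by rounding values and slopes at the knots and counting integer points (`exists_cover`). A lower
deviation bound for each representative shows that the population norm is at most a multiple of the
empirical norm, up to `O(u⁻²)` (`exists_norm_comparison`).

**Stability.** On a ball of convex links, `‖m ∘ T_θ - m₀ ∘ T_θ₀‖` dominates `‖θ - θ₀‖` and
`‖m ∘ T_θ₀ - m₀ ∘ T_θ₀‖` (`exists_stability`), by compactness and identifiability. If
`m ∘ T_θ = m₀ ∘ T_θ₀` almost surely, the partial derivatives in the direction of the first, absolutely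
continuous covariate agree almost surely (`NullOnLines.ae_slope_eq`). So the value and the slope of `m`
at `T_θ` are functions of `T_θ₀`. A convex function takes a given value with a given nonzero slope at one
point only, hence so is `T_θ` where the slope is not zero, and the nondegeneracy of `X` given `T_θ₀`
forces `θ = θ₀` (`IndexNondeg.identify`). The same nondegeneracy excludes sequences along which the
error is of smaller order than `‖θ - θ₀‖` (`exists_norm_sub_sq_le`).
-/

noncomputable section

namespace ConvexSingleIndex

section

/-! ### Link functions as primitives of their derivatives -/

/-- The function with value `c` at `a` and derivative `g`. -/
def prim (a c : ℝ) (g : ℝ → ℝ) (t : ℝ) : ℝ := c + ∫ u in a..t, g u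

/-- `g` is the derivative of a link function with roughness at most `J`, extended to the whole line.
The roughness enters only through a monotone function `V`, which plays the role of
`t ↦ ∫_{-∞}^t (g')²`, and the Cauchy–Schwarz bound for the increments of `g` in terms of those
of `V`. -/
structure IsLink (J : ℝ) (g : ℝ → ℝ) : Prop where
  cont : Continuous g
  energy : ∃ V : ℝ → ℝ, Monotone V ∧ (∀ s t, V t - V s ≤ J ^ 2) ∧
    ∀ s t, s ≤ t → (g t - g s) ^ 2 ≤ (t - s) * (V t - V s)

theorem prim_sub {g : ℝ → ℝ} (hg : Continuous g) (a c s t : ℝ) :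
    prim a c g t - prim a c g s = ∫ u in s..t, g u := by
  unfold prim
  rw [add_sub_add_left_eq_sub]
  exact intervalIntegral.integral_interval_sub_left (hg.intervalIntegrable _ _)
    (hg.intervalIntegrable _ _)

theorem hasDerivAt_prim {g : ℝ → ℝ} (hg : Continuous g) (a c t : ℝ) :
    HasDerivAt (prim a c g) (g t) t := by
  unfold prim
  exact (intervalIntegral.integral_hasDerivAt_right (hg.intervalIntegrable _ _)
    (hg.stronglyMeasurableAtFilter _ _) hg.continuousAt).const_add c

theorem continuous_prim {g : ℝ → ℝ} (hg : Continuous g) (a c : ℝ) : Continuous (prim a c g) :=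
  continuous_iff_continuousAt.2 fun t => (hasDerivAt_prim hg a c t).continuousAt

@[simp] theorem prim_self (a c : ℝ) (g : ℝ → ℝ) : prim a c g a = c := by simp [prim]

/-- Cauchy–Schwarz inequality for the integral of `φ · 1`. -/
theorem sq_integral_le {s t : ℝ} (hst : s ≤ t) {φ : ℝ → ℝ} (h1 : IntervalIntegrable φ volume s t)
    (h2 : IntervalIntegrable (fun u => φ u ^ 2) volume s t) :
    (∫ u in s..t, φ u) ^ 2 ≤ (t - s) * ∫ u in s..t, φ u ^ 2 := by
  rcases hst.eq_or_lt with rfl | hlt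
  · simp
  set I := ∫ u in s..t, φ u
  set c := I / (t - s)
  have hpos : 0 < t - s := by linarith
  have h0 : 0 ≤ ∫ u in s..t, (φ u - c) ^ 2 :=
    intervalIntegral.integral_nonneg hst fun u _ => sq_nonneg _
  have h3 : (∫ u in s..t, (φ u - c) ^ 2) = (∫ u in s..t, φ u ^ 2) - 2 * c * I + c ^ 2 * (t - s) := by
    have : (fun u => (φ u - c) ^ 2) = fun u => (φ u ^ 2 - (2 * c) * φ u) + c ^ 2 := by
      funext u; ring
    rw [this, intervalIntegral.integral_add (h2.sub (h1.const_mul _)) (by simp),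
      intervalIntegral.integral_sub h2 (h1.const_mul _), intervalIntegral.integral_const_mul]
    simp [I]; ring
  rw [h3] at h0
  have hc : c * (t - s) = I := div_mul_cancel₀ _ hpos.ne'
  have h4 := mul_nonneg hpos.le h0
  nlinarith

variable {a b : ℝ}

/-- A member of the link class with finite roughness agrees on `[a, b]` with a primitive. -/
theorem exists_prim_of_mem_linkClass (hab : a < b) {m : ℝ → ℝ}
    (hm : m ∈ LinkClass (Set.Icc a b)) (hr : roughnessSq (Set.Icc a b) m < ∞) :
    ∃ c g, IsLink (Real.sqrt (roughnessSq (Set.Icc a b) m).toReal) g ∧ Monotone g ∧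
      (∀ t ∈ Set.Icc a b, m t = prim a c g t) ∧
      ∀ t ∈ Set.Icc a b, derivWithin m (Set.Icc a b) t = g t := by
  obtain ⟨hconv, hdiff, hac⟩ := hm
  set D := Set.Icc a b with hD
  set g₁ := derivWithin m D with hg₁
  have haD : a ∈ D := Set.left_mem_Icc.2 hab.le
  have hbD : b ∈ D := Set.right_mem_Icc.2 hab.le
  have hcont : ContinuousOn g₁ D := by
    have := (hac a haD b hbD).continuousOn
    rwa [Set.uIcc_of_le hab.le] at this
  have hmono : MonotoneOn g₁ D := hconv.monotoneOn_derivWithin hdiff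
  set g := Set.IccExtend hab.le (D.domRestrict g₁) with hg
  have hgD : ∀ t ∈ D, g t = g₁ t := fun t ht => by
    rw [hg, Set.IccExtend_of_mem _ _ ht]; rfl
  have hgc : Continuous g := (continuousOn_iff_continuous_domRestrict.1 hcont).Icc_extend'
  have hgm : Monotone g := by
    apply Monotone.IccExtend
    intro s t hst
    exact hmono s.2 t.2 hst
  -- the second derivative
  set φ := deriv g₁ with hφ
  have hφm : Measurable φ := measurable_deriv _
  have hae : ∀ᵐ u ∂(volume.restrict D), derivWithin g₁ D u = φ u := by
    rw [hD, ← restrict_Ioo_eq_restrict_Icc]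
    filter_upwards [self_mem_ae_restrict measurableSet_Ioo] with u hu
    exact derivWithin_of_mem_nhds (Icc_mem_nhds hu.1 hu.2)
  have hrough : roughnessSq D m = ∫⁻ u in D, ENNReal.ofReal (φ u ^ 2) := by
    unfold roughnessSq
    apply lintegral_congr_ae
    filter_upwards [hae] with u hu
    rw [← hg₁, hu]
  have hint : IntegrableOn (fun u => φ u ^ 2) D := by
    refine ⟨(hφm.pow_const 2).aestronglyMeasurable, ?_⟩
    rw [hasFiniteIntegral_iff_ofReal (Eventually.of_forall fun u => sq_nonneg _), ← hrough]
    exact hr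
  have hsub : ∀ s t, s ≤ t → (∫ u in D ∩ Set.Iic s, φ u ^ 2) ≤ ∫ u in D ∩ Set.Iic t, φ u ^ 2 := by
    intro s t hst
    refine setIntegral_mono_set (hint.mono_set Set.inter_subset_left)
      (Eventually.of_forall fun u => sq_nonneg _) ?_
    exact (Set.inter_subset_inter_right D (Set.Iic_subset_Iic.2 hst)).eventuallyLE
  have main : ∀ s t, s ∈ D → t ∈ D → s ≤ t → (g t - g s) ^ 2 ≤ (t - s) *
      ((∫ u in D ∩ Set.Iic t, φ u ^ 2) - ∫ u in D ∩ Set.Iic s, φ u ^ 2) := by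
    intro s t hsD htD hst
    have has := hsD.1
    have htb := htD.2
    rw [hgD s hsD, hgD t htD, ← (hac s hsD t htD).integral_deriv_eq_sub]
    have hi2 : IntervalIntegrable (fun u => φ u ^ 2) volume s t := by
      rw [intervalIntegrable_iff_integrableOn_Ioc_of_le hst]
      exact hint.mono_set fun u hu => ⟨has.trans hu.1.le, hu.2.trans htb⟩
    have hVV : (∫ u in D ∩ Set.Iic t, φ u ^ 2) - ∫ u in D ∩ Set.Iic s, φ u ^ 2
        = ∫ u in s..t, φ u ^ 2 := by
      have hset : D ∩ Set.Iic t = (D ∩ Set.Iic s) ∪ Set.Ioc s t := by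
        ext u; simp only [hD, Set.mem_inter_iff, Set.mem_Icc, Set.mem_Iic, Set.mem_union,
          Set.mem_Ioc]
        constructor
        · rintro ⟨⟨h1, h2⟩, h3⟩
          rcases le_or_gt u s with h | h
          · exact Or.inl ⟨⟨h1, h2⟩, h⟩
          · exact Or.inr ⟨h, h3⟩
        · rintro (⟨⟨h1, h2⟩, h3⟩ | ⟨h1, h2⟩)
          · exact ⟨⟨h1, h2⟩, h3.trans hst⟩
          · exact ⟨⟨has.trans h1.le, h2.trans htb⟩, h2⟩
      rw [hset, setIntegral_union ?_ measurableSet_Ioc (hint.mono_set Set.inter_subset_left)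
        ((intervalIntegrable_iff_integrableOn_Ioc_of_le hst).1 hi2),
        intervalIntegral.integral_of_le hst]
      · ring
      · rw [Set.disjoint_left]
        rintro u ⟨_, h1⟩ ⟨h2, _⟩
        exact absurd h1 (not_le.2 h2)
    rw [hVV]
    exact sq_integral_le hst (hac s hsD t htD).intervalIntegrable_deriv hi2
  refine ⟨m a, g, ⟨hgc, fun t => ∫ u in D ∩ Set.Iic t, φ u ^ 2, hsub, ?_, ?_⟩, hgm, ?_, ?_⟩
  · intro s t
    have h1 : ∫ u in D ∩ Set.Iic t, φ u ^ 2 ≤ ∫ u in D, φ u ^ 2 :=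
      setIntegral_mono_set hint (Eventually.of_forall fun u => sq_nonneg _)
        Set.inter_subset_left.eventuallyLE
    have h2 : 0 ≤ ∫ u in D ∩ Set.Iic s, φ u ^ 2 := integral_nonneg fun u => sq_nonneg _
    rw [Real.sq_sqrt ENNReal.toReal_nonneg, hrough,
      ← integral_eq_lintegral_of_nonneg_ae (Eventually.of_forall fun u => sq_nonneg _)
        (hφm.pow_const 2).aestronglyMeasurable]
    simp only; linarith
  · intro s t hst
    obtain ⟨s', hs'⟩ : ∃ r : ℝ, r = (Set.projIcc a b hab.le s).1 := ⟨_, rfl⟩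
    obtain ⟨t', ht'⟩ : ∃ r : ℝ, r = (Set.projIcc a b hab.le t).1 := ⟨_, rfl⟩
    have hs'D : s' ∈ D := hs' ▸ (Set.projIcc a b hab.le s).2
    have ht'D : t' ∈ D := ht' ▸ (Set.projIcc a b hab.le t).2
    have hst' : s' ≤ t' := hs' ▸ ht' ▸ Set.monotone_projIcc hab.le hst
    have e1 : g s = g s' := by
      rw [hg, hs', Set.IccExtend_val]; rfl
    have e2 : g t = g t' := by
      rw [hg, ht', Set.IccExtend_val]; rfl
    have hlen : t' - s' ≤ t - s := by
      simp only [hs', ht', Set.coe_projIcc]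
      rcases max_cases a (min b s) with h1 | h1 <;> rcases max_cases a (min b t) with h2 | h2 <;>
      rcases min_cases b s with h3 | h3 <;> rcases min_cases b t with h4 | h4 <;> linarith
    have hV : ∀ r, (∫ u in D ∩ Set.Iic ((Set.projIcc a b hab.le r : Set.Icc a b) : ℝ), φ u ^ 2)
        = ∫ u in D ∩ Set.Iic r, φ u ^ 2 := by
      intro r
      rcases le_total a r with h | h
      · congr 2
        ext u
        simp only [hD, Set.mem_inter_iff, Set.mem_Icc, Set.mem_Iic, Set.coe_projIcc, le_max_iff,
          le_min_iff]
        constructor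
        · rintro ⟨h1, h2 | h2⟩
          · exact ⟨h1, h2.trans h⟩
          · exact ⟨h1, h2.2⟩
        · rintro ⟨h1, h2⟩
          exact ⟨h1, Or.inr ⟨h1.2, h2⟩⟩
      · rw [Set.projIcc_of_le_left hab.le h]
        have h1 : volume (D ∩ Set.Iic a) = 0 := by
          refine measure_mono_null (t := {a}) (fun u hu => ?_) (by simp)
          exact le_antisymm hu.2 hu.1.1
        have h2 : volume (D ∩ Set.Iic r) = 0 :=
          measure_mono_null (Set.inter_subset_inter_right D (Set.Iic_subset_Iic.2 h)) h1
        rw [setIntegral_measure_zero _ h1, setIntegral_measure_zero _ h2]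
    rw [e1, e2]
    have h3 := main s' t' hs'D ht'D hst'
    rw [hs', ht', hV s, hV t, ← hs', ← ht'] at h3
    refine h3.trans (mul_le_mul_of_nonneg_right hlen (sub_nonneg.2 (hsub s t hst)))
  · intro t ht
    unfold prim
    have h1 : ∫ u in a..t, g u = m t - m a := by
      apply intervalIntegral.integral_eq_sub_of_hasDerivAt_of_le ht.1
      · exact hdiff.continuousOn.mono fun u hu => ⟨hu.1, hu.2.trans ht.2⟩
      · intro u hu
        have huD : u ∈ D := ⟨hu.1.le, hu.2.le.trans ht.2⟩
        rw [hgD u huD]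
        exact (hdiff u huD).hasDerivWithinAt.hasDerivAt (Icc_mem_nhds hu.1 (hu.2.trans_le ht.2))
      · exact hgc.intervalIntegrable _ _
    rw [h1]; ring
  · intro t ht; exact (hgD t ht).symm

/-- The increments of `g` over short intervals, in terms of those of the energy `V`. -/
theorem abs_increment_le {V g : ℝ → ℝ}
    (h : ∀ s t, s ≤ t → (g t - g s) ^ 2 ≤ (t - s) * (V t - V s))
    (hV : Monotone V) {s t h₀ : ℝ} (hst : s ≤ t) (hh : t - s ≤ h₀) :
    |g t - g s| ≤ Real.sqrt h₀ * Real.sqrt (V t - V s) := by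
  have h0 : 0 ≤ t - s := by linarith
  rw [← Real.sqrt_mul (h0.trans hh)]
  apply Real.abs_le_sqrt
  exact (h s t hst).trans (mul_le_mul_of_nonneg_right hh (sub_nonneg.2 (hV hst)))

theorem prim_sub_taylor {g : ℝ → ℝ} (hg : Continuous g) (a c s t : ℝ) :
    prim a c g t - prim a c g s - g s * (t - s) = ∫ u in s..t, (g u - g s) := by
  rw [prim_sub hg, intervalIntegral.integral_sub (hg.intervalIntegrable _ _) (by simp)]
  simp; ring

theorem prim_taylor_abs_le {g : ℝ → ℝ} (hg : Continuous g) {a c s t B : ℝ} (hst : s ≤ t)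
    (hB : ∀ u ∈ Set.Icc s t, |g u - g s| ≤ B) :
    |prim a c g t - prim a c g s - g s * (t - s)| ≤ (t - s) * B := by
  rw [prim_sub_taylor hg, ← Real.norm_eq_abs]
  have := intervalIntegral.norm_integral_le_of_norm_le_const (a := s) (b := t) (C := B)
    (f := fun u => g u - g s) (fun u hu => by
      rw [Set.uIoc_of_le hst] at hu
      exact hB u ⟨hu.1.le, hu.2⟩)
  rw [abs_of_nonneg (by linarith : (0:ℝ) ≤ t - s)] at this
  linarith

theorem IsLink.abs_sub_le {J : ℝ} {g : ℝ → ℝ} (h : IsLink J g) (hJ : 0 ≤ J) {s t : ℝ}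
    (hst : s ≤ t) : |g t - g s| ≤ J * Real.sqrt (t - s) := by
  obtain ⟨V, hV, hVJ, hVg⟩ := h.energy
  calc |g t - g s| ≤ _ := abs_increment_le hVg hV hst le_rfl
    _ ≤ Real.sqrt (t - s) * J := by
        gcongr
        rw [Real.sqrt_le_left hJ]; exact hVJ s t
    _ = _ := mul_comm _ _

theorem IsLink.abs_le {J : ℝ} {g : ℝ → ℝ} (h : IsLink J g) (hJ : 0 ≤ J) {t : ℝ}
    (ht : t ∈ Set.Icc a b) : |g t| ≤ |g a| + J * Real.sqrt (b - a) := by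
  have h1 := h.abs_sub_le hJ ht.1
  have h2 : J * Real.sqrt (t - a) ≤ J * Real.sqrt (b - a) := by
    gcongr; exact ht.2
  have h3 : |g t| ≤ |g a| + |g t - g a| := by
    have := abs_add_le (g a) (g t - g a); simpa using this
  linarith

theorem IsLink.mono {J J' : ℝ} {g : ℝ → ℝ} (h : IsLink J g) (hJ : 0 ≤ J) (hJJ : J ≤ J') :
    IsLink J' g := by
  obtain ⟨V, hV, hVJ, hVg⟩ := h.energy
  exact ⟨h.cont, V, hV, fun s t => (hVJ s t).trans (by gcongr), hVg⟩

theorem prim_abs_sub_le {g : ℝ → ℝ} (hg : Continuous g) {a₀ c G s t : ℝ}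
    (hG : ∀ u ∈ Set.Icc a b, |g u| ≤ G) (hs : s ∈ Set.Icc a b) (ht : t ∈ Set.Icc a b) :
    |prim a₀ c g t - prim a₀ c g s| ≤ G * |t - s| := by
  rw [prim_sub hg, ← Real.norm_eq_abs]
  apply intervalIntegral.norm_integral_le_of_norm_le_const
  intro u hu
  exact hG u (Set.uIcc_subset_Icc hs ht (Set.uIoc_subset_uIcc hu))

end

section

/-! ### Partitions adapted to a distribution -/

/-- Knots `τ₀ = a ≤ ⋯ ≤ τ_N = b` such that every open gap is short and has small mass. Masses of the
knots themselves are not controlled, so that distributions with atoms are allowed. -/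
structure IsKnots (a b : ℝ) (ρ : Measure ℝ) (N : ℕ) (τ : ℕ → ℝ) : Prop where
  mono : Monotone τ
  zero : τ 0 = a
  last : τ N = b
  length_le : ∀ i < N, τ (i + 1) - τ i ≤ 2 * (b - a) / N
  mass_le : ∀ i < N, ρ (Set.Ioo (τ i) (τ (i + 1))) ≤ ENNReal.ofReal (2 / N)

/-- Quantiles of the sum of `ρ` and the uniform distribution on `[a, b]` are such knots. -/
theorem exists_isKnots {a b : ℝ} (hab : a < b) (ρ : Measure ℝ) [IsProbabilityMeasure ρ]
    (hρ : ∀ᵐ t ∂ρ, t ≤ b) {N : ℕ} (hN : 0 < N) : ∃ τ, IsKnots a b ρ N τ := by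
  have hN' : (0 : ℝ) < N := by exact_mod_cast hN
  have hL : 0 < b - a := by linarith
  set Φ : ℝ → ℝ := fun t => ρ.real (Set.Iic t) + (t - a) / (b - a) with hΦ
  have hΦm : Monotone Φ := by
    intro s t hst
    have h1 : ρ.real (Set.Iic s) ≤ ρ.real (Set.Iic t) := measureReal_mono (Set.Iic_subset_Iic.2 hst)
    have h2 : (s - a) / (b - a) ≤ (t - a) / (b - a) := by gcongr
    exact add_le_add h1 h2
  have hΦb : Φ b = 2 := by
    have : ρ.real (Set.Iic b) = 1 := by
      rw [measureReal_def, prob_compl_eq_zero_iff measurableSet_Iic |>.1 hρ]; simp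
    simp only [hΦ, this, div_self hL.ne']; norm_num
  set S : ℕ → Set ℝ := fun i => {t | t ∈ Set.Icc a b ∧ 2 * (i : ℝ) / N ≤ Φ t} with hS
  have hSb : ∀ i, i ≤ N → b ∈ S i := fun i hi => by
    refine ⟨Set.right_mem_Icc.2 hab.le, ?_⟩
    rw [hΦb, div_le_iff₀ hN']
    have : (i : ℝ) ≤ N := by exact_mod_cast hi
    linarith
  have hbdd : ∀ i, BddBelow (S i) := fun i => ⟨a, fun t ht => ht.1.1⟩
  have hinf_mem : ∀ i, i ≤ N → sInf (S i) ∈ Set.Icc a b := fun i hi =>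
    ⟨le_csInf ⟨b, hSb i hi⟩ fun t ht => ht.1.1, csInf_le (hbdd i) (hSb i hi)⟩
  have gap : ∀ i < N, ∀ s t, sInf (S i) < s → s ≤ t → t < sInf (S (i + 1)) →
      ρ.real (Set.Ioc s t) + (t - s) / (b - a) ≤ 2 / N := by
    intro i hi s t hs hst ht
    obtain ⟨t', ht', hlt⟩ := exists_lt_of_csInf_lt ⟨b, hSb i hi.le⟩ hs
    have h1 : 2 * (i : ℝ) / N ≤ Φ s := ht'.2.trans (hΦm hlt.le)
    have h2 : Φ t < 2 * ((i + 1 : ℕ) : ℝ) / N := by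
      by_contra hcon
      push Not at hcon
      have htm : t ∈ S (i + 1) := by
        refine ⟨⟨?_, ?_⟩, hcon⟩
        · exact (hinf_mem i hi.le).1.trans (hs.le.trans hst)
        · exact ht.le.trans (hinf_mem (i + 1) hi).2
      exact absurd (csInf_le (hbdd _) htm) (not_le.2 ht)
    have h3 : ρ.real (Set.Ioc s t) = ρ.real (Set.Iic t) - ρ.real (Set.Iic s) := by
      rw [← Set.Iic_sdiff_Iic, measureReal_sdiff (Set.Iic_subset_Iic.2 hst) measurableSet_Iic]
    have h4 : 2 * ((i + 1 : ℕ) : ℝ) / N = 2 * (i : ℝ) / N + 2 / N := by push_cast; ring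
    have h5 : (t - s) / (b - a) = (t - a) / (b - a) - (s - a) / (b - a) := by ring
    simp only [hΦ] at h1 h2
    rw [h3, h5]; linarith
  have hmono : ∀ i j, i ≤ j → j ≤ N → sInf (S i) ≤ sInf (S j) := by
    intro i j hij hj
    apply csInf_le_csInf (hbdd i) ⟨b, hSb j hj⟩
    intro t ht
    refine ⟨ht.1, le_trans ?_ ht.2⟩
    have : (i : ℝ) ≤ j := by exact_mod_cast hij
    gcongr
  refine ⟨fun i => sInf (S (min i N)), ?_, ?_, ?_, ?_, ?_⟩
  · intro i j hij
    exact hmono _ _ (min_le_min_right N hij) (min_le_right _ _)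
  · simp only [Nat.zero_le, inf_of_le_left]
    refine le_antisymm (csInf_le (hbdd 0) ⟨Set.left_mem_Icc.2 hab.le, ?_⟩) (hinf_mem 0 hN.le).1
    simp [hΦ]
  · simp only [min_self]
    refine le_antisymm (hinf_mem N le_rfl).2 (le_csInf ⟨b, hSb N le_rfl⟩ fun t ht => ?_)
    have h1 := ht.2
    rw [mul_div_assoc, div_self hN'.ne'] at h1
    have h2 : ρ.real (Set.Iic t) ≤ 1 := measureReal_le_one
    simp only [hΦ] at h1
    have h3 : 1 ≤ (t - a) / (b - a) := by linarith
    rw [le_div_iff₀ hL] at h3; linarith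
  · intro i hi
    simp only [min_eq_left hi.le, min_eq_left (Nat.succ_le_of_lt hi)]
    by_contra hcon
    push Not at hcon
    set d := sInf (S (i + 1)) - sInf (S i)
    have hd : 2 * (b - a) / N < d := hcon
    have h0 : 0 < 2 * (b - a) / N := by positivity
    set e := (d - 2 * (b - a) / N) / 4 with he
    have he0 : 0 < e := by rw [he]; linarith
    have h1 := gap i hi (sInf (S i) + e) (sInf (S (i + 1)) - e) (by linarith)
      (by linarith) (by linarith)
    have h2 : 0 ≤ ρ.real (Set.Ioc (sInf (S i) + e) (sInf (S (i + 1)) - e)) := measureReal_nonneg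
    have h3 : (sInf (S (i + 1)) - e - (sInf (S i) + e)) / (b - a) ≤ 2 / N := by linarith
    rw [div_le_iff₀ hL] at h3
    have h4 : 2 / (N : ℝ) * (b - a) = 2 * (b - a) / N := by ring
    linarith
  · intro i hi
    simp only [min_eq_left hi.le, min_eq_left (Nat.succ_le_of_lt hi)]
    rcases le_or_gt (sInf (S (i + 1))) (sInf (S i)) with hle | hlt
    · rw [Set.Ioo_eq_empty (not_lt.2 hle)]; simp
    set p := sInf (S i)
    set q := sInf (S (i + 1))
    obtain ⟨u, hu1, hu2, hu3⟩ := exists_seq_strictAnti_tendsto' (show p < (p + q) / 2 by linarith)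
    obtain ⟨v, hv1, hv2, hv3⟩ := exists_seq_strictMono_tendsto' (show (p + q) / 2 < q by linarith)
    have hU : Set.Ioo p q = ⋃ k, Set.Ioc (u k) (v k) := by
      ext t
      simp only [Set.mem_Ioo, Set.mem_iUnion, Set.mem_Ioc]
      constructor
      · rintro ⟨h1, h2⟩
        obtain ⟨k, hk1, hk2⟩ := ((hu3.eventually_lt_const h1).and
          (hv3.eventually_const_lt h2)).exists
        exact ⟨k, hk1, hk2.le⟩
      · rintro ⟨k, h1, h2⟩
        exact ⟨(hu2 k).1.trans h1, h2.trans_lt (hv2 k).2⟩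
    have hm : Monotone fun k => Set.Ioc (u k) (v k) := fun k l hkl =>
      Set.Ioc_subset_Ioc (hu1.antitone hkl) (hv1.monotone hkl)
    rw [hU]
    refine le_of_tendsto (tendsto_measure_iUnion_atTop hm) (Eventually.of_forall fun k => ?_)
    have hk := gap i hi (u k) (v k) (hu2 k).1 ((hu2 k).2.le.trans (hv2 k).1.le) (hv2 k).2
    have h0 : 0 ≤ (v k - u k) / (b - a) :=
      div_nonneg (sub_nonneg.2 ((hu2 k).2.le.trans (hv2 k).1.le)) hL.le
    rw [Function.comp_apply, ← ofReal_measureReal]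
    exact ENNReal.ofReal_le_ofReal (by linarith)

/-- Every point of `[a, b)` lies in one of the half-open cells. -/
theorem IsKnots.exists_cell {a b : ℝ} {ρ : Measure ℝ} {N : ℕ} {τ : ℕ → ℝ} (h : IsKnots a b ρ N τ)
    {t : ℝ} (hat : a ≤ t) (htb : t < b) : ∃ i < N, t ∈ Set.Ico (τ i) (τ (i + 1)) := by
  have hex : ∃ i, t < τ i := ⟨N, by rwa [h.last]⟩
  classical
  set k := Nat.find hex with hk
  have hk1 : t < τ k := Nat.find_spec hex
  have hk0 : k ≠ 0 := by
    intro h0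
    rw [h0, h.zero] at hk1
    exact absurd hat (not_le.2 hk1)
  obtain ⟨i, hi⟩ := Nat.exists_eq_succ_of_ne_zero hk0
  refine ⟨i, ?_, ?_, ?_⟩
  · have : k ≤ N := Nat.find_min' hex (by rwa [h.last])
    omega
  · exact not_lt.1 (Nat.find_min hex (by omega))
  · rw [hi] at hk1; exact hk1

theorem IsKnots.disjoint {a b : ℝ} {ρ : Measure ℝ} {N : ℕ} {τ : ℕ → ℝ} (h : IsKnots a b ρ N τ)
    {i j : ℕ} {t : ℝ} (hi : t ∈ Set.Ico (τ i) (τ (i + 1))) (hj : t ∈ Set.Ico (τ j) (τ (j + 1))) :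
    i = j := by
  by_contra hne
  rcases Nat.lt_or_gt_of_ne hne with hlt | hlt
  · have := h.mono (Nat.succ_le_of_lt hlt)
    exact absurd hi.2 (not_lt.2 (this.trans hj.1))
  · have := h.mono (Nat.succ_le_of_lt hlt)
    exact absurd hj.2 (not_lt.2 (this.trans hi.1))

end

section

/-! ### Sub-Gaussian errors given the covariates -/

variable {𝒳 : Type*} [MeasurableSpace 𝒳]

/-- For `(x, e) ∼ μ` the error `e` is sub-Gaussian given `x`, with variance proxy `2σ`. The
conditional exponential moments are tested against nonnegative functions of `x`, which avoids
conditional distributions. -/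
def IsSubG (μ : Measure (𝒳 × ℝ)) (σ : ℝ) : Prop :=
  ∀ (v : 𝒳 → ℝ≥0∞) (b : 𝒳 → ℝ), Measurable v → Measurable b →
    ∫⁻ z, v z.1 * ENNReal.ofReal (Real.exp (z.2 * b z.1 - σ * b z.1 ^ 2)) ∂μ ≤ ∫⁻ z, v z.1 ∂μ

/-- The covariates of a sample. -/
def covs {n : ℕ} (z : Fin n → 𝒳 × ℝ) : Fin n → 𝒳 := fun i => (z i).1

theorem measurable_covs {n : ℕ} : Measurable (covs : (Fin n → 𝒳 × ℝ) → Fin n → 𝒳) :=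
  measurable_pi_lambda _ fun i => (measurable_pi_apply i).fst

/-- The errors of an i.i.d. sample are jointly sub-Gaussian given all the covariates: the
coefficients may depend on the whole sample of covariates. The errors are integrated out one at a
time. -/
theorem IsSubG.lintegral_pi_le {μ : Measure (𝒳 × ℝ)} [IsProbabilityMeasure μ] {σ : ℝ}
    (h : IsSubG μ σ) (n : ℕ) : ∀ (w : (Fin n → 𝒳) → ℝ≥0∞) (a : (Fin n → 𝒳) → Fin n → ℝ),
    Measurable w → Measurable a →
    ∫⁻ z, w (covs z) * ENNReal.ofReal
      (Real.exp (∑ i, ((z i).2 * a (covs z) i - σ * a (covs z) i ^ 2)))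
        ∂(Measure.pi fun _ : Fin n => μ) ≤
    ∫⁻ z, w (covs z) ∂(Measure.pi fun _ : Fin n => μ) := by
  induction n with
  | zero => intro w a _ _; simp
  | succ n ih =>
    intro w a hw ha
    set e := MeasurableEquiv.piFinSuccAbove (fun _ : Fin (n + 1) => 𝒳 × ℝ) 0 with he
    have hmp := (measurePreserving_piFinSuccAbove (fun _ : Fin (n + 1) => μ) 0).symm
    have hcov : ∀ p : (𝒳 × ℝ) × (Fin n → 𝒳 × ℝ),
        covs (e.symm p) = Fin.cons p.1.1 (covs p.2) := by
      intro p
      funext i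
      refine Fin.cases ?_ (fun j => ?_) i <;> simp [covs, he, MeasurableEquiv.piFinSuccAbove]
    have h0 : ∀ p : (𝒳 × ℝ) × (Fin n → 𝒳 × ℝ), e.symm p 0 = p.1 := fun p => by
      simp [he, MeasurableEquiv.piFinSuccAbove]
    have hs : ∀ (p : (𝒳 × ℝ) × (Fin n → 𝒳 × ℝ)) (j : Fin n), e.symm p j.succ = p.2 j :=
      fun p j => by simp [he, MeasurableEquiv.piFinSuccAbove]
    have hcm : Measurable fun q : 𝒳 × (Fin n → 𝒳) => (Fin.cons q.1 q.2 : Fin (n + 1) → 𝒳) := by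
      refine measurable_pi_lambda _ fun i => ?_
      refine Fin.cases ?_ (fun j => ?_) i
      · exact measurable_fst
      · exact (measurable_pi_apply j).comp measurable_snd
    have hcm2 : Measurable fun p : (𝒳 × ℝ) × (Fin n → 𝒳 × ℝ) =>
        (Fin.cons p.1.1 (covs p.2) : Fin (n + 1) → 𝒳) :=
      hcm.comp (measurable_fst.fst.prodMk (measurable_covs.comp measurable_snd))
    -- both sides as integrals over the product of the first pair and the others
    have hL : ∀ F : (Fin (n + 1) → 𝒳 × ℝ) → ℝ≥0∞, Measurable F →
        ∫⁻ z, F z ∂(Measure.pi fun _ : Fin (n + 1) => μ) =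
        ∫⁻ p, F (e.symm p) ∂(μ.prod (Measure.pi fun _ : Fin n => μ)) := by
      intro F hF
      exact (hmp.lintegral_comp hF).symm
    have haz : ∀ i, Measurable fun p : (𝒳 × ℝ) × (Fin n → 𝒳 × ℝ) =>
        a (Fin.cons p.1.1 (covs p.2)) i := fun i =>
      (measurable_pi_apply i).comp (ha.comp hcm2)
    have hmeas1 : Measurable fun z : Fin (n + 1) → 𝒳 × ℝ => w (covs z) * ENNReal.ofReal
        (Real.exp (∑ i, ((z i).2 * a (covs z) i - σ * a (covs z) i ^ 2))) := by
      refine (hw.comp measurable_covs).mul (ENNReal.measurable_ofReal.comp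
        (Real.measurable_exp.comp (Finset.measurable_sum _ fun i _ => ?_)))
      have : Measurable fun z : Fin (n + 1) → 𝒳 × ℝ => a (covs z) i :=
        (measurable_pi_apply i).comp (ha.comp measurable_covs)
      exact ((measurable_pi_apply i).snd.mul this).sub ((this.pow_const 2).const_mul σ)
    rw [hL _ hmeas1, hL (fun z => w (covs z)) (hw.comp measurable_covs)]
    simp only [hcov, Fin.sum_univ_succ, h0, hs]
    set E0 : (𝒳 × ℝ) × (Fin n → 𝒳 × ℝ) → ℝ≥0∞ := fun p => w (Fin.cons p.1.1 (covs p.2)) *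
      ENNReal.ofReal (Real.exp (p.1.2 * a (Fin.cons p.1.1 (covs p.2)) 0 -
        σ * a (Fin.cons p.1.1 (covs p.2)) 0 ^ 2)) with hE0
    have hE0m : Measurable E0 := by
      refine (hw.comp hcm2).mul (ENNReal.measurable_ofReal.comp (Real.measurable_exp.comp ?_))
      exact (measurable_fst.snd.mul (haz 0)).sub (((haz 0).pow_const 2).const_mul σ)
    have hle : ∀ p : (𝒳 × ℝ), ∫⁻ z', w (Fin.cons p.1 (covs z')) * ENNReal.ofReal
        (Real.exp ((p.2 * a (Fin.cons p.1 (covs z')) 0 - σ * a (Fin.cons p.1 (covs z')) 0 ^ 2) +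
          ∑ i : Fin n, ((z' i).2 * a (Fin.cons p.1 (covs z')) i.succ -
            σ * a (Fin.cons p.1 (covs z')) i.succ ^ 2))) ∂(Measure.pi fun _ : Fin n => μ)
        ≤ ∫⁻ z', E0 (p, z') ∂(Measure.pi fun _ : Fin n => μ) := by
      intro p
      have hc1 : Measurable fun x : Fin n → 𝒳 => (Fin.cons p.1 x : Fin (n + 1) → 𝒳) :=
        hcm.comp (measurable_const.prodMk measurable_id)
      have hai : ∀ i, Measurable fun x : Fin n → 𝒳 => a (Fin.cons p.1 x) i := fun i =>
        (measurable_pi_apply i).comp (ha.comp hc1)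
      have := ih (fun x => w (Fin.cons p.1 x) * ENNReal.ofReal (Real.exp
        (p.2 * a (Fin.cons p.1 x) 0 - σ * a (Fin.cons p.1 x) 0 ^ 2)))
        (fun x i => a (Fin.cons p.1 x) i.succ)
        ((hw.comp hc1).mul (ENNReal.measurable_ofReal.comp (Real.measurable_exp.comp
          (((hai 0).const_mul p.2).sub (((hai 0).pow_const 2).const_mul σ)))))
        (measurable_pi_lambda _ fun i => hai i.succ)
      refine le_trans (le_of_eq ?_) this
      refine lintegral_congr fun z' => ?_
      rw [Real.exp_add, ENNReal.ofReal_mul (Real.exp_pos _).le, mul_assoc]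
    rw [lintegral_prod _ (by
      have := hmeas1.comp e.symm.measurable
      refine (Measurable.aemeasurable ?_)
      convert this using 1
      funext p
      simp only [Function.comp, hcov, Fin.sum_univ_succ, h0, hs])]
    calc _ ≤ ∫⁻ p, ∫⁻ z', E0 (p, z') ∂(Measure.pi fun _ : Fin n => μ) ∂μ :=
          lintegral_mono hle
      _ = ∫⁻ z', ∫⁻ p, E0 (p, z') ∂μ ∂(Measure.pi fun _ : Fin n => μ) :=
          lintegral_lintegral_swap hE0m.aemeasurable
      _ ≤ ∫⁻ z', ∫⁻ p, w (Fin.cons p.1 (covs z')) ∂μ ∂(Measure.pi fun _ : Fin n => μ) := by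
          refine lintegral_mono fun z' => ?_
          have hc1 : Measurable fun x : 𝒳 => (Fin.cons x (covs z') : Fin (n + 1) → 𝒳) :=
            hcm.comp (measurable_id.prodMk measurable_const)
          exact h (fun x => w (Fin.cons x (covs z'))) (fun x => a (Fin.cons x (covs z')) 0)
            (hw.comp hc1) ((measurable_pi_apply 0).comp (ha.comp hc1))
      _ = _ := by
          exact (lintegral_prod_symm (fun p : (𝒳 × ℝ) × (Fin n → 𝒳 × ℝ) =>
            w (Fin.cons p.1.1 (covs p.2))) (hw.comp hcm2).aemeasurable).symm

/-- Exponential moments of a standard Gaussian variable: these linearize squares in the exponent. -/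
theorem lintegral_exp_mul_gaussian (y : ℝ) :
    ∫⁻ g, ENNReal.ofReal (Real.exp (y * g)) ∂(gaussianReal 0 1)
      = ENNReal.ofReal (Real.exp (y ^ 2 / 2)) := by
  have h1 := mgf_gaussianReal (p := gaussianReal 0 1) (X := id) (μ := 0) (v := 1) (by simp) y
  rw [← ofReal_integral_eq_lintegral_ofReal (integrable_exp_mul_gaussianReal y)
    (Eventually.of_forall fun _ => (Real.exp_pos _).le)]
  simp only [mgf, id] at h1
  rw [h1]; simp

theorem lintegral_exp_sq_gaussian_le :
    ∫⁻ g, ENNReal.ofReal (Real.exp (g ^ 2 / 4)) ∂(gaussianReal 0 1) ≤ 2 := by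
  rw [gaussianReal_of_var_ne_zero _ one_ne_zero, lintegral_withDensity_eq_lintegral_mul _
    (measurable_gaussianPDF _ _) (by fun_prop)]
  have h1 : ∀ g : ℝ, (gaussianPDF 0 1 * fun g => ENNReal.ofReal (Real.exp (g ^ 2 / 4))) g =
      ENNReal.ofReal ((Real.sqrt (2 * Real.pi))⁻¹ * Real.exp (-(1 / 4) * g ^ 2)) := by
    intro g
    rw [Pi.mul_apply, gaussianPDF, ← ENNReal.ofReal_mul (gaussianPDFReal_nonneg _ _ _),
      gaussianPDFReal]
    congr 1
    rw [mul_assoc, ← Real.exp_add]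
    congr 2
    · simp
    · simp; ring
  simp_rw [h1]
  rw [← ofReal_integral_eq_lintegral_ofReal ((integrable_exp_neg_mul_sq (by norm_num)).const_mul _)
    (Eventually.of_forall fun _ => by positivity), integral_const_mul, integral_gaussian]
  rw [show (2 : ℝ≥0∞) = ENNReal.ofReal 2 by simp]
  apply ENNReal.ofReal_le_ofReal
  rw [inv_mul_le_iff₀ (by positivity), Real.sqrt_le_left (by positivity), mul_pow,
    Real.sq_sqrt (by positivity)]
  rw [div_div_eq_mul_div]; nlinarith [Real.pi_pos]

theorem lintegral_pi_prod {ι α : Type*} [Fintype ι] [MeasurableSpace α] {γ : Measure α}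
    [IsProbabilityMeasure γ] (f : ι → α → ℝ≥0∞) (hf : ∀ i, Measurable (f i)) :
    ∫⁻ g, ∏ i, f i (g i) ∂(Measure.pi fun _ : ι => γ) = ∏ i, ∫⁻ t, f i t ∂γ := by
  rw [lintegral_prod_eq_prod_lintegral_of_indepFun Finset.univ (fun i (g : ι → α) => f i (g i))
    (iIndepFun_pi (X := f) fun i => (hf i).aemeasurable)
    (fun i => (hf i).comp (measurable_pi_apply i))]
  refine Finset.prod_congr rfl fun i _ => ?_
  exact (measurePreserving_eval (fun _ : ι => γ) i).lintegral_comp (hf i)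

/-- Exponential moment of a quadratic form in the errors. Each square is linearized by an
independent Gaussian factor, so that only exponential moments of linear forms are needed. -/
theorem IsSubG.lintegral_exp_sum_sq_le {μ : Measure (𝒳 × ℝ)} [IsProbabilityMeasure μ] {σ : ℝ}
    (h : IsSubG μ σ) (hσ : 0 < σ) {n : ℕ} {ι : Type*} [Fintype ι] {G : Set (Fin n → 𝒳)}
    (hG : MeasurableSet G) {ψ : (Fin n → 𝒳) → ι → Fin n → ℝ}
    (hψ : ∀ k i, Measurable fun x => ψ x k i) {B : ℝ} (hB0 : 0 < B)
    (hB : ∀ x ∈ G, ∀ c : ι → ℝ, ∑ i, (∑ k, c k * ψ x k i) ^ 2 ≤ B * ∑ k, c k ^ 2) :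
    ∫⁻ z, G.indicator 1 (covs z) * ENNReal.ofReal
      (Real.exp ((∑ k, (∑ i, (z i).2 * ψ (covs z) k i) ^ 2) / (8 * σ * B)))
        ∂(Measure.pi fun _ : Fin n => μ) ≤ 2 ^ Fintype.card ι := by
  set s := Real.sqrt (1 / (4 * σ * B)) with hs
  have hs2 : s ^ 2 = 1 / (4 * σ * B) := Real.sq_sqrt (by positivity)
  set γ := Measure.pi fun _ : ι => gaussianReal 0 1 with hγ
  set a : (ι → ℝ) → (Fin n → 𝒳) → Fin n → ℝ := fun g x i => ∑ k, s * g k * ψ x k i with ha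
  have hψz : ∀ k i, Measurable fun z : Fin n → 𝒳 × ℝ => ψ (covs z) k i := fun k i =>
    (hψ k i).comp measurable_covs
  have ham : ∀ g, Measurable (a g) := fun g =>
    measurable_pi_lambda _ fun i => Finset.measurable_sum _ fun k _ => (hψ k i).const_mul _
  have hlin : ∀ z : Fin n → 𝒳 × ℝ, ENNReal.ofReal
      (Real.exp ((∑ k, (∑ i, (z i).2 * ψ (covs z) k i) ^ 2) / (8 * σ * B))) =
      ∫⁻ g, ENNReal.ofReal (Real.exp (∑ i, (z i).2 * a g (covs z) i)) ∂γ := by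
    intro z
    set y : ι → ℝ := fun k => ∑ i, (z i).2 * ψ (covs z) k i with hy
    have h1 : ∀ g : ι → ℝ, ENNReal.ofReal (Real.exp (∑ i, (z i).2 * a g (covs z) i)) =
        ∏ k, ENNReal.ofReal (Real.exp ((s * y k) * g k)) := by
      intro g
      rw [← ENNReal.ofReal_prod_of_nonneg fun k _ => (Real.exp_pos _).le, ← Real.exp_sum]
      congr 2
      simp only [ha, hy, Finset.mul_sum, Finset.sum_mul]
      rw [Finset.sum_comm]
      exact Finset.sum_congr rfl fun k _ => Finset.sum_congr rfl fun i _ => by ring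
    simp_rw [h1]
    rw [hγ, lintegral_pi_prod (fun k t => ENNReal.ofReal (Real.exp ((s * y k) * t)))
      (fun k => by fun_prop)]
    simp_rw [lintegral_exp_mul_gaussian]
    rw [← ENNReal.ofReal_prod_of_nonneg fun k _ => (Real.exp_pos _).le, ← Real.exp_sum]
    congr 2
    rw [Finset.sum_div]
    refine Finset.sum_congr rfl fun k _ => ?_
    change y k ^ 2 / _ = _
    rw [mul_pow, hs2]; field_simp; ring
  have hGm : Measurable fun z : Fin n → 𝒳 × ℝ => G.indicator (1 : (Fin n → 𝒳) → ℝ≥0∞) (covs z) :=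
    (measurable_one.indicator hG).comp measurable_covs
  have hjm : Measurable fun p : (Fin n → 𝒳 × ℝ) × (ι → ℝ) =>
      G.indicator (1 : (Fin n → 𝒳) → ℝ≥0∞) (covs p.1) *
        ENNReal.ofReal (Real.exp (∑ i, (p.1 i).2 * a p.2 (covs p.1) i)) := by
    refine (hGm.comp measurable_fst).mul (ENNReal.measurable_ofReal.comp
      (Real.measurable_exp.comp (Finset.measurable_sum _ fun i _ => ?_)))
    refine ((measurable_pi_apply i).comp measurable_fst).snd.mul
      (Finset.measurable_sum _ fun k _ => ?_)
    have h1 : Measurable fun p : (Fin n → 𝒳 × ℝ) × (ι → ℝ) => ψ (covs p.1) k i :=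
      (hψz k i).comp measurable_fst
    exact (((measurable_pi_apply k).comp measurable_snd).const_mul s).mul h1
  calc _ = ∫⁻ z, ∫⁻ g, G.indicator 1 (covs z) *
        ENNReal.ofReal (Real.exp (∑ i, (z i).2 * a g (covs z) i)) ∂γ
          ∂(Measure.pi fun _ : Fin n => μ) := by
        refine lintegral_congr fun z => ?_
        rw [hlin z, lintegral_const_mul']
        by_cases hz : covs z ∈ G <;> simp [hz]
    _ = ∫⁻ g, ∫⁻ z, G.indicator 1 (covs z) *
        ENNReal.ofReal (Real.exp (∑ i, (z i).2 * a g (covs z) i))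
          ∂(Measure.pi fun _ : Fin n => μ) ∂γ := lintegral_lintegral_swap hjm.aemeasurable
    _ ≤ ∫⁻ g, ∏ k, ENNReal.ofReal (Real.exp (g k ^ 2 / 4)) ∂γ := by
        refine lintegral_mono fun g => ?_
        have h1 := h.lintegral_pi_le n
          (fun x => G.indicator 1 x * ENNReal.ofReal (Real.exp (∑ i, σ * a g x i ^ 2))) (a g)
          ((measurable_one.indicator hG).mul (ENNReal.measurable_ofReal.comp
            (Real.measurable_exp.comp (Finset.measurable_sum _ fun i _ =>
              (((measurable_pi_apply i).comp (ham g)).pow_const 2).const_mul σ)))) (ham g)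
        calc _ = _ := by
              refine lintegral_congr fun z => ?_
              rw [mul_assoc, ← ENNReal.ofReal_mul (Real.exp_pos _).le, ← Real.exp_add,
                ← Finset.sum_add_distrib]
              congr 3
              refine Finset.sum_congr rfl fun i _ => by ring
          _ ≤ _ := h1
          _ ≤ ∫⁻ _ : Fin n → 𝒳 × ℝ, ∏ k, ENNReal.ofReal (Real.exp (g k ^ 2 / 4))
                ∂(Measure.pi fun _ : Fin n => μ) := by
              refine lintegral_mono fun z => ?_
              by_cases hz : covs z ∈ G
              · simp only [hz, Set.indicator_of_mem, Pi.one_apply, one_mul]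
                rw [← ENNReal.ofReal_prod_of_nonneg fun k _ => (Real.exp_pos _).le, ← Real.exp_sum]
                apply ENNReal.ofReal_le_ofReal
                apply Real.exp_le_exp.2
                rw [← Finset.mul_sum, ← Finset.sum_div]
                have h2 := hB _ hz fun k => s * g k
                simp only [mul_pow, hs2, ← Finset.mul_sum] at h2
                calc σ * ∑ i, a g (covs z) i ^ 2
                    ≤ σ * (B * (1 / (4 * σ * B) * ∑ k, g k ^ 2)) :=
                      mul_le_mul_of_nonneg_left h2 hσ.le
                  _ = (∑ k, g k ^ 2) / 4 := by field_simp
              · simp [hz]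
          _ = _ := by simp
    _ = ∏ _k : ι, ∫⁻ t, ENNReal.ofReal (Real.exp (t ^ 2 / 4)) ∂(gaussianReal 0 1) :=
        lintegral_pi_prod (fun _ t => ENNReal.ofReal (Real.exp (t ^ 2 / 4))) fun _ => by fun_prop
    _ ≤ ∏ _k : ι, 2 := Finset.prod_le_prod' fun _ _ => lintegral_exp_sq_gaussian_le
    _ = _ := by simp

theorem measure_exp_tail_le {Ω' : Type*} [MeasurableSpace Ω'] {ν : Measure Ω'} {F : Ω' → ℝ≥0∞}
    (hF : Measurable F) {A : ℝ} (h : ∫⁻ ω, F ω ∂ν ≤ ENNReal.ofReal (Real.exp A)) (t : ℝ) :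
    ν {ω | ENNReal.ofReal (Real.exp (A + t)) ≤ F ω} ≤ ENNReal.ofReal (Real.exp (-t)) := by
  have h0 : ENNReal.ofReal (Real.exp (A + t)) ≠ 0 := by simp [Real.exp_pos]
  refine (meas_ge_le_lintegral_div hF.aemeasurable h0 ENNReal.ofReal_ne_top).trans ?_
  rw [ENNReal.div_le_iff h0 ENNReal.ofReal_ne_top, ← ENNReal.ofReal_mul (Real.exp_pos _).le,
    ← Real.exp_add]
  rwa [show -t + (A + t) = A by ring]

theorem two_pow_le_ofReal_exp (N : ℕ) : (2 : ℝ≥0∞) ^ N ≤ ENNReal.ofReal (Real.exp N) := by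
  rw [show (2 : ℝ≥0∞) = ENNReal.ofReal 2 by simp, ← ENNReal.ofReal_pow (by norm_num)]
  apply ENNReal.ofReal_le_ofReal
  rw [← mul_one (N : ℝ), Real.exp_nat_mul]
  gcongr
  have := Real.add_one_le_exp (1 : ℝ)
  linarith

section GramSchmidt

open InnerProductSpace

variable {E : Type*} [NormedAddCommGroup E] [InnerProductSpace ℝ E]

theorem norm_sum_gramSchmidtNormed_sq {N : ℕ} (f : Fin N → E) (c : Fin N → ℝ) :
    ‖∑ k, c k • gramSchmidtNormed ℝ f k‖ ^ 2 = ∑ k, (c k * ‖gramSchmidtNormed ℝ f k‖) ^ 2 := by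
  rw [← real_inner_self_eq_norm_sq, sum_inner]
  refine Finset.sum_congr rfl fun j _ => ?_
  rw [inner_sum, Finset.sum_eq_single j]
  · rw [real_inner_smul_left, real_inner_smul_right, real_inner_self_eq_norm_sq]; ring
  · intro k _ hk
    simp [gramSchmidtNormed, inner_smul_left, inner_smul_right,
      gramSchmidt_orthogonal ℝ f hk.symm]
  · simp

theorem norm_gramSchmidtNormed_eq {N : ℕ} (f : Fin N → E) (k : Fin N) :
    gramSchmidtNormed ℝ f k = 0 ∨ ‖gramSchmidtNormed ℝ f k‖ = 1 := by
  by_cases h : gramSchmidtNormed ℝ f k = 0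
  · exact Or.inl h
  · exact Or.inr (gramSchmidtNormed_unit_length' h)

theorem norm_sum_gramSchmidtNormed_sq_le {N : ℕ} (f : Fin N → E) (c : Fin N → ℝ) :
    ‖∑ k, c k • gramSchmidtNormed ℝ f k‖ ^ 2 ≤ ∑ k, c k ^ 2 := by
  rw [norm_sum_gramSchmidtNormed_sq]
  refine Finset.sum_le_sum fun k _ => ?_
  rcases norm_gramSchmidtNormed_eq f k with h | h <;> simp [h, sq_nonneg]

/-- The component of `w` along a span is seen by the orthonormalized family. -/
theorem inner_sq_le_of_mem_span {N : ℕ} (f : Fin N → E) (w : E) {v : E}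
    (hv : v ∈ Submodule.span ℝ (Set.range f)) :
    inner ℝ w v ^ 2 ≤ ‖v‖ ^ 2 * ∑ k, inner ℝ w (gramSchmidtNormed ℝ f k) ^ 2 := by
  rw [← span_gramSchmidt, ← span_gramSchmidtNormed_range] at hv
  obtain ⟨c, rfl⟩ := (Submodule.mem_span_range_iff_exists_fun ℝ).1 hv
  rw [norm_sum_gramSchmidtNormed_sq, inner_sum]
  refine le_trans (le_of_eq ?_) (Finset.sum_mul_sq_le_sq_mul_sq Finset.univ
    (fun k => c k * ‖gramSchmidtNormed ℝ f k‖) fun k => inner ℝ w (gramSchmidtNormed ℝ f k))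
  congr 1
  refine Finset.sum_congr rfl fun k _ => ?_
  rw [real_inner_smul_right]
  rcases norm_gramSchmidtNormed_eq f k with h | h
  · simp [h]
  · simp [h]

theorem measurable_gramSchmidt {α : Type*} [MeasurableSpace α] {n N : ℕ}
    {f : α → Fin N → EuclideanSpace ℝ (Fin n)} (hf : ∀ k, Measurable fun x => f x k)
    (k : Fin N) : Measurable fun x => gramSchmidt ℝ (f x) k := by
  induction k using WellFoundedLT.induction with
  | _ k ih =>
    simp only [gramSchmidt_def ℝ _ k, Submodule.starProjection_singleton]
    refine (hf k).sub (Finset.measurable_sum _ fun i hi => ?_)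
    have hi' := ih i (Finset.mem_Iio.1 hi)
    exact ((hi'.inner (hf k)).div (hi'.norm.pow_const 2)).smul hi'

theorem measurable_gramSchmidtNormed {α : Type*} [MeasurableSpace α] {n N : ℕ}
    {f : α → Fin N → EuclideanSpace ℝ (Fin n)} (hf : ∀ k, Measurable fun x => f x k)
    (k : Fin N) : Measurable fun x => gramSchmidtNormed ℝ (f x) k := by
  have h := measurable_gramSchmidt hf k
  exact h.norm.inv.smul h

/-- Uniformly over a linear span of dimension `N` that depends on the covariates only, the errors
have inner product at most `√(N + t)` times the norm, up to a constant. -/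
theorem IsSubG.measure_span_le {𝒳 : Type*} [MeasurableSpace 𝒳] {μ : Measure (𝒳 × ℝ)}
    [IsProbabilityMeasure μ] {σ : ℝ} (h : IsSubG μ σ) (hσ : 0 < σ) {n N : ℕ}
    {ψ : (Fin n → 𝒳) → Fin N → Fin n → ℝ} (hψ : ∀ k i, Measurable fun x => ψ x k i) (t : ℝ) :
    (Measure.pi fun _ : Fin n => μ) {z | ∃ c : Fin N → ℝ,
      8 * σ * (N + t) * ∑ i, (∑ k, c k * ψ (covs z) k i) ^ 2 <
        (∑ i, (z i).2 * ∑ k, c k * ψ (covs z) k i) ^ 2} ≤ ENNReal.ofReal (Real.exp (-t)) := by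
  set f : (Fin n → 𝒳) → Fin N → EuclideanSpace ℝ (Fin n) := fun x k => WithLp.toLp 2 (ψ x k)
    with hf
  have hfm : ∀ k, Measurable fun x => f x k := fun k =>
    (WithLp.measurable_toLp 2 (Fin n → ℝ)).comp (measurable_pi_lambda _ fun i => hψ k i)
  set e : (Fin n → 𝒳) → Fin N → Fin n → ℝ := fun x k i => gramSchmidtNormed ℝ (f x) k i with he
  have hem : ∀ k i, Measurable fun x => e x k i := fun k i =>
    (measurable_pi_apply i).comp ((WithLp.measurable_ofLp 2 (Fin n → ℝ)).comp
      (measurable_gramSchmidtNormed hfm k))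
  have hexp := h.lintegral_exp_sum_sq_le hσ (G := Set.univ) MeasurableSet.univ hem one_pos
    (fun x _ c => by
      have h1 := norm_sum_gramSchmidtNormed_sq_le (f x) c
      rw [EuclideanSpace.norm_sq_eq] at h1
      simpa [he] using h1)
  simp only [Set.indicator_univ, Pi.one_apply, one_mul, mul_one, Fintype.card_fin] at hexp
  set Q : (Fin n → 𝒳 × ℝ) → ℝ := fun z => ∑ k, (∑ i, (z i).2 * e (covs z) k i) ^ 2 with hQ
  have hQm : Measurable Q := Finset.measurable_sum _ fun k _ =>
    (Finset.measurable_sum _ fun i _ =>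
      (measurable_pi_apply i).snd.mul ((hem k i).comp measurable_covs)).pow_const 2
  refine le_trans (measure_mono ?_) (measure_exp_tail_le (A := N)
    (ENNReal.measurable_ofReal.comp (Real.measurable_exp.comp (hQm.div_const (8 * σ))))
    (hexp.trans (two_pow_le_ofReal_exp N)) t)
  rintro z ⟨c, hc⟩
  simp only [Set.mem_ofPred_eq, Function.comp]
  apply ENNReal.ofReal_le_ofReal
  apply Real.exp_le_exp.2
  rw [le_div_iff₀ (by positivity)]
  by_contra hcon
  push Not at hcon
  -- the vector in the span, and the vector of the errors
  set v : EuclideanSpace ℝ (Fin n) := ∑ k, c k • f (covs z) k with hv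
  set w : EuclideanSpace ℝ (Fin n) := WithLp.toLp 2 fun i => (z i).2 with hw
  have hvi : ∀ i, v i = ∑ k, c k * ψ (covs z) k i := fun i => by simp [hv, hf]
  have hmem : v ∈ Submodule.span ℝ (Set.range (f (covs z))) :=
    Submodule.sum_mem _ fun k _ => Submodule.smul_mem _ _ (Submodule.subset_span ⟨k, rfl⟩)
  have h1 := inner_sq_le_of_mem_span (f (covs z)) w hmem
  have h2 : inner ℝ w v = ∑ i, (z i).2 * ∑ k, c k * ψ (covs z) k i := by
    simp only [PiLp.inner_apply, RCLike.inner_apply, conj_trivial, hvi]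
    exact Finset.sum_congr rfl fun i _ => mul_comm _ _
  have h3 : ‖v‖ ^ 2 = ∑ i, (∑ k, c k * ψ (covs z) k i) ^ 2 := by
    rw [EuclideanSpace.norm_sq_eq]
    simp [hvi]
  have h4 : ∑ k, inner ℝ w (gramSchmidtNormed ℝ (f (covs z)) k) ^ 2 = Q z := by
    refine Finset.sum_congr rfl fun k _ => ?_
    simp only [PiLp.inner_apply, RCLike.inner_apply, conj_trivial, he, hw]
    congr 1
    exact Finset.sum_congr rfl fun i _ => mul_comm _ _
  rw [h2, h3, h4] at h1
  have h5 : (∑ i, (∑ k, c k * ψ (covs z) k i) ^ 2) * Q z ≤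
      (∑ i, (∑ k, c k * ψ (covs z) k i) ^ 2) * ((N + t) * (8 * σ)) :=
    mul_le_mul_of_nonneg_left hcon.le (Finset.sum_nonneg fun _ _ => sq_nonneg _)
  linarith

/-- The chi-square bound for a spanning family with any finite index type. -/
theorem IsSubG.measure_span_le' {𝒳 : Type*} [MeasurableSpace 𝒳] {μ : Measure (𝒳 × ℝ)}
    [IsProbabilityMeasure μ] {σ : ℝ} (h : IsSubG μ σ) (hσ : 0 < σ) {n : ℕ} {ι : Type*} [Fintype ι]
    {ψ : (Fin n → 𝒳) → ι → Fin n → ℝ} (hψ : ∀ k i, Measurable fun x => ψ x k i) (t : ℝ) :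
    (Measure.pi fun _ : Fin n => μ) {z | ∃ c : ι → ℝ,
      8 * σ * (Fintype.card ι + t) * ∑ i, (∑ k, c k * ψ (covs z) k i) ^ 2 <
        (∑ i, (z i).2 * ∑ k, c k * ψ (covs z) k i) ^ 2} ≤ ENNReal.ofReal (Real.exp (-t)) := by
  set e := Fintype.equivFin ι
  refine le_trans (measure_mono ?_) (h.measure_span_le hσ (N := Fintype.card ι)
    (ψ := fun x k i => ψ x (e.symm k) i) (fun k i => hψ _ i) t)
  rintro z ⟨c, hc⟩
  refine ⟨fun k => c (e.symm k), ?_⟩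
  have : ∀ i, ∑ k, c (e.symm k) * ψ (covs z) (e.symm k) i = ∑ k, c k * ψ (covs z) k i := fun i =>
    Equiv.sum_comp e.symm fun k => c k * ψ (covs z) k i
  simpa only [this] using hc

end GramSchmidt

end

section

/-! ### The noise on functions of one index -/

variable {𝒳 : Type*} [MeasurableSpace 𝒳]

/-- Chernoff bound for the number of sample points in a set of mass at most `p`. -/
theorem measure_count_le {α : Type*} [MeasurableSpace α] {ν : Measure α} [IsProbabilityMeasure ν]
    {A : Set α} (hA : MeasurableSet A) {p : ℝ} (hp : 0 ≤ p) (hν : ν A ≤ ENNReal.ofReal p) (n : ℕ) :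
    (Measure.pi fun _ : Fin n => ν) {z | 3 * n * p < ∑ i, A.indicator (1 : α → ℝ) (z i)} ≤
      ENNReal.ofReal (Real.exp (-(n * p))) := by
  have hm : Measurable (A.indicator (1 : α → ℝ)) := measurable_one.indicator hA
  have h1 : ∫⁻ y, ENNReal.ofReal (Real.exp (A.indicator (1 : α → ℝ) y)) ∂ν ≤
      ENNReal.ofReal (Real.exp (2 * p)) := by
    calc _ ≤ ∫⁻ y, (1 + A.indicator (fun _ => 2) y) ∂ν := by
          refine lintegral_mono fun y => ?_
          by_cases hy : y ∈ A
          · simp only [hy, Set.indicator_of_mem, Pi.one_apply]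
            rw [show (1 : ℝ≥0∞) + 2 = ENNReal.ofReal 3 by norm_num]
            apply ENNReal.ofReal_le_ofReal
            exact Real.exp_one_lt_three.le
          · simp [hy]
      _ = 1 + 2 * ν A := by
          rw [lintegral_add_left measurable_const, lintegral_indicator hA]; simp
      _ ≤ ENNReal.ofReal (1 + 2 * p) := by
          rw [ENNReal.ofReal_add (by norm_num) (by positivity), ENNReal.ofReal_mul (by norm_num)]
          simp only [ENNReal.ofReal_one, ENNReal.ofReal_ofNat]
          gcongr
      _ ≤ _ := by
          apply ENNReal.ofReal_le_ofReal
          linarith [Real.add_one_le_exp (2 * p)]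
  have h2 : ∫⁻ z, ENNReal.ofReal (Real.exp (∑ i, A.indicator (1 : α → ℝ) (z i)))
      ∂(Measure.pi fun _ : Fin n => ν) ≤ ENNReal.ofReal (Real.exp (2 * (n * p))) := by
    simp_rw [Real.exp_sum, ENNReal.ofReal_prod_of_nonneg fun _ _ => (Real.exp_pos _).le]
    rw [lintegral_pi_prod (fun _ y => ENNReal.ofReal (Real.exp (A.indicator (1 : α → ℝ) y)))
      fun _ => by fun_prop]
    refine (Finset.prod_le_prod' fun _ _ => h1).trans (le_of_eq ?_)
    rw [Finset.prod_const, ← ENNReal.ofReal_pow (Real.exp_pos _).le, ← Real.exp_nat_mul]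
    congr 2
    simp; ring
  refine le_trans (measure_mono ?_) (measure_exp_tail_le (ENNReal.measurable_ofReal.comp
    (Real.measurable_exp.comp (Finset.measurable_sum _ fun i _ =>
      hm.comp (measurable_pi_apply i)))) h2 _)
  intro z hz
  simp only [Set.mem_ofPred_eq, Function.comp] at hz ⊢
  apply ENNReal.ofReal_le_ofReal
  apply Real.exp_le_exp.2
  linarith

/-- The indicator of the part of the `j`-th cell that lies more than `s` to the right of its left
knot. -/
def cellInd (τ : ℕ → ℝ) (s : ℝ) (j : ℕ) (t : ℝ) : ℝ :=
  (Set.Ioo (τ j + s) (τ (j + 1))).indicator 1 t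

/-- The samples with at most `6 n / N` covariates in every open cell. -/
def fewPerCell (T : 𝒳 → ℝ) (τ : ℕ → ℝ) (N n : ℕ) : Set (Fin n → 𝒳) :=
  {x | ∀ j < N, ∑ i, cellInd τ 0 j (T (x i)) ≤ 6 * n / N}

theorem measurable_cellInd (τ : ℕ → ℝ) (s : ℝ) (j : ℕ) : Measurable (cellInd τ s j) :=
  measurable_one.indicator measurableSet_Ioo

theorem measurable_cellInd_fst (τ : ℕ → ℝ) (j : ℕ) (t : ℝ) :
    Measurable fun s => cellInd τ s j t := by
  have : (fun s => cellInd τ s j t) = (Set.Iio (t - τ j)).indicator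
      (fun _ => (Set.Iio (τ (j + 1))).indicator 1 t) := by
    funext s
    by_cases h1 : τ j + s < t <;> by_cases h2 : t < τ (j + 1)
    · simp [cellInd, h1, h2, lt_sub_iff_add_lt']
    · simp [cellInd, h2]
    · simp [cellInd, h1, lt_sub_iff_add_lt']
    · simp [cellInd, h2]
  rw [this]
  exact measurable_const.indicator measurableSet_Iio

theorem cellInd_nonneg (τ : ℕ → ℝ) (s : ℝ) (j : ℕ) (t : ℝ) : 0 ≤ cellInd τ s j t :=
  Set.indicator_nonneg (fun _ _ => zero_le_one) t

theorem cellInd_le_one (τ : ℕ → ℝ) (s : ℝ) (j : ℕ) (t : ℝ) : cellInd τ s j t ≤ 1 :=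
  Set.indicator_le_self' (fun _ _ => zero_le_one) t |>.trans (le_of_eq rfl)

theorem cellInd_mem {τ : ℕ → ℝ} {s : ℝ} {j : ℕ} {t : ℝ} (h : cellInd τ s j t ≠ 0) :
    τ j + s < t ∧ t < τ (j + 1) :=
  Set.mem_Ioo.1 (Set.mem_of_indicator_ne_zero h)

theorem cellInd_eq_one {τ : ℕ → ℝ} {s : ℝ} {j : ℕ} {t : ℝ} (h1 : τ j + s < t)
    (h2 : t < τ (j + 1)) : cellInd τ s j t = 1 := Set.indicator_of_mem (Set.mem_Ioo.2 ⟨h1, h2⟩) _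

theorem cellInd_eq_zero {τ : ℕ → ℝ} {s : ℝ} {j : ℕ} {t : ℝ} (h : ¬ (τ j + s < t ∧ t < τ (j + 1))) :
    cellInd τ s j t = 0 :=
  Set.indicator_of_notMem (s := Set.Ioo (τ j + s) (τ (j + 1))) h _

theorem cellInd_anti {τ : ℕ → ℝ} {s : ℝ} (hs : 0 ≤ s) (j : ℕ) (t : ℝ) :
    cellInd τ s j t ≤ cellInd τ 0 j t := by
  by_cases h : τ j + s < t ∧ t < τ (j + 1)
  · rw [cellInd_eq_one h.1 h.2, cellInd_eq_one (by linarith [h.1]) h.2]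
  · rw [cellInd_eq_zero h]; exact cellInd_nonneg _ _ _ _

theorem measurableSet_fewPerCell {T : 𝒳 → ℝ} (hT : Measurable T) (τ : ℕ → ℝ) (N n : ℕ) :
    MeasurableSet (fewPerCell T τ N n) := by
  have : fewPerCell T τ N n = ⋂ j, ⋂ (_ : j < N),
      {x | ∑ i, cellInd τ 0 j (T (x i)) ≤ 6 * n / N} := by
    ext x; simp [fewPerCell]
  rw [this]
  refine MeasurableSet.iInter fun j => MeasurableSet.iInter fun _ => measurableSet_le
    (Finset.measurable_sum _ fun i _ => ?_) measurable_const
  exact (measurable_cellInd τ 0 j).comp (hT.comp (measurable_pi_apply i))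

variable {a b : ℝ} {ρ : Measure ℝ} {N : ℕ} {τ : ℕ → ℝ}

theorem IsKnots.cellInd_disjoint (h : IsKnots a b ρ N τ) {s : ℝ} (hs : 0 ≤ s) {i j : ℕ} {t : ℝ}
    (hi : cellInd τ s i t ≠ 0) (hj : cellInd τ s j t ≠ 0) : i = j := by
  have h1 := cellInd_mem hi
  have h2 := cellInd_mem hj
  exact h.disjoint ⟨by linarith [h1.1], h1.2⟩ ⟨by linarith [h2.1], h2.2⟩

/-- The cells are disjoint, so their indicators are orthogonal for every empirical measure. -/
theorem IsKnots.sum_cellInd_sq (h : IsKnots a b ρ N τ) {s : ℝ} (hs : 0 ≤ s) (c : Fin N → ℝ)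
    (t : ℝ) : (∑ j : Fin N, c j * cellInd τ s j t) ^ 2 = ∑ j : Fin N, c j ^ 2 * cellInd τ s j t := by
  by_cases hex : ∃ j : Fin N, cellInd τ s j t ≠ 0
  · obtain ⟨j, hj⟩ := hex
    have h0 : ∀ k : Fin N, k ≠ j → cellInd τ s k t = 0 := fun k hk => by
      by_contra hne
      exact hk (Fin.ext (h.cellInd_disjoint hs hne hj))
    have h1 : cellInd τ s j t = 1 := cellInd_eq_one (cellInd_mem hj).1 (cellInd_mem hj).2
    rw [Finset.sum_eq_single j (fun k _ hk => by simp [h0 k hk]) (by simp),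
      Finset.sum_eq_single j (fun k _ hk => by simp [h0 k hk]) (by simp), h1]
    ring
  · push Not at hex
    simp [hex]

/-- With high probability no open cell holds more than `6 n / N` covariates, three times the bound for
their mean number. -/
theorem IsKnots.measure_fewPerCell_compl_le {T : 𝒳 → ℝ} (hT : Measurable T)
    {μ : Measure (𝒳 × ℝ)} [IsProbabilityMeasure μ]
    (h : IsKnots a b (μ.map fun z => T z.1) N τ) (n : ℕ) :
    (Measure.pi fun _ : Fin n => μ) {z | covs z ∉ fewPerCell T τ N n} ≤
      N * ENNReal.ofReal (Real.exp (-(n * (2 / N)))) := by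
  have hsub : {z : Fin n → 𝒳 × ℝ | covs z ∉ fewPerCell T τ N n} ⊆
      ⋃ j ∈ Finset.range N, {z | 3 * n * (2 / (N : ℝ)) <
        ∑ i, ((fun z : 𝒳 × ℝ => T z.1) ⁻¹' Set.Ioo (τ j) (τ (j + 1))).indicator
          (1 : 𝒳 × ℝ → ℝ) (z i)} := by
    intro z hz
    simp only [fewPerCell, Set.mem_ofPred_eq, not_forall, not_le] at hz
    obtain ⟨j, hj, hlt⟩ := hz
    simp only [Set.mem_iUnion, Finset.mem_range]
    refine ⟨j, hj, ?_⟩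
    simp only [Set.mem_ofPred_eq]
    calc 3 * n * (2 / (N : ℝ)) = 6 * n / N := by ring
      _ < _ := hlt
      _ = _ := by
        refine Finset.sum_congr rfl fun i _ => ?_
        simp only [cellInd, covs, add_zero]
        rfl
  refine (measure_mono hsub).trans ((measure_biUnion_finset_le _ _).trans ?_)
  calc _ ≤ ∑ _j ∈ Finset.range N, ENNReal.ofReal (Real.exp (-(n * (2 / N)))) := by
        refine Finset.sum_le_sum fun j hj => ?_
        have hTm : Measurable fun z : 𝒳 × ℝ => T z.1 := hT.comp measurable_fst
        refine measure_count_le (hTm measurableSet_Ioo) (by positivity) ?_ n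
        have := h.mass_le j (Finset.mem_range.1 hj)
        rwa [Measure.map_apply hTm measurableSet_Ioo] at this
    _ = _ := by simp

/-- The mean over `s` of the squared noise in the cells cut off at distance `s`. -/
theorem IsSubG.measure_cell_noise_le {μ : Measure (𝒳 × ℝ)} [IsProbabilityMeasure μ] {σ : ℝ}
    (hμ : IsSubG μ σ) (hσ : 0 < σ) {T : 𝒳 → ℝ} (hT : Measurable T)
    (h : IsKnots a b ρ N τ) (hN : 0 < N) {n : ℕ} (hn : 0 < n) {h₀ : ℝ} (hh : 0 < h₀) :
    (Measure.pi fun _ : Fin n => μ) {z | covs z ∈ fewPerCell T τ N n ∧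
      ENNReal.ofReal (96 * σ * n * h₀) < ∫⁻ s in Set.Ioc 0 h₀, ENNReal.ofReal
        (∑ j : Fin N, (∑ i, (z i).2 * cellInd τ s j (T (covs z i))) ^ 2)} ≤
      ENNReal.ofReal (Real.exp (-N)) := by
  have hN' : (0 : ℝ) < N := by exact_mod_cast hN
  have hn' : (0 : ℝ) < n := by exact_mod_cast hn
  set B : ℝ := 6 * n / N with hB
  have hB0 : 0 < B := by positivity
  set Q : ℝ → (Fin n → 𝒳 × ℝ) → ℝ := fun s z =>
    ∑ j : Fin N, (∑ i, (z i).2 * cellInd τ s j (T (covs z i))) ^ 2 with hQ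
  set G := fewPerCell T τ N n with hG
  have hGm : MeasurableSet G := measurableSet_fewPerCell hT τ N n
  have hexp : ∀ s, 0 ≤ s → ∫⁻ z, G.indicator 1 (covs z) * ENNReal.ofReal
      (Real.exp (Q s z / (8 * σ * B))) ∂(Measure.pi fun _ : Fin n => μ) ≤
        ENNReal.ofReal (Real.exp N) := by
    intro s hs
    have := hμ.lintegral_exp_sum_sq_le hσ hGm (ψ := fun x (j : Fin N) i => cellInd τ s j (T (x i)))
      (fun k i => (measurable_cellInd τ s k).comp (hT.comp (measurable_pi_apply i))) hB0 ?_
    · simp only [Fintype.card_fin] at this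
      exact this.trans (two_pow_le_ofReal_exp N)
    · intro x hx c
      simp_rw [h.sum_cellInd_sq hs]
      rw [Finset.sum_comm, Finset.mul_sum]
      refine Finset.sum_le_sum fun j _ => ?_
      rw [← Finset.mul_sum, mul_comm]
      refine mul_le_mul_of_nonneg_right ?_ (sq_nonneg _)
      exact (Finset.sum_le_sum fun i _ => cellInd_anti hs j _).trans (hx j j.2)
  have hcm : ∀ j : ℕ, Measurable fun p : ℝ × ℝ => cellInd τ p.1 j p.2 := by
    intro j
    have : (fun p : ℝ × ℝ => cellInd τ p.1 j p.2) =
        ({p : ℝ × ℝ | τ j + p.1 < p.2} ∩ {p | p.2 < τ (j + 1)}).indicator 1 := by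
      funext p
      simp [cellInd, Set.indicator]
    rw [this]
    exact measurable_one.indicator ((measurableSet_lt (measurable_fst.const_add _)
      measurable_snd).inter (measurableSet_lt measurable_snd measurable_const))
  have hQm : Measurable fun p : ℝ × (Fin n → 𝒳 × ℝ) => Q p.1 p.2 := by
    simp only [hQ]
    refine Finset.measurable_sum _ fun j _ => Measurable.pow_const
      (Finset.measurable_sum _ fun i _ => ?_) 2
    have h1 : Measurable fun p : ℝ × (Fin n → 𝒳 × ℝ) => T (covs p.2 i) :=
      hT.comp ((measurable_pi_apply i).comp (measurable_covs.comp measurable_snd))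
    have h2 : Measurable fun p : ℝ × (Fin n → 𝒳 × ℝ) => (p.2 i).2 :=
      ((measurable_pi_apply i).comp measurable_snd).snd
    exact h2.mul ((hcm j).comp (measurable_fst.prodMk h1))
  have hjm : Measurable fun p : ℝ × (Fin n → 𝒳 × ℝ) => G.indicator (1 : (Fin n → 𝒳) → ℝ≥0∞)
      (covs p.2) * ENNReal.ofReal (Real.exp (Q p.1 p.2 / (8 * σ * B))) :=
    ((measurable_one.indicator hGm).comp (measurable_covs.comp measurable_snd)).mul
      (ENNReal.measurable_ofReal.comp (Real.measurable_exp.comp (hQm.div_const _)))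
  set F : (Fin n → 𝒳 × ℝ) → ℝ≥0∞ := fun z => ∫⁻ s in Set.Ioc 0 h₀,
    G.indicator 1 (covs z) * ENNReal.ofReal (Real.exp (Q s z / (8 * σ * B))) with hF
  have hFm : Measurable F := hjm.lintegral_prod_left'
  have hFi : ∫⁻ z, (ENNReal.ofReal h₀)⁻¹ * F z ∂(Measure.pi fun _ : Fin n => μ) ≤
      ENNReal.ofReal (Real.exp N) := by
    have hswap : ∫⁻ z, F z ∂(Measure.pi fun _ : Fin n => μ) = ∫⁻ s in Set.Ioc 0 h₀, ∫⁻ z,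
        G.indicator 1 (covs z) * ENNReal.ofReal (Real.exp (Q s z / (8 * σ * B)))
          ∂(Measure.pi fun _ : Fin n => μ) :=
      lintegral_lintegral_swap (f := fun z s => G.indicator 1 (covs z) *
        ENNReal.ofReal (Real.exp (Q s z / (8 * σ * B)))) (hjm.comp measurable_swap).aemeasurable
    rw [lintegral_const_mul _ hFm, hswap]
    calc _ ≤ (ENNReal.ofReal h₀)⁻¹ * ∫⁻ _s in Set.Ioc 0 h₀, ENNReal.ofReal (Real.exp N) := by
          exact mul_le_mul' le_rfl (setLIntegral_mono' measurableSet_Ioc fun s hs => hexp s hs.1.le)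
      _ = _ := by
          rw [setLIntegral_const, Real.volume_Ioc, sub_zero, mul_comm, mul_assoc,
            ENNReal.mul_inv_cancel (by simpa using hh) ENNReal.ofReal_ne_top, mul_one]
  have htail := measure_exp_tail_le (F := fun z => (ENNReal.ofReal h₀)⁻¹ * F z)
    (hFm.const_mul _) (A := (N : ℝ)) hFi (N : ℝ)
  refine le_trans (measure_mono ?_) htail
  rintro z ⟨hzG, hz⟩
  simp only [Set.mem_ofPred_eq]
  by_contra hcon
  push Not at hcon
  refine absurd hz (not_lt.2 ?_)
  -- the convexity of the exponential function turns a bound for the mean of the exponential into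
  -- one for the mean of the exponent
  set A : ℝ := N + N with hA
  have hA1 : 1 ≤ A := by
    have : (1 : ℝ) ≤ N := by exact_mod_cast hN
    linarith
  have hpt : ∀ s, ENNReal.ofReal (Q s z) ≤ ENNReal.ofReal (8 * σ * B) *
      (ENNReal.ofReal (Real.exp (-A)) * ENNReal.ofReal (Real.exp (Q s z / (8 * σ * B))) +
        ENNReal.ofReal (A - 1)) := by
    intro s
    rw [← ENNReal.ofReal_mul (Real.exp_pos _).le, ← Real.exp_add,
      ← ENNReal.ofReal_add (Real.exp_pos _).le (by linarith), ← ENNReal.ofReal_mul (by positivity)]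
    apply ENNReal.ofReal_le_ofReal
    have h1 := Real.add_one_le_exp (-A + Q s z / (8 * σ * B))
    have h2 : Q s z / (8 * σ * B) ≤ Real.exp (-A + Q s z / (8 * σ * B)) + (A - 1) := by linarith
    rwa [div_le_iff₀' (by positivity)] at h2
  have hFz : F z = ∫⁻ s in Set.Ioc 0 h₀, ENNReal.ofReal (Real.exp (Q s z / (8 * σ * B))) := by
    simp [hF, hzG]
  have hle : F z ≤ ENNReal.ofReal h₀ * ENNReal.ofReal (Real.exp A) := by
    have h1 := mul_le_mul' (le_refl (ENNReal.ofReal h₀)) hcon.le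
    rwa [← mul_assoc, ENNReal.mul_inv_cancel (by simpa using hh) ENNReal.ofReal_ne_top,
      one_mul] at h1
  calc ∫⁻ s in Set.Ioc 0 h₀, ENNReal.ofReal (Q s z)
      ≤ ∫⁻ s in Set.Ioc 0 h₀, ENNReal.ofReal (8 * σ * B) *
      (ENNReal.ofReal (Real.exp (-A)) * ENNReal.ofReal (Real.exp (Q s z / (8 * σ * B))) +
        ENNReal.ofReal (A - 1)) := lintegral_mono fun s => hpt s
    _ = ENNReal.ofReal (8 * σ * B) * (ENNReal.ofReal (Real.exp (-A)) * F z +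
        ENNReal.ofReal (A - 1) * ENNReal.ofReal h₀) := by
        rw [lintegral_const_mul' _ _ ENNReal.ofReal_ne_top, lintegral_add_right _ measurable_const,
          lintegral_const_mul' _ _ ENNReal.ofReal_ne_top, hFz, setLIntegral_const, Real.volume_Ioc,
          sub_zero]
    _ ≤ ENNReal.ofReal (8 * σ * B) * (ENNReal.ofReal (Real.exp (-A)) *
        (ENNReal.ofReal h₀ * ENNReal.ofReal (Real.exp A)) +
        ENNReal.ofReal (A - 1) * ENNReal.ofReal h₀) := by gcongr
    _ = ENNReal.ofReal (96 * σ * n * h₀) := by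
        rw [← ENNReal.ofReal_mul hh.le, ← ENNReal.ofReal_mul (Real.exp_pos _).le,
          ← ENNReal.ofReal_mul (by linarith), ← ENNReal.ofReal_add (by positivity)
            (mul_nonneg (by linarith) hh.le), ← ENNReal.ofReal_mul (by positivity)]
        congr 1
        have h1 : Real.exp (-A) * (h₀ * Real.exp A) = h₀ := by
          rw [mul_left_comm, ← Real.exp_add]; simp
        rw [h1, hA, hB]; field_simp; ring

end

section

/-! ### Taylor expansion at the knots -/

variable {a b : ℝ} {ρ : Measure ℝ} {N : ℕ} {τ : ℕ → ℝ}

/-- The indicator of the half-open cell between two knots. -/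
def halfCell (τ : ℕ → ℝ) (j : ℕ) (t : ℝ) : ℝ := (Set.Ico (τ j) (τ (j + 1))).indicator 1 t

/-- The remainder of the first-order Taylor expansion of `prim a c g` at the knot to the left. -/
def taylorRem (a c : ℝ) (g : ℝ → ℝ) (τ : ℕ → ℝ) (N : ℕ) (t : ℝ) : ℝ :=
  prim a c g t - ∑ j : Fin N, (prim a c g (τ j) * halfCell τ j t +
    g (τ j) * ((t - τ j) * halfCell τ j t))

theorem measurable_halfCell (τ : ℕ → ℝ) (j : ℕ) : Measurable (halfCell τ j) :=
  measurable_one.indicator measurableSet_Ico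

theorem IsKnots.taylorRem_eq (h : IsKnots a b ρ N τ) (c : ℝ) (g : ℝ → ℝ) {j : ℕ} (hj : j < N)
    {t : ℝ} (ht : t ∈ Set.Ico (τ j) (τ (j + 1))) :
    taylorRem a c g τ N t = prim a c g t - prim a c g (τ j) - g (τ j) * (t - τ j) := by
  unfold taylorRem
  rw [Finset.sum_eq_single ⟨j, hj⟩]
  · have : halfCell τ j t = 1 := Set.indicator_of_mem ht _
    simp only [this]; ring
  · intro k _ hk
    have : halfCell τ k t = 0 := Set.indicator_of_notMem (fun hmem => hk (Fin.ext
      (h.disjoint hmem ht))) _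
    simp [this]
  · simp

theorem IsKnots.cellInd_of_mem (h : IsKnots a b ρ N τ) {j k : ℕ} {s t : ℝ} (hs : 0 ≤ s)
    (ht : t ∈ Set.Ico (τ j) (τ (j + 1))) (hk : k ≠ j) : cellInd τ s k t = 0 := by
  by_contra hne
  have h1 := cellInd_mem hne
  exact hk (h.disjoint ⟨by linarith [h1.1], h1.2⟩ ht)

theorem intervalIntegrable_increment {g : ℝ → ℝ} (hg : Continuous g) (τ : ℕ → ℝ) (j : ℕ)
    (t p q : ℝ) :
    IntervalIntegrable (fun s => (g (τ j + s) - g (τ j)) * cellInd τ s j t) volume p q := by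
  have h1 : Continuous fun s => g (τ j + s) - g (τ j) := by fun_prop
  refine (h1.intervalIntegrable p q).mono_fun
    (h1.measurable.mul (measurable_cellInd_fst τ j t)).aestronglyMeasurable
    (Eventually.of_forall fun s => ?_)
  simp only [norm_mul, Real.norm_eq_abs]
  rw [abs_of_nonneg (cellInd_nonneg τ s j t)]
  exact mul_le_of_le_one_right (abs_nonneg _) (cellInd_le_one _ _ _ _)

/-- The remainder is a mixture over `s` of step functions with jumps `g (τ_j + s) - g (τ_j)`. For each
`s` the noise in the remainder is then a linear form in the noise sums over the cut off cells. -/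
theorem IsKnots.taylorRem_eq_integral (h : IsKnots a b ρ N τ) (c : ℝ) {g : ℝ → ℝ}
    (hg : Continuous g) {h₀ : ℝ} (hh : ∀ i < N, τ (i + 1) - τ i ≤ h₀) {t : ℝ}
    (ht : t ∈ Set.Ico a b) : taylorRem a c g τ N t =
      ∫ s in (0 : ℝ)..h₀, ∑ j : Fin N, (g (τ j + s) - g (τ j)) * cellInd τ s j t := by
  obtain ⟨j, hj, hjt⟩ := h.exists_cell ht.1 ht.2
  have h0 : 0 ≤ t - τ j := sub_nonneg.2 hjt.1
  have hle : t - τ j ≤ h₀ := by linarith [hh j hj, hjt.2]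
  have hcongr : (∫ s in (0 : ℝ)..h₀, ∑ j : Fin N, (g (τ j + s) - g (τ j)) * cellInd τ s j t)
      = ∫ s in (0 : ℝ)..h₀, (g (τ j + s) - g (τ j)) * cellInd τ s j t := by
    refine intervalIntegral.integral_congr fun s hs => ?_
    rw [Set.uIcc_of_le (h0.trans hle)] at hs
    exact Finset.sum_eq_single (⟨j, hj⟩ : Fin N) (fun k _ hk => by
      rw [h.cellInd_of_mem hs.1 hjt (fun e => hk (Fin.ext e)), mul_zero]) (by simp)
  have hint := intervalIntegrable_increment hg τ j t
  rw [h.taylorRem_eq c g hj hjt, hcongr, prim_sub_taylor hg,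
    ← intervalIntegral.integral_add_adjacent_intervals (hint 0 (t - τ j)) (hint (t - τ j) h₀)]
  have h2 : (∫ s in (t - τ j)..h₀, (g (τ j + s) - g (τ j)) * cellInd τ s j t) = 0 := by
    rw [intervalIntegral.integral_congr (g := fun _ => 0) fun s hs => ?_]
    · simp
    · rw [Set.uIcc_of_le hle] at hs
      have : cellInd τ s j t = 0 := cellInd_eq_zero fun h' => by linarith [h'.1, hs.1]
      simp [this]
  have h3 : (∫ s in (0 : ℝ)..(t - τ j), (g (τ j + s) - g (τ j)) * cellInd τ s j t) =
      ∫ s in (0 : ℝ)..(t - τ j), (g (τ j + s) - g (τ j)) := by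
    apply intervalIntegral.integral_congr_ae
    filter_upwards [(Set.countable_singleton (t - τ j)).ae_notMem volume] with s hs hmem
    rw [Set.uIoc_of_le h0] at hmem
    have hlt : s < t - τ j := lt_of_le_of_ne hmem.2 hs
    rw [cellInd_eq_one (by linarith) hjt.2, mul_one]
  rw [h2, h3, add_zero, intervalIntegral.integral_comp_add_left (fun u => g u - g (τ j)) (τ j)]
  simp

theorem sum_increments_le (τ : ℕ → ℝ) (N : ℕ) {V : ℝ → ℝ} {J : ℝ}
    (hV : ∀ s t, V t - V s ≤ J ^ 2) : ∑ j : Fin N, (V (τ (j + 1)) - V (τ j)) ≤ J ^ 2 := by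
  rw [Fin.sum_univ_eq_sum_range (fun j => V (τ (j + 1)) - V (τ j)) N,
    Finset.sum_range_sub (fun j => V (τ j))]
  exact hV _ _

/-- The remainder vanishes at the knots, hence is controlled by the open cells. -/
theorem IsKnots.taylorRem_sq_le (h : IsKnots a b ρ N τ) (c : ℝ) {g V : ℝ → ℝ} (hg : Continuous g)
    (hV : Monotone V) (hgV : ∀ s t, s ≤ t → (g t - g s) ^ 2 ≤ (t - s) * (V t - V s))
    {h₀ : ℝ} (hh : ∀ i < N, τ (i + 1) - τ i ≤ h₀) {t : ℝ} (ht : t ∈ Set.Ico a b) :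
    taylorRem a c g τ N t ^ 2 ≤
      h₀ ^ 3 * ∑ j : Fin N, (V (τ (j + 1)) - V (τ j)) * cellInd τ 0 j t := by
  obtain ⟨j, hj, hjt⟩ := h.exists_cell ht.1 ht.2
  rw [h.taylorRem_eq c g hj hjt, Finset.sum_eq_single (⟨j, hj⟩ : Fin N) (fun k _ hk => by
    rw [h.cellInd_of_mem le_rfl hjt (fun e => hk (Fin.ext e)), mul_zero]) (by simp)]
  rcases hjt.1.eq_or_lt with heq | hlt
  · rw [← heq]
    simp [cellInd]
  · have h1 : cellInd τ 0 j t = 1 := cellInd_eq_one (by linarith) hjt.2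
    simp only [h1, mul_one]
    have hle : t - τ j ≤ h₀ := by linarith [hh j hj, hjt.2]
    have h00 : 0 ≤ h₀ := by linarith
    have hVj : 0 ≤ V (τ (j + 1)) - V (τ j) := sub_nonneg.2 (hV (hlt.le.trans hjt.2.le))
    have h2 := prim_taylor_abs_le hg (a := a) (c := c) hlt.le
      (B := Real.sqrt h₀ * Real.sqrt (V (τ (j + 1)) - V (τ j))) (fun u hu => by
        refine (abs_increment_le hgV hV hu.1 (h₀ := h₀) (by linarith [hu.2])).trans ?_
        gcongr
        exact hV (hu.2.trans hjt.2.le))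
    have h3 : |prim a c g t - prim a c g (τ j) - g (τ j) * (t - τ j)| ≤
        h₀ * (Real.sqrt h₀ * Real.sqrt (V (τ (j + 1)) - V (τ j))) :=
      h2.trans (mul_le_mul_of_nonneg_right hle (by positivity))
    calc _ = |prim a c g t - prim a c g (τ j) - g (τ j) * (t - τ j)| ^ 2 := (sq_abs _).symm
      _ ≤ (h₀ * (Real.sqrt h₀ * Real.sqrt (V (τ (j + 1)) - V (τ j)))) ^ 2 := by gcongr
      _ = _ := by
        rw [mul_pow, mul_pow, Real.sq_sqrt h00, Real.sq_sqrt hVj]; ring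

/-- If the noise `e` is small on the cells, cut off at distance `s`, in the mean over `s`, then it
is nearly orthogonal to the Taylor remainders. -/
theorem IsKnots.noise_taylorRem_le (h : IsKnots a b ρ N τ) {J : ℝ} (hJ : 0 ≤ J) (c : ℝ) {g : ℝ → ℝ}
    (hg : IsLink J g) {h₀ K : ℝ} (hh0 : 0 < h₀) (hK : 0 < K) (hh : ∀ i < N, τ (i + 1) - τ i ≤ h₀)
    {n : ℕ} {e t : Fin n → ℝ} (ht : ∀ i, t i ∈ Set.Ico a b)
    (hnoise : ∫⁻ s in Set.Ioc 0 h₀, ENNReal.ofReal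
      (∑ j : Fin N, (∑ i, e i * cellInd τ s j (t i)) ^ 2) ≤ ENNReal.ofReal (K * h₀)) :
    |∑ i, e i * taylorRem a c g τ N (t i)| ≤ Real.sqrt K * (h₀ * Real.sqrt h₀) * J := by
  obtain ⟨V, hV, hVJ, hgV⟩ := hg.energy
  have hgc := hg.cont
  set Q : ℝ → ℝ := fun s => ∑ j : Fin N, (∑ i, e i * cellInd τ s j (t i)) ^ 2 with hQ
  have hQ0 : ∀ s, 0 ≤ Q s := fun s => Finset.sum_nonneg fun _ _ => sq_nonneg _
  have hQm : Measurable Q := Finset.measurable_sum _ fun j _ => Measurable.pow_const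
    (Finset.measurable_sum _ fun i _ => (measurable_cellInd_fst τ j (t i)).const_mul _) 2
  have hQi : IntegrableOn Q (Set.Ioc 0 h₀) := by
    refine ⟨hQm.aestronglyMeasurable, ?_⟩
    rw [hasFiniteIntegral_iff_ofReal (Eventually.of_forall hQ0)]
    exact hnoise.trans_lt ENNReal.ofReal_lt_top
  have hQI : IntervalIntegrable Q volume 0 h₀ :=
    (intervalIntegrable_iff_integrableOn_Ioc_of_le hh0.le).2 hQi
  have hQle : ∫ s in (0 : ℝ)..h₀, Q s ≤ K * h₀ := by
    rw [intervalIntegral.integral_of_le hh0.le, integral_eq_lintegral_of_nonneg_ae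
      (Eventually.of_forall hQ0) hQm.aestronglyMeasurable]
    exact ENNReal.toReal_le_of_le_ofReal (by positivity) hnoise
  -- the noise in the remainder as one integral over `s`
  set S : ℝ → ℝ := fun s => ∑ j : Fin N, (g (τ j + s) - g (τ j)) * ∑ i, e i * cellInd τ s j (t i)
    with hS
  have hsum : ∑ i, e i * taylorRem a c g τ N (t i) = ∫ s in (0 : ℝ)..h₀, S s := by
    have h1 : ∀ i, e i * taylorRem a c g τ N (t i) = ∫ s in (0 : ℝ)..h₀,
        e i * ∑ j : Fin N, (g (τ j + s) - g (τ j)) * cellInd τ s j (t i) := fun i => by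
      rw [h.taylorRem_eq_integral c hgc hh (ht i), intervalIntegral.integral_const_mul]
    simp_rw [h1]
    rw [← intervalIntegral.integral_finsetSum]
    · refine intervalIntegral.integral_congr fun s _ => ?_
      simp only [hS, Finset.mul_sum]
      rw [Finset.sum_comm]
      exact Finset.sum_congr rfl fun j _ => Finset.sum_congr rfl fun i _ => by ring
    · intro i _
      refine IntervalIntegrable.const_mul ?_ _
      have := IntervalIntegrable.sum (Finset.univ : Finset (Fin N)) (μ := volume) (a := 0) (b := h₀)
        (f := fun j s => (g (τ j + s) - g (τ j)) * cellInd τ s j (t i))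
        (fun j _ => intervalIntegrable_increment hgc τ j (t i) 0 h₀)
      have heq : (fun s => ∑ j : Fin N, (g (τ j + s) - g (τ j)) * cellInd τ s j (t i)) =
          ∑ j : Fin N, fun s => (g (τ j + s) - g (τ j)) * cellInd τ s j (t i) := by
        funext s; simp
      rw [heq]; exact this
  set κ := Real.sqrt K with hκ
  have hκ0 : 0 < κ := Real.sqrt_pos.2 hK
  have hκ2 : κ ^ 2 = K := Real.sq_sqrt hK.le
  have hSle : ∀ s ∈ Set.Ioc (0 : ℝ) h₀, |S s| ≤ Real.sqrt h₀ * J * ((Q s / κ + κ) / 2) := by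
    intro s hs
    have hterm : |S s| ≤ ∑ j : Fin N, (Real.sqrt h₀ * Real.sqrt (V (τ (j + 1)) - V (τ j))) *
        |∑ i, e i * cellInd τ s j (t i)| := by
      refine (Finset.abs_sum_le_sum_abs _ _).trans (Finset.sum_le_sum fun j _ => ?_)
      rw [abs_mul]
      by_cases hz : ∑ i, e i * cellInd τ s j (t i) = 0
      · simp [hz]
      · obtain ⟨i, _, hi⟩ := Finset.exists_ne_zero_of_sum_ne_zero hz
        have hmem := cellInd_mem (right_ne_zero_of_mul hi)
        gcongr
        refine (abs_increment_le hgV hV (by linarith [hs.1]) (h₀ := h₀)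
          (by linarith [hs.2])).trans ?_
        gcongr
        exact hV (hmem.1.le.trans hmem.2.le)
    have hcs := Finset.sum_mul_sq_le_sq_mul_sq Finset.univ
      (fun j : Fin N => Real.sqrt h₀ * Real.sqrt (V (τ (j + 1)) - V (τ j)))
      (fun j => |∑ i, e i * cellInd τ s j (t i)|)
    have h1 : ∑ j : Fin N, (Real.sqrt h₀ * Real.sqrt (V (τ (j + 1)) - V (τ j))) ^ 2 ≤
        h₀ * J ^ 2 := by
      calc _ = h₀ * ∑ j : Fin N, (V (τ (j + 1)) - V (τ j)) := by
            rw [Finset.mul_sum]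
            refine Finset.sum_congr rfl fun j _ => ?_
            rw [mul_pow, Real.sq_sqrt hh0.le,
              Real.sq_sqrt (sub_nonneg.2 (hV (h.mono (Nat.le_succ _))))]
        _ ≤ _ := mul_le_mul_of_nonneg_left (sum_increments_le τ N hVJ) hh0.le
    have h2 : ∑ j : Fin N, |∑ i, e i * cellInd τ s j (t i)| ^ 2 = Q s :=
      Finset.sum_congr rfl fun j _ => sq_abs _
    rw [h2] at hcs
    have h3 : |S s| ^ 2 ≤ (Real.sqrt h₀ * J) ^ 2 * Q s := by
      calc |S s| ^ 2 ≤ _ := pow_le_pow_left₀ (abs_nonneg _) hterm 2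
        _ ≤ _ := hcs
        _ ≤ (h₀ * J ^ 2) * Q s := mul_le_mul_of_nonneg_right h1 (hQ0 s)
        _ = _ := by rw [mul_pow, Real.sq_sqrt hh0.le]
    have h4 : Q s ≤ ((Q s / κ + κ) / 2) ^ 2 := by
      have : Q s = (Q s / κ) * κ := by field_simp
      nlinarith [sq_nonneg (Q s / κ - κ)]
    have h5 : 0 ≤ (Q s / κ + κ) / 2 := by have := hQ0 s; positivity
    refine abs_le_of_sq_le_sq' ?_ (by positivity) |>.2
    calc |S s| ^ 2 ≤ _ := h3
      _ ≤ (Real.sqrt h₀ * J) ^ 2 * ((Q s / κ + κ) / 2) ^ 2 := by gcongr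
      _ = _ := by ring
  rw [hsum, ← Real.norm_eq_abs]
  have hbound : IntervalIntegrable (fun s => Real.sqrt h₀ * J * ((Q s / κ + κ) / 2)) volume 0 h₀ :=
    (((hQI.div_const κ).add (by simp)).div_const 2).const_mul _
  refine (intervalIntegral.norm_integral_le_of_norm_le hh0.le (g := fun s =>
    Real.sqrt h₀ * J * ((Q s / κ + κ) / 2)) (Eventually.of_forall fun s hs =>
      (Real.norm_eq_abs _).trans_le (hSle s hs)) hbound).trans ?_
  rw [intervalIntegral.integral_const_mul, intervalIntegral.integral_div,
    intervalIntegral.integral_add (hQI.div_const κ) (by simp), intervalIntegral.integral_div,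
    intervalIntegral.integral_const, sub_zero, smul_eq_mul]
  have h6 : (∫ s in (0 : ℝ)..h₀, Q s) / κ ≤ h₀ * κ := by
    rw [div_le_iff₀ hκ0]; nlinarith
  calc Real.sqrt h₀ * J * (((∫ s in (0 : ℝ)..h₀, Q s) / κ + h₀ * κ) / 2)
      ≤ Real.sqrt h₀ * J * ((h₀ * κ + h₀ * κ) / 2) := by gcongr
    _ = _ := by ring

/-! ### The noise on functions of one index, uniformly over link functions -/

/-- The empirical norm of the remainder, when no cell holds too many covariates. -/
theorem IsKnots.sum_taylorRem_sq_le {𝒳 : Type*} {T : 𝒳 → ℝ} (h : IsKnots a b ρ N τ) {J : ℝ}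
    (c : ℝ) {g : ℝ → ℝ} (hg : IsLink J g) {h₀ : ℝ} (hh0 : 0 ≤ h₀) (hh : ∀ i < N, τ (i + 1) - τ i ≤ h₀) {n : ℕ}
    {x : Fin n → 𝒳} (hx : x ∈ fewPerCell T τ N n) (hT : ∀ y, T y ∈ Set.Ico a b) :
    ∑ i, taylorRem a c g τ N (T (x i)) ^ 2 ≤ (6 * n / N) * h₀ ^ 3 * J ^ 2 := by
  obtain ⟨V, hV, hVJ, hgV⟩ := hg.energy
  calc _ ≤ ∑ i, h₀ ^ 3 * ∑ j : Fin N, (V (τ (j + 1)) - V (τ j)) * cellInd τ 0 j (T (x i)) :=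
        Finset.sum_le_sum fun i _ => h.taylorRem_sq_le c hg.cont hV hgV hh (hT _)
    _ = h₀ ^ 3 * ∑ j : Fin N, (V (τ (j + 1)) - V (τ j)) * ∑ i, cellInd τ 0 j (T (x i)) := by
        rw [← Finset.mul_sum, Finset.sum_comm]
        simp_rw [Finset.mul_sum]
    _ ≤ h₀ ^ 3 * ∑ j : Fin N, (V (τ (j + 1)) - V (τ j)) * (6 * n / N) := by
        refine mul_le_mul_of_nonneg_left (Finset.sum_le_sum fun j _ => ?_) (by positivity)
        exact mul_le_mul_of_nonneg_left (hx j j.2) (sub_nonneg.2 (hV (h.mono (Nat.le_succ _))))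
    _ ≤ h₀ ^ 3 * (J ^ 2 * (6 * n / N)) := by
        rw [← Finset.sum_mul]
        have := sum_increments_le τ N hVJ
        gcongr
    _ = _ := by ring

variable {𝒳 : Type*} [MeasurableSpace 𝒳]

theorem sqrt_sum_sub_sq_le {n : ℕ} (u v : Fin n → ℝ) :
    Real.sqrt (∑ i, (u i - v i) ^ 2) ≤ Real.sqrt (∑ i, u i ^ 2) + Real.sqrt (∑ i, v i ^ 2) := by
  have := norm_sub_le (WithLp.toLp 2 u : EuclideanSpace ℝ (Fin n)) (WithLp.toLp 2 v)
  simpa [EuclideanSpace.norm_eq] using this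

/-- For one index `T`, the noise is controlled on all functions `m ∘ T - g₀` at once: the
piecewise linear part of `m` lies in a space of dimension `2N`, and the Taylor remainders at the
knots contribute the term with the roughness. -/
theorem IsSubG.measure_noise_le {μ : Measure (𝒳 × ℝ)} [IsProbabilityMeasure μ] {σ : ℝ}
    (hμ : IsSubG μ σ) (hσ : 0 < σ) (hab : a < b) {T g₀ : 𝒳 → ℝ} (hT : Measurable T)
    (hTab : ∀ x, T x ∈ Set.Ico a b) (hg₀ : Measurable g₀)
    (h : IsKnots a b (μ.map fun z => T z.1) N τ) (hN : 0 < N) {n : ℕ} (hn : 0 < n) :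
    (Measure.pi fun _ : Fin n => μ) {z | ¬ ∀ (J c : ℝ) (g : ℝ → ℝ), 0 ≤ J → IsLink J g →
      |∑ i, (z i).2 * (prim a c g (T (z i).1) - g₀ (z i).1)| ≤
        Real.sqrt (32 * σ * N) * Real.sqrt (∑ i, (prim a c g (T (z i).1) - g₀ (z i).1) ^ 2) +
        25 * Real.sqrt (σ * n) * ((2 * (b - a) / N) * Real.sqrt (2 * (b - a) / N)) * J} ≤
      N * ENNReal.ofReal (Real.exp (-(n * (2 / N)))) + 2 * ENNReal.ofReal (Real.exp (-N)) := by
  have hN' : (0 : ℝ) < N := by exact_mod_cast hN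
  have hN1 : (1 : ℝ) ≤ N := by exact_mod_cast hN
  have hn' : (0 : ℝ) < n := by exact_mod_cast hn
  set h₀ := 2 * (b - a) / N with hh₀
  have hh0 : 0 < h₀ := by
    have : 0 < b - a := by linarith
    positivity
  -- the functions spanned by the cells, and `g₀`
  set ψ : (Fin n → 𝒳) → Option (Fin N × Bool) → Fin n → ℝ := fun x k i =>
    match k with
    | none => g₀ (x i)
    | some (j, false) => halfCell τ j (T (x i))
    | some (j, true) => (T (x i) - τ j) * halfCell τ j (T (x i)) with hψ
  have hψm : ∀ k i, Measurable fun x => ψ x k i := by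
    intro k i
    have h1 : Measurable fun x : Fin n → 𝒳 => T (x i) := hT.comp (measurable_pi_apply i)
    match k with
    | none => exact hg₀.comp (measurable_pi_apply i)
    | some (j, false) => exact (measurable_halfCell τ j).comp h1
    | some (j, true) => exact (h1.sub_const _).mul ((measurable_halfCell τ j).comp h1)
  refine le_trans (measure_mono (t := {z | covs z ∉ fewPerCell T τ N n} ∪
    ({z | ∃ c : Option (Fin N × Bool) → ℝ,
      8 * σ * (Fintype.card (Option (Fin N × Bool)) + N) * ∑ i, (∑ k, c k * ψ (covs z) k i) ^ 2 <
        (∑ i, (z i).2 * ∑ k, c k * ψ (covs z) k i) ^ 2} ∪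
    {z | covs z ∈ fewPerCell T τ N n ∧
      ENNReal.ofReal (96 * σ * n * h₀) < ∫⁻ s in Set.Ioc 0 h₀, ENNReal.ofReal
        (∑ j : Fin N, (∑ i, (z i).2 * cellInd τ s j (T (covs z i))) ^ 2)})) ?_) ?_
  · intro z hz
    by_contra hcon
    simp only [Set.mem_union, not_or, Set.mem_ofPred_eq, not_not, not_exists, not_and,
      not_lt] at hcon
    obtain ⟨hfew, hspan, hcell⟩ := hcon
    refine hz fun J c g hJ hg => ?_
    have hrem := h.noise_taylorRem_le hJ c hg hh0 (K := 96 * σ * n) (by positivity) h.length_le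
      (e := fun i => (z i).2) (t := fun i => T (covs z i)) (fun i => hTab _) (hcell hfew)
    have hrem2 := h.sum_taylorRem_sq_le (T := T) c hg hh0.le h.length_le hfew hTab
    set v : Fin n → ℝ := fun i => prim a c g (T (covs z i)) - taylorRem a c g τ N (T (covs z i)) -
      g₀ (covs z i) with hv
    have hvψ : ∃ d : Option (Fin N × Bool) → ℝ, ∀ i, ∑ k, d k * ψ (covs z) k i = v i := by
      refine ⟨fun k => match k with
        | none => -1
        | some (j, false) => prim a c g (τ j)
        | some (j, true) => g (τ j), fun i => ?_⟩
      rw [Fintype.sum_option, Fintype.sum_prod_type]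
      simp only [Fintype.sum_bool, hψ, hv, taylorRem]
      rw [sub_sub_cancel, Finset.sum_congr rfl fun j _ => add_comm _ _]
      ring
    obtain ⟨d, hd⟩ := hvψ
    have hsp := hspan d
    simp only [hd] at hsp
    have hcard : (Fintype.card (Option (Fin N × Bool)) : ℝ) = 2 * N + 1 := by
      simp; ring
    rw [hcard] at hsp
    set f : Fin n → ℝ := fun i => prim a c g (T (z i).1) - g₀ (z i).1 with hf
    set r : Fin n → ℝ := fun i => taylorRem a c g τ N (T (covs z i)) with hr
    have hfv : ∀ i, f i = v i + r i := fun i => by simp only [hf, hv, hr, covs]; ring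
    have hvf : ∀ i, v i = f i - r i := fun i => by rw [hfv]; ring
    have h1 : |∑ i, (z i).2 * v i| ≤ Real.sqrt (32 * σ * N) * Real.sqrt (∑ i, v i ^ 2) := by
      rw [← Real.sqrt_mul (by positivity)]
      apply Real.abs_le_sqrt
      refine hsp.trans (mul_le_mul_of_nonneg_right ?_ (Finset.sum_nonneg fun _ _ => sq_nonneg _))
      nlinarith
    have h2 : Real.sqrt (∑ i, v i ^ 2) ≤ Real.sqrt (∑ i, f i ^ 2) + Real.sqrt (∑ i, r i ^ 2) := by
      simp_rw [hvf]
      exact sqrt_sum_sub_sq_le f r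
    have h3 : Real.sqrt (∑ i, r i ^ 2) ≤ Real.sqrt (6 * n / N) * (h₀ * Real.sqrt h₀) * J := by
      refine (Real.sqrt_le_sqrt hrem2).trans (le_of_eq ?_)
      rw [Real.sqrt_mul (by positivity), Real.sqrt_mul (by positivity), Real.sqrt_sq hJ]
      congr 2
      rw [show h₀ ^ 3 = h₀ ^ 2 * h₀ by ring, Real.sqrt_mul (by positivity), Real.sqrt_sq hh0.le]
    have h4 : Real.sqrt (32 * σ * N) * Real.sqrt (6 * n / N) ≤ 14 * Real.sqrt (σ * n) := by
      rw [← Real.sqrt_mul (by positivity)]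
      have : 32 * σ * N * (6 * n / N) = 192 * (σ * n) := by field_simp; ring
      rw [this, Real.sqrt_mul (by norm_num)]
      gcongr
      rw [Real.sqrt_le_left (by norm_num)]; norm_num
    have h5 : Real.sqrt (96 * σ * n) ≤ 10 * Real.sqrt (σ * n) := by
      rw [mul_assoc, Real.sqrt_mul (by norm_num)]
      gcongr
      rw [Real.sqrt_le_left (by norm_num)]; norm_num
    have h6 : 0 ≤ h₀ * Real.sqrt h₀ * J := by positivity
    have h7 : 0 ≤ Real.sqrt (σ * n) * (h₀ * Real.sqrt h₀ * J) := by positivity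
    calc |∑ i, (z i).2 * f i| = |∑ i, (z i).2 * v i + ∑ i, (z i).2 * r i| := by
          rw [← Finset.sum_add_distrib]
          congr 1
          exact Finset.sum_congr rfl fun i _ => by rw [hfv]; ring
      _ ≤ |∑ i, (z i).2 * v i| + |∑ i, (z i).2 * r i| := abs_add_le _ _
      _ ≤ Real.sqrt (32 * σ * N) * (Real.sqrt (∑ i, f i ^ 2) +
            Real.sqrt (6 * n / N) * (h₀ * Real.sqrt h₀) * J) +
          Real.sqrt (96 * σ * n) * (h₀ * Real.sqrt h₀) * J := by
          refine add_le_add (h1.trans ?_) hrem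
          gcongr
          exact h2.trans (by gcongr)
      _ = Real.sqrt (32 * σ * N) * Real.sqrt (∑ i, f i ^ 2) +
          (Real.sqrt (32 * σ * N) * Real.sqrt (6 * n / N) + Real.sqrt (96 * σ * n)) *
            (h₀ * Real.sqrt h₀ * J) := by ring
      _ ≤ Real.sqrt (32 * σ * N) * Real.sqrt (∑ i, f i ^ 2) +
          (14 * Real.sqrt (σ * n) + 10 * Real.sqrt (σ * n)) * (h₀ * Real.sqrt h₀ * J) := by
          gcongr
      _ ≤ _ := by linarith
  · refine (measure_union_le _ _).trans (add_le_add (h.measure_fewPerCell_compl_le hT n) ?_)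
    refine (measure_union_le _ _).trans ?_
    rw [two_mul]
    exact add_le_add (hμ.measure_span_le' hσ hψm N) (hμ.measure_cell_noise_le hσ hT h hN hn hh0)

end

section

/-! ### Covering numbers of balls of link functions -/

/-- The integer vectors of length `N` with sum of squares at most `q`. -/
def intBall (N q : ℕ) : Finset (Fin N → ℤ) :=
  (Fintype.piFinset fun _ : Fin N => Finset.Icc (-(q : ℤ)) q).filter fun z => ∑ j, z j ^ 2 ≤ q

theorem mem_intBall {N q : ℕ} {z : Fin N → ℤ} (h : ∑ j, z j ^ 2 ≤ q) : z ∈ intBall N q := by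
  refine Finset.mem_filter.2 ⟨Fintype.mem_piFinset.2 fun j => ?_, h⟩
  have h1 : z j ^ 2 ≤ q := (Finset.single_le_sum (fun i _ => sq_nonneg (z i))
    (Finset.mem_univ j)).trans h
  have h2 : |z j| ≤ z j ^ 2 := by
    rw [← sq_abs]
    rcases (abs_nonneg (z j)).eq_or_lt with h0 | h0
    · rw [← h0]; norm_num
    · nlinarith
  exact Finset.mem_Icc.2 (abs_le.1 (h2.trans h1))

/-- A partial sum of the theta series at `e⁻¹`. The error term makes the induction work. -/
theorem sum_exp_neg_sq_le (q : ℕ) :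
    ∑ k ∈ Finset.Icc (-(q : ℤ)) q, Real.exp (-((k : ℝ) ^ 2)) ≤ 3 - 2 * (1 / 2) ^ q := by
  induction q with
  | zero => simp; norm_num
  | succ q ih =>
    have h1 : Finset.Icc (-((q + 1 : ℕ) : ℤ)) ((q + 1 : ℕ) : ℤ) =
        insert (-((q : ℤ) + 1)) (insert ((q : ℤ) + 1) (Finset.Icc (-(q : ℤ)) q)) := by
      ext k; simp only [Finset.mem_Icc, Finset.mem_insert]; push_cast; omega
    rw [h1, Finset.sum_insert (by simp; omega), Finset.sum_insert (by simp)]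
    have h2 : Real.exp (-((((q : ℤ) + 1 : ℤ) : ℝ) ^ 2)) ≤ (1 / 2) ^ (q + 1) := by
      have h3 : Real.exp (-1) ≤ 1 / 2 := by
        rw [Real.exp_neg, inv_le_comm₀ (Real.exp_pos _) (by norm_num)]
        linarith [Real.add_one_le_exp (1 : ℝ)]
      calc _ ≤ Real.exp (((q + 1 : ℕ) : ℝ) * (-1)) := by
            apply Real.exp_le_exp.2
            push_cast
            have : (0 : ℝ) ≤ q := Nat.cast_nonneg q
            nlinarith
        _ = Real.exp (-1) ^ (q + 1) := Real.exp_nat_mul _ _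
        _ ≤ _ := pow_le_pow_left₀ (Real.exp_pos _).le h3 _
    have h4 : Real.exp (-(((-((q : ℤ) + 1) : ℤ) : ℝ) ^ 2)) =
        Real.exp (-((((q : ℤ) + 1 : ℤ) : ℝ) ^ 2)) := by
      congr 1; push_cast; ring
    rw [h4]
    have h5 : 2 * (1 / 2 : ℝ) ^ (q + 1) = (1 / 2) ^ q := by rw [pow_succ]; ring
    linarith

/-- Number of integer points in a ball. The indicator of the ball is dominated by
`exp (q - ∑ z_j²)`, whose sum over all integer vectors factorizes. -/
theorem card_intBall_le (N q : ℕ) : ((intBall N q).card : ℝ) ≤ Real.exp q * 3 ^ N := by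
  have h1 : ∑ z ∈ Fintype.piFinset (fun _ : Fin N => Finset.Icc (-(q : ℤ)) q),
      ∏ j, Real.exp (-((z j : ℝ) ^ 2)) ≤ 3 ^ N := by
    rw [← Finset.prod_univ_sum (fun _ : Fin N => Finset.Icc (-(q : ℤ)) q)
      (fun _ k => Real.exp (-((k : ℝ) ^ 2)))]
    refine (Finset.prod_le_prod (fun _ _ => Finset.sum_nonneg fun _ _ => (Real.exp_pos _).le)
      fun _ _ => (sum_exp_neg_sq_le q).trans (?_ : _ ≤ (3 : ℝ))).trans ?_
    · have : (0 : ℝ) ≤ 2 * (1 / 2) ^ q := by positivity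
      linarith
    · simp
  have h2 : ((intBall N q).card : ℝ) * Real.exp (-q) ≤ 3 ^ N := by
    refine le_trans ?_ h1
    refine le_trans ?_ (Finset.sum_le_sum_of_subset_of_nonneg
      (show intBall N q ⊆ _ from Finset.filter_subset _ _)
      fun _ _ _ => Finset.prod_nonneg fun _ _ => (Real.exp_pos _).le)
    rw [← nsmul_eq_mul, ← Finset.sum_const]
    refine Finset.sum_le_sum fun z hz => ?_
    have h3 : ∑ j, z j ^ 2 ≤ (q : ℤ) := (Finset.mem_filter.1 hz).2
    rw [← Real.exp_sum]
    apply Real.exp_le_exp.2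
    rw [Finset.sum_neg_distrib]
    have h4 : ∑ j, (z j : ℝ) ^ 2 ≤ q := by exact_mod_cast h3
    linarith
  rw [Real.exp_neg, ← div_eq_mul_inv, div_le_iff₀ (Real.exp_pos _)] at h2
  linarith

/-- Representatives of the fibres of a map with values in a finite set. -/
theorem exists_finset_representatives {α β : Type*} (S : Set α) (f : α → β)
    (B : Finset β) (hB : ∀ x ∈ S, f x ∈ B) :
    ∃ F : Finset α, (↑F ⊆ S) ∧ F.card ≤ B.card ∧ ∀ x ∈ S, ∃ y ∈ F, f y = f x := by
  classical
  rcases S.eq_empty_or_nonempty with rfl | ⟨x₀, hx₀⟩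
  · exact ⟨∅, by simp, by simp, by simp⟩
  have : ∀ b : β, ∃ y ∈ S, (∃ x ∈ S, f x = b) → f y = b := by
    intro b
    by_cases h : ∃ x ∈ S, f x = b
    · obtain ⟨x, hx, hxb⟩ := h
      exact ⟨x, hx, fun _ => hxb⟩
    · exact ⟨x₀, hx₀, fun h' => absurd h' h⟩
  choose r hr hrf using this
  refine ⟨B.image r, ?_, Finset.card_image_le, fun x hx => ⟨r (f x), ?_, hrf _ ⟨x, hx, rfl⟩⟩⟩
  · intro y hy
    obtain ⟨b, _, rfl⟩ := Finset.mem_image.1 (Finset.mem_coe.1 hy)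
    exact hr b
  · exact Finset.mem_image_of_mem r (hB x hx)

variable {a b : ℝ} {ρ : Measure ℝ} {N : ℕ} {τ : ℕ → ℝ}

/-- The pairs `(c, g)` such that `prim a c g` has size at most `R`. -/
def linkBall (a R : ℝ) : Set (ℝ × (ℝ → ℝ)) := {p | |p.1| ≤ R ∧ |p.2 a| ≤ R ∧ IsLink R p.2}

/-- The slope at the `j`-th knot in units of `h₀`. -/
def slopeCode (h₀ : ℝ) (τ : ℕ → ℝ) (p : ℝ × (ℝ → ℝ)) (j : ℕ) : ℤ := ⌊p.2 (τ j) / h₀⌋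

/-- The value at the `j`-th knot in units of `h₀²`. -/
def valueCode (a h₀ : ℝ) (τ : ℕ → ℝ) (p : ℝ × (ℝ → ℝ)) (j : ℕ) : ℤ :=
  ⌊prim a p.1 p.2 (τ j) / h₀ ^ 2⌋

/-- The increments of the rounded slopes, and those of the rounded values after the contribution
of the rounded slopes is removed. Their squares have a sum of order `N`. -/
def incrCode (a h₀ : ℝ) (τ : ℕ → ℝ) (N : ℕ) (p : ℝ × (ℝ → ℝ)) :
    (ℤ × ℤ) × ((Fin N → ℤ) × (Fin N → ℤ)) :=
  ((slopeCode h₀ τ p 0, valueCode a h₀ τ p 0),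
    (fun j => slopeCode h₀ τ p (j + 1) - slopeCode h₀ τ p j,
     fun j => valueCode a h₀ τ p (j + 1) - valueCode a h₀ τ p j -
      ⌊(τ (j + 1) - τ j) * slopeCode h₀ τ p j / h₀⌋))

/-- The increments determine the codes at all knots, by summation from the left. -/
theorem codes_eq_of_incrCode_eq {h₀ : ℝ} {p q : ℝ × (ℝ → ℝ)}
    (h : incrCode a h₀ τ N p = incrCode a h₀ τ N q) {j : ℕ} (hj : j ≤ N) :
    slopeCode h₀ τ p j = slopeCode h₀ τ q j ∧ valueCode a h₀ τ p j = valueCode a h₀ τ q j := by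
  simp only [incrCode, Prod.mk.injEq] at h
  obtain ⟨⟨h1, h2⟩, h3, h4⟩ := h
  induction j with
  | zero => exact ⟨h1, h2⟩
  | succ j ih =>
    obtain ⟨i1, i2⟩ := ih (Nat.le_of_succ_le hj)
    have e1 := congrFun h3 ⟨j, hj⟩
    have e2 := congrFun h4 ⟨j, hj⟩
    simp only at e1 e2
    rw [i1] at e1 e2
    rw [i2] at e2
    exact ⟨by linarith, by linarith⟩

theorem abs_floor_sub_le (x : ℝ) : |(⌊x⌋ : ℝ) - x| ≤ 1 := by
  rw [abs_le]
  constructor <;> linarith [Int.floor_le x, Int.lt_floor_add_one x]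

theorem abs_sub_le_of_floor_eq {x y u : ℝ} (hu : 0 < u) (h : ⌊x / u⌋ = ⌊y / u⌋) : |x - y| ≤ u := by
  have h1 := Int.abs_sub_lt_one_of_floor_eq_floor h
  rw [← sub_div, abs_div, abs_of_pos hu, div_lt_one hu] at h1
  exact h1.le

/-- The increments have a sum of squares of order `N`: the increments of the slopes and the Taylor
remainders of the values are controlled by the energy, and rounding costs `O(1)` per cell. -/
theorem IsKnots.sum_incrCode_sq_le (h : IsKnots a b ρ N τ) {R h₀ : ℝ} (hh0 : 0 < h₀)
    (hh : ∀ i < N, τ (i + 1) - τ i ≤ h₀) {p : ℝ × (ℝ → ℝ)} (hp : p ∈ linkBall a R) :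
    (∑ j, (((incrCode a h₀ τ N p).2.1 j : ℝ)) ^ 2 ≤ 2 * R ^ 2 / h₀ + 18 * N) ∧
    (∑ j, (((incrCode a h₀ τ N p).2.2 j : ℝ)) ^ 2 ≤ 2 * R ^ 2 / h₀ + 18 * N) := by
  obtain ⟨V, hV, hVJ, hgV⟩ := hp.2.2.energy
  have hg := hp.2.2.cont
  have hVj : ∀ j, 0 ≤ V (τ (j + 1)) - V (τ j) := fun j => sub_nonneg.2 (hV (h.mono (Nat.le_succ _)))
  have hsum : ∑ j : Fin N, (2 * (V (τ (j + 1)) - V (τ j)) / h₀ + 18) ≤ 2 * R ^ 2 / h₀ + 18 * N := by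
    rw [Finset.sum_add_distrib, ← Finset.sum_div, ← Finset.mul_sum]
    have := sum_increments_le τ N hVJ
    simp only [Finset.sum_const, Finset.card_univ, Fintype.card_fin, nsmul_eq_mul]
    have h1 : 2 * ∑ j : Fin N, (V (τ (j + 1)) - V (τ j)) / 1 ≤ 2 * R ^ 2 := by simpa using this
    simp only [div_one] at h1
    have h2 : (2 * ∑ j : Fin N, (V (τ (j + 1)) - V (τ j))) / h₀ ≤ 2 * R ^ 2 / h₀ := by gcongr
    linarith
  have hle : ∀ j < N, 0 ≤ τ (j + 1) - τ j := fun j _ => sub_nonneg.2 (h.mono (Nat.le_succ _))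
  have hsq : ∀ (j : ℕ) (y k : ℝ), k ≤ 3 → 0 ≤ k →
      |y| ≤ Real.sqrt (V (τ (j + 1)) - V (τ j)) / Real.sqrt h₀ + k →
      y ^ 2 ≤ 2 * (V (τ (j + 1)) - V (τ j)) / h₀ + 18 := by
    intro j y k hk hk0 hy
    set u := Real.sqrt (V (τ (j + 1)) - V (τ j)) / Real.sqrt h₀ with hu
    have hu0 : 0 ≤ u := by positivity
    have hu2 : u ^ 2 = (V (τ (j + 1)) - V (τ j)) / h₀ := by
      rw [hu, div_pow, Real.sq_sqrt (hVj j), Real.sq_sqrt hh0.le]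
    have h1 : y ^ 2 ≤ (u + k) ^ 2 := by
      rw [← sq_abs y]; gcongr
    rw [mul_div_assoc, ← hu2]
    nlinarith [sq_nonneg (u - k)]
  have hsh : h₀ = Real.sqrt h₀ * Real.sqrt h₀ := (Real.mul_self_sqrt hh0.le).symm
  have hs0 : 0 < Real.sqrt h₀ := Real.sqrt_pos.2 hh0
  constructor
  · refine le_trans (Finset.sum_le_sum fun j _ => hsq j _ 2 (by norm_num) (by norm_num) ?_) hsum
    simp only [incrCode, slopeCode]
    push_cast
    have h1 := abs_increment_le hgV hV (h.mono (Nat.le_succ j)) (hh j j.2)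
    have h2 : |p.2 (τ (j + 1)) / h₀ - p.2 (τ j) / h₀| ≤
        Real.sqrt (V (τ (j + 1)) - V (τ j)) / Real.sqrt h₀ := by
      rw [← sub_div, abs_div, abs_of_pos hh0, div_le_div_iff₀ hh0 hs0]
      calc _ ≤ (Real.sqrt h₀ * Real.sqrt (V (τ (j + 1)) - V (τ j))) * Real.sqrt h₀ := by gcongr
        _ = Real.sqrt (V (τ (j + 1)) - V (τ j)) * (Real.sqrt h₀ * Real.sqrt h₀) := by ring
        _ = _ := by rw [← hsh]
    have h3 := abs_floor_sub_le (p.2 (τ (j + 1)) / h₀)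
    have h4 := abs_floor_sub_le (p.2 (τ j) / h₀)
    rw [abs_le] at *
    constructor <;> linarith [h2.1, h2.2, h3.1, h3.2, h4.1, h4.2]
  · refine le_trans (Finset.sum_le_sum fun j _ => hsq j _ 3 (by norm_num) (by norm_num) ?_) hsum
    simp only [incrCode]
    push_cast
    set d := τ (j + 1) - τ j with hd
    have hd0 : 0 ≤ d := hle j j.2
    have hdh : d ≤ h₀ := hh j j.2
    have hd1 : d / h₀ ≤ 1 := by rw [div_le_one hh0]; exact hdh
    have h1 := prim_taylor_abs_le hg (a := a) (c := p.1) (h.mono (Nat.le_succ j))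
      (B := Real.sqrt h₀ * Real.sqrt (V (τ (j + 1)) - V (τ j))) (fun u hu => by
        refine (abs_increment_le hgV hV hu.1 (h₀ := h₀) (by linarith [hu.2])).trans ?_
        gcongr
        exact hV hu.2)
    have h2 : |prim a p.1 p.2 (τ (j + 1)) / h₀ ^ 2 - prim a p.1 p.2 (τ j) / h₀ ^ 2 -
        (d / h₀) * (p.2 (τ j) / h₀)| ≤ Real.sqrt (V (τ (j + 1)) - V (τ j)) / Real.sqrt h₀ := by
      have e : prim a p.1 p.2 (τ (j + 1)) / h₀ ^ 2 - prim a p.1 p.2 (τ j) / h₀ ^ 2 -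
          (d / h₀) * (p.2 (τ j) / h₀) = (prim a p.1 p.2 (τ (j + 1)) - prim a p.1 p.2 (τ j) -
            p.2 (τ j) * d) / h₀ ^ 2 := by field_simp
      rw [e, abs_div, abs_of_pos (by positivity : 0 < h₀ ^ 2), div_le_div_iff₀ (by positivity) hs0]
      calc _ ≤ (d * (Real.sqrt h₀ * Real.sqrt (V (τ (j + 1)) - V (τ j)))) * Real.sqrt h₀ := by
            gcongr
        _ ≤ (h₀ * (Real.sqrt h₀ * Real.sqrt (V (τ (j + 1)) - V (τ j)))) * Real.sqrt h₀ := by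
            gcongr
        _ = Real.sqrt (V (τ (j + 1)) - V (τ j)) * (h₀ * (Real.sqrt h₀ * Real.sqrt h₀)) := by ring
        _ = _ := by rw [← hsh]; ring
    have h3 := abs_floor_sub_le (prim a p.1 p.2 (τ (j + 1)) / h₀ ^ 2)
    have h4 := abs_floor_sub_le (prim a p.1 p.2 (τ j) / h₀ ^ 2)
    have h5 := abs_floor_sub_le (d * slopeCode h₀ τ p j / h₀)
    -- the rounding of the slope costs at most `1`
    have h6 : 0 ≤ (d / h₀) * (p.2 (τ j) / h₀) - d * slopeCode h₀ τ p j / h₀ ∧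
        (d / h₀) * (p.2 (τ j) / h₀) - d * slopeCode h₀ τ p j / h₀ ≤ 1 := by
      have e : (d / h₀) * (p.2 (τ j) / h₀) - d * slopeCode h₀ τ p j / h₀ =
          (d / h₀) * (p.2 (τ j) / h₀ - slopeCode h₀ τ p j) := by ring
      have h7 : 0 ≤ p.2 (τ j) / h₀ - slopeCode h₀ τ p j := sub_nonneg.2 (Int.floor_le _)
      have h8 : p.2 (τ j) / h₀ - slopeCode h₀ τ p j ≤ 1 := by
        have := Int.lt_floor_add_one (p.2 (τ j) / h₀)
        unfold slopeCode; linarith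
      have h9 : 0 ≤ d / h₀ := by positivity
      rw [e]
      exact ⟨by positivity, mul_le_one₀ hd1 h7 h8⟩
    -- the roundings of the two values have opposite signs
    have h10 := Int.floor_le (prim a p.1 p.2 (τ (j + 1)) / h₀ ^ 2)
    have h11 := Int.lt_floor_add_one (prim a p.1 p.2 (τ (j + 1)) / h₀ ^ 2)
    have h12 := Int.floor_le (prim a p.1 p.2 (τ j) / h₀ ^ 2)
    have h13 := Int.lt_floor_add_one (prim a p.1 p.2 (τ j) / h₀ ^ 2)
    have h14 := Int.floor_le (d * slopeCode h₀ τ p j / h₀)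
    have h15 := Int.lt_floor_add_one (d * slopeCode h₀ τ p j / h₀)
    unfold valueCode
    rw [abs_le] at h2 ⊢
    constructor <;> linarith [h2.1, h2.2, h6.1, h6.2]

/-- A ball of link functions is covered by `exp (K N)` of its members, in the sense of values and
slopes at the knots, with a resolution of order `N⁻²` for the values and `N⁻¹` for the slopes. -/
theorem exists_cover (hab : a < b) (R : ℝ) : ∃ K : ℕ, ∀ (N : ℕ) (ρ : Measure ℝ)
    (τ : ℕ → ℝ), 0 < N → IsKnots a b ρ N τ → ∃ F : Finset (ℝ × (ℝ → ℝ)), (↑F ⊆ linkBall a R) ∧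
      (F.card : ℝ) ≤ Real.exp (K * N) ∧ ∀ p ∈ linkBall a R, ∃ q ∈ F, ∀ j < N,
        |prim a p.1 p.2 (τ j) - prim a q.1 q.2 (τ j)| ≤ (2 * (b - a) / N) ^ 2 ∧
        |p.2 (τ j) - q.2 (τ j)| ≤ 2 * (b - a) / N := by
  have hL : 0 < b - a := by linarith
  set κ : ℕ := ⌈R ^ 2 / (b - a)⌉₊ + 18 with hκ
  set A : ℕ := ⌈R / (2 * (b - a))⌉₊ + ⌈R / (2 * (b - a)) ^ 2⌉₊ + 1 with hA
  refine ⟨2 * κ + 4 + (25 * A ^ 2 + 4), fun N ρ τ hN h => ?_⟩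
  have hN' : (0 : ℝ) < N := by exact_mod_cast hN
  have hN1 : (1 : ℝ) ≤ N := by exact_mod_cast hN
  set h₀ := 2 * (b - a) / N with hh₀
  have hh0 : 0 < h₀ := by positivity
  set q : ℕ := κ * N with hq
  set B₀ : Finset ℤ := Finset.Icc (-((A * N ^ 2 : ℕ) : ℤ)) (A * N ^ 2 : ℕ) with hB₀
  set B := (B₀ ×ˢ B₀) ×ˢ (intBall N q ×ˢ intBall N q) with hB
  have hq2 : 2 * R ^ 2 / h₀ + 18 * N ≤ q := by
    have e : 2 * R ^ 2 / h₀ = R ^ 2 / (b - a) * N := by rw [hh₀]; field_simp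
    rw [e, hq, hκ]
    push_cast
    have := Nat.le_ceil (R ^ 2 / (b - a))
    nlinarith
  have hmem : ∀ p ∈ linkBall a R, incrCode a h₀ τ N p ∈ B := by
    intro p hp
    obtain ⟨h1, h2⟩ := h.sum_incrCode_sq_le hh0 h.length_le hp
    have hm0 : ∀ x : ℝ, |x| ≤ A * N ^ 2 - 1 → ⌊x⌋ ∈ B₀ := by
      intro x hx
      have h3 := abs_floor_sub_le x
      have h4 : |(⌊x⌋ : ℝ)| ≤ A * N ^ 2 := by
        have := abs_add_le ((⌊x⌋ : ℝ) - x) x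
        rw [sub_add_cancel] at this
        linarith
      have h5 : |⌊x⌋| ≤ ((A * N ^ 2 : ℕ) : ℤ) := by exact_mod_cast h4
      exact Finset.mem_Icc.2 (abs_le.1 h5)
    have hA1 : R / (2 * (b - a)) ≤ A - 1 := by
      have := Nat.le_ceil (R / (2 * (b - a)))
      have h0 : (0 : ℝ) ≤ ⌈R / (2 * (b - a)) ^ 2⌉₊ := Nat.cast_nonneg _
      rw [hA]; push_cast; linarith
    have hA2 : R / (2 * (b - a)) ^ 2 ≤ A - 1 := by
      have := Nat.le_ceil (R / (2 * (b - a)) ^ 2)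
      have h0 : (0 : ℝ) ≤ ⌈R / (2 * (b - a))⌉₊ := Nat.cast_nonneg _
      rw [hA]; push_cast; linarith
    have hA0 : (1 : ℝ) ≤ A := by
      rw [hA]; push_cast
      have h0 : (0 : ℝ) ≤ ⌈R / (2 * (b - a))⌉₊ := Nat.cast_nonneg _
      have h0' : (0 : ℝ) ≤ ⌈R / (2 * (b - a)) ^ 2⌉₊ := Nat.cast_nonneg _
      linarith
    have hNN : (N : ℝ) ≤ N ^ 2 := by nlinarith
    have hNN1 : (1 : ℝ) ≤ N ^ 2 := by nlinarith
    refine Finset.mem_product.2 ⟨Finset.mem_product.2 ⟨?_, ?_⟩, Finset.mem_product.2 ⟨?_, ?_⟩⟩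
    · refine hm0 _ ?_
      rw [h.zero, abs_div, abs_of_pos hh0]
      calc |p.2 a| / h₀ ≤ R / h₀ := by gcongr; exact hp.2.1
        _ = R / (2 * (b - a)) * N := by rw [hh₀]; field_simp
        _ ≤ (A - 1) * N ^ 2 := mul_le_mul hA1 hNN hN'.le (by linarith)
        _ ≤ _ := by linarith
    · refine hm0 _ ?_
      rw [h.zero, prim_self, abs_div, abs_of_pos (by positivity : 0 < h₀ ^ 2)]
      calc |p.1| / h₀ ^ 2 ≤ R / h₀ ^ 2 := by gcongr; exact hp.1
        _ = R / (2 * (b - a)) ^ 2 * N ^ 2 := by rw [hh₀]; field_simp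
        _ ≤ (A - 1) * N ^ 2 := by gcongr
        _ ≤ _ := by linarith
    · apply mem_intBall
      have := h1.trans hq2
      exact_mod_cast this
    · apply mem_intBall
      have := h2.trans hq2
      exact_mod_cast this
  classical
  obtain ⟨F, hF1, hF2, hF3⟩ := exists_finset_representatives (linkBall a R)
    (incrCode a h₀ τ N) B hmem
  refine ⟨F, hF1, ?_, fun p hp => ?_⟩
  · have hc0 : (B₀.card : ℝ) ≤ 5 * A * N ^ 2 := by
      have h1 : B₀.card = 2 * (A * N ^ 2) + 1 := by
        rw [hB₀, Int.card_Icc]; omega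
      have h2 : 1 ≤ A * N ^ 2 := by
        have : 1 ≤ A := by omega
        have : 1 ≤ N ^ 2 := Nat.one_le_pow _ _ hN
        nlinarith
      rw [h1]
      have h3 : 2 * (A * N ^ 2) + 1 ≤ 5 * (A * N ^ 2) := by omega
      have : ((2 * (A * N ^ 2) + 1 : ℕ) : ℝ) ≤ ((5 * (A * N ^ 2) : ℕ) : ℝ) := by exact_mod_cast h3
      refine this.trans (le_of_eq ?_)
      push_cast; ring
    have hci : ((intBall N q).card : ℝ) ≤ Real.exp ((κ + 2) * N) := by
      refine (card_intBall_le N q).trans ?_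
      have h3 : (3 : ℝ) ^ N ≤ Real.exp (2 * N) := by
        rw [mul_comm, Real.exp_nat_mul]
        gcongr
        linarith [Real.add_one_le_exp (2 : ℝ)]
      calc _ ≤ Real.exp q * Real.exp (2 * N) := by gcongr
        _ = _ := by rw [← Real.exp_add, hq]; push_cast; ring_nf
    have hc1 : (B₀.card : ℝ) * B₀.card ≤ Real.exp ((25 * A ^ 2 + 4) * N) := by
      have h4 : (25 * (A : ℝ) ^ 2) ≤ Real.exp (25 * A ^ 2 * N) := by
        refine le_trans ?_ (Real.add_one_le_exp _)
        have : 25 * (A : ℝ) ^ 2 * 1 ≤ 25 * A ^ 2 * N := by gcongr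
        linarith
      have h5 : (N : ℝ) ^ 4 ≤ Real.exp (4 * N) := by
        have : (N : ℝ) ≤ Real.exp N := by linarith [Real.add_one_le_exp (N : ℝ)]
        calc (N : ℝ) ^ 4 ≤ Real.exp N ^ 4 := by gcongr
          _ = _ := by rw [← Real.exp_nat_mul]; norm_num
      calc (B₀.card : ℝ) * B₀.card ≤ (5 * A * N ^ 2) * (5 * A * N ^ 2) := by gcongr
        _ = (25 * A ^ 2) * N ^ 4 := by ring
        _ ≤ Real.exp (25 * A ^ 2 * N) * Real.exp (4 * N) := by gcongr
        _ = _ := by rw [← Real.exp_add]; ring_nf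
    calc (F.card : ℝ) ≤ B.card := by exact_mod_cast hF2
      _ = (B₀.card * B₀.card) * ((intBall N q).card * (intBall N q).card) := by
        rw [hB]; simp only [Finset.card_product]; push_cast; ring
      _ ≤ Real.exp ((25 * A ^ 2 + 4) * N) * (Real.exp ((κ + 2) * N) * Real.exp ((κ + 2) * N)) := by
        gcongr
      _ = _ := by rw [← Real.exp_add, ← Real.exp_add]; push_cast; ring_nf
  · obtain ⟨q', hq'F, hq'⟩ := hF3 p hp
    refine ⟨q', hq'F, fun j hj => ?_⟩
    obtain ⟨e1, e2⟩ := codes_eq_of_incrCode_eq hq'.symm hj.le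
    exact ⟨abs_sub_le_of_floor_eq (by positivity) e2, abs_sub_le_of_floor_eq hh0 e1⟩

end

section

/-! ### Comparison of the empirical and the population norm -/

/-- Lower deviations of a sum of independent variables with values in `[0, 1]`, up to a factor `2`
in the mean. -/
theorem measure_sum_lt_mean_le {α : Type*} [MeasurableSpace α] {ν : Measure α}
    [IsProbabilityMeasure ν] {ψ : α → ℝ} (hψ : Measurable ψ) (h0 : ∀ x, 0 ≤ ψ x)
    (h1 : ∀ x, ψ x ≤ 1) (n : ℕ) (t : ℝ) :
    (Measure.pi fun _ : Fin n => ν) {z | 2 * ∑ i, ψ (z i) + 2 * t < n * ∫ x, ψ x ∂ν} ≤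
      ENNReal.ofReal (Real.exp (-t)) := by
  set E := ∫ x, ψ x ∂ν with hE
  have hint : Integrable ψ ν := Integrable.of_bound hψ.aestronglyMeasurable 1
    (ae_of_all _ fun x => by rw [Real.norm_eq_abs, abs_of_nonneg (h0 x)]; exact h1 x)
  have hone : ∫⁻ x, ENNReal.ofReal (Real.exp (-ψ x)) ∂ν ≤ ENNReal.ofReal (Real.exp (-(E / 2))) := by
    have hi : Integrable (fun x => 1 - ψ x / 2) ν := (integrable_const _).sub (hint.div_const 2)
    calc ∫⁻ x, ENNReal.ofReal (Real.exp (-ψ x)) ∂ν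
        ≤ ∫⁻ x, ENNReal.ofReal (1 - ψ x / 2) ∂ν := by
          refine lintegral_mono fun x => ENNReal.ofReal_le_ofReal ?_
          have hx0 := h0 x
          have hx1 := h1 x
          have h2 : 1 + ψ x ≤ Real.exp (ψ x) := by
            have := Real.add_one_le_exp (ψ x); linarith
          rw [Real.exp_neg]
          refine (inv_anti₀ (by linarith) h2).trans ?_
          rw [inv_le_iff_one_le_mul₀ (by linarith)]
          nlinarith
      _ = ENNReal.ofReal (∫ x, (1 - ψ x / 2) ∂ν) := by
          rw [ofReal_integral_eq_lintegral_ofReal hi]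
          exact ae_of_all _ fun x => by have := h1 x; simp only [Pi.zero_apply]; linarith
      _ ≤ _ := by
          apply ENNReal.ofReal_le_ofReal
          rw [integral_sub (integrable_const _) (hint.div_const 2), integral_div]
          simp only [integral_const, probReal_univ, one_smul]
          have := Real.add_one_le_exp (-(E / 2))
          linarith
  have hF : Measurable fun z : Fin n → α => ∏ i, ENNReal.ofReal (Real.exp (-ψ (z i))) := by
    fun_prop
  have htot : ∫⁻ z, ∏ i, ENNReal.ofReal (Real.exp (-ψ (z i))) ∂(Measure.pi fun _ : Fin n => ν) ≤
      ENNReal.ofReal (Real.exp (-(n * E / 2))) := by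
    rw [lintegral_pi_prod (fun _ x => ENNReal.ofReal (Real.exp (-ψ x))) (fun _ => by fun_prop)]
    rw [Finset.prod_const, Finset.card_univ, Fintype.card_fin]
    calc _ ≤ ENNReal.ofReal (Real.exp (-(E / 2))) ^ n := pow_le_pow_left' hone n
      _ = _ := by
        rw [← ENNReal.ofReal_pow (Real.exp_pos _).le, ← Real.exp_nat_mul]
        congr 2; ring
  refine (measure_mono ?_).trans (measure_exp_tail_le hF htot t)
  intro z hz
  simp only [Set.mem_ofPred_eq] at hz ⊢
  rw [← ENNReal.ofReal_prod_of_nonneg (fun _ _ => (Real.exp_pos _).le), ← Real.exp_sum]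
  apply ENNReal.ofReal_le_ofReal
  apply Real.exp_le_exp.2
  rw [Finset.sum_neg_distrib]
  linarith

variable {𝒳 : Type*} [MeasurableSpace 𝒳] {a b : ℝ} {ρ : Measure ℝ} {N : ℕ} {τ : ℕ → ℝ}

/-- A link function is determined by its values and slopes at the knots, up to the Taylor
remainders. -/
theorem IsKnots.prim_sub_sq_le (h : IsKnots a b ρ N τ) {c c' : ℝ} {g V g' V' : ℝ → ℝ}
    (hg : Continuous g) (hV : Monotone V)
    (hgV : ∀ s t, s ≤ t → (g t - g s) ^ 2 ≤ (t - s) * (V t - V s))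
    (hg' : Continuous g') (hV' : Monotone V')
    (hgV' : ∀ s t, s ≤ t → (g' t - g' s) ^ 2 ≤ (t - s) * (V' t - V' s))
    {h₀ : ℝ} (hh0 : 0 ≤ h₀) (hh : ∀ i < N, τ (i + 1) - τ i ≤ h₀)
    (hclose : ∀ j < N, |prim a c g (τ j) - prim a c' g' (τ j)| ≤ h₀ ^ 2 ∧
      |g (τ j) - g' (τ j)| ≤ h₀) {t : ℝ} (ht : t ∈ Set.Ico a b) :
    (prim a c g t - prim a c' g' t) ^ 2 ≤ 12 * h₀ ^ 4 + 3 * h₀ ^ 3 *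
      ∑ j : Fin N, ((V (τ (j + 1)) - V (τ j)) + (V' (τ (j + 1)) - V' (τ j))) * cellInd τ 0 j t := by
  obtain ⟨j, hj, hjt⟩ := h.exists_cell ht.1 ht.2
  have h1 := h.taylorRem_sq_le c hg hV hgV hh ht
  have h2 := h.taylorRem_sq_le c' hg' hV' hgV' hh ht
  simp only [add_mul, Finset.sum_add_distrib, mul_add]
  set r := taylorRem a c g τ N t with hr
  set r' := taylorRem a c' g' τ N t with hr'
  have e1 := h.taylorRem_eq c g hj hjt
  have e2 := h.taylorRem_eq c' g' hj hjt
  obtain ⟨hc1, hc2⟩ := hclose j hj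
  have ht0 : 0 ≤ t - τ j := by linarith [hjt.1]
  have ht1 : t - τ j ≤ h₀ := by linarith [hjt.2, hh j hj]
  set p := (prim a c g (τ j) - prim a c' g' (τ j)) + (g (τ j) - g' (τ j)) * (t - τ j) with hp
  have hpabs : |p| ≤ 2 * h₀ ^ 2 := by
    refine (abs_add_le _ _).trans ?_
    rw [abs_mul, abs_of_nonneg ht0]
    have : |g (τ j) - g' (τ j)| * (t - τ j) ≤ h₀ * h₀ := by gcongr
    nlinarith
  have hpsq : p ^ 2 ≤ (2 * h₀ ^ 2) ^ 2 := by
    rw [← sq_abs p]; gcongr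
  have heq : prim a c g t - prim a c' g' t = p + r - r' := by
    rw [hp, hr, hr', e1, e2]; ring
  rw [heq]
  nlinarith [sq_nonneg (p - r), sq_nonneg (p + r'), sq_nonneg (r + r')]

theorem abs_prim_le {R : ℝ} {p : ℝ × (ℝ → ℝ)} (hR : 0 ≤ R) (hp : p ∈ linkBall a R) {t : ℝ}
    (ht : t ∈ Set.Icc a b) :
    |prim a p.1 p.2 t| ≤ R + (R + R * Real.sqrt (b - a)) * (b - a) := by
  obtain ⟨h1, h2, h3⟩ := hp
  have hab : a ≤ b := ht.1.trans ht.2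
  have hG : ∀ u ∈ Set.Icc a b, |p.2 u| ≤ R + R * Real.sqrt (b - a) := fun u hu =>
    (h3.abs_le hR hu).trans (by linarith)
  have h4 := prim_abs_sub_le h3.cont (a₀ := a) (c := p.1) hG (Set.left_mem_Icc.2 hab) ht
  rw [prim_self] at h4
  have h5 : (R + R * Real.sqrt (b - a)) * |t - a| ≤ (R + R * Real.sqrt (b - a)) * (b - a) := by
    rw [abs_of_nonneg (by linarith [ht.1])]
    gcongr
    exact ht.2
  have h6 := abs_sub_abs_le_abs_sub (prim a p.1 p.2 t) p.1
  linarith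

/-- For one index `T` and uniformly over a ball of link functions, the population norm is at most
a multiple of the empirical norm, up to `N⁻⁴ + N / n`. -/
theorem exists_norm_comparison (hab : a < b) {R : ℝ} (hR : 0 ≤ R) : ∃ C : ℝ, 0 ≤ C ∧
    ∀ (μ : Measure (𝒳 × ℝ)) [IsProbabilityMeasure μ] (T g₀ : 𝒳 → ℝ), Measurable T →
      (∀ x, T x ∈ Set.Ico a b) → Measurable g₀ → (∀ x, |g₀ x| ≤ R) →
      ∀ (N n : ℕ) (τ : ℕ → ℝ), 0 < N → IsKnots a b (μ.map fun z => T z.1) N τ →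
      (Measure.pi fun _ : Fin n => μ) {z | ¬ ∀ p ∈ linkBall a R,
        n * ∫ w, (prim a p.1 p.2 (T w.1) - g₀ w.1) ^ 2 ∂μ ≤
          8 * ∑ i, (prim a p.1 p.2 (T (z i).1) - g₀ (z i).1) ^ 2 + C * (n / N ^ 4 + N)} ≤
      N * ENNReal.ofReal (Real.exp (-(n * (2 / N)))) + ENNReal.ofReal (Real.exp (-N)) := by
  obtain ⟨K, hK⟩ := exists_cover hab R
  have hL : 0 < b - a := by linarith
  set Fb : ℝ := 2 * R + (R + R * Real.sqrt (b - a)) * (b - a) + 1 with hFb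
  have hFb0 : 0 < Fb := by positivity
  set L := b - a with hLdef
  set C₁ : ℝ := 192 * L ^ 4 + 288 * L ^ 3 * R ^ 2 with hC₁
  refine ⟨10 * C₁ + 4 * Fb ^ 2 * (K + 1), by positivity, ?_⟩
  intro μ _ T g₀ hT hTab hg₀ hg₀R N n τ hN h
  have hN' : (0 : ℝ) < N := by exact_mod_cast hN
  obtain ⟨F, hF1, hF2, hF3⟩ := hK N _ τ hN h
  set h₀ := 2 * L / N with hh₀
  have hh0 : 0 < h₀ := by positivity
  have hh : ∀ i < N, τ (i + 1) - τ i ≤ h₀ := h.length_le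
  set f : ℝ × (ℝ → ℝ) → 𝒳 × ℝ → ℝ := fun p w => prim a p.1 p.2 (T w.1) - g₀ w.1 with hf
  have hfm : ∀ p ∈ linkBall a R, Measurable (f p) := fun p hp =>
    (((continuous_prim hp.2.2.cont a p.1).measurable.comp hT).sub hg₀).comp measurable_fst
  have hfb : ∀ p ∈ linkBall a R, ∀ w, |f p w| ≤ Fb := by
    intro p hp w
    have h1 := abs_prim_le hR hp (Set.Ico_subset_Icc_self (hTab w.1))
    have h2 := hg₀R w.1
    calc |f p w| ≤ |prim a p.1 p.2 (T w.1)| + |g₀ w.1| := abs_sub _ _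
      _ ≤ _ := by rw [hFb]; linarith
  have hfint : ∀ p ∈ linkBall a R, Integrable (fun w => f p w ^ 2) μ := by
    intro p hp
    refine Integrable.of_bound ((hfm p hp).pow_const 2).aestronglyMeasurable (Fb ^ 2)
      (ae_of_all _ fun w => ?_)
    rw [Real.norm_eq_abs, abs_pow]
    exact pow_le_pow_left₀ (abs_nonneg _) (hfb p hp w) 2
  set B1 : Set (Fin n → 𝒳 × ℝ) := {z | covs z ∉ fewPerCell T τ N n} with hB1
  set B2 : ℝ × (ℝ → ℝ) → Set (Fin n → 𝒳 × ℝ) := fun q =>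
    {z | 2 * ∑ i, f q (z i) ^ 2 / Fb ^ 2 + 2 * ((K + 1) * N) <
      n * ∫ w, f q w ^ 2 / Fb ^ 2 ∂μ} with hB2
  have hB2m : ∀ q ∈ F, (Measure.pi fun _ : Fin n => μ) (B2 q) ≤
      ENNReal.ofReal (Real.exp (-((K + 1) * N))) := by
    intro q hq
    have hq' := hF1 hq
    refine measure_sum_lt_mean_le (ψ := fun w => f q w ^ 2 / Fb ^ 2)
      (((hfm q hq').pow_const 2).div_const _) (fun w => by positivity) (fun w => ?_) n _
    rw [div_le_one (by positivity), ← sq_abs]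
    exact pow_le_pow_left₀ (abs_nonneg _) (hfb q hq' w) 2
  have hsub : {z : Fin n → 𝒳 × ℝ | ¬ ∀ p ∈ linkBall a R,
        n * ∫ w, (prim a p.1 p.2 (T w.1) - g₀ w.1) ^ 2 ∂μ ≤
          8 * ∑ i, (prim a p.1 p.2 (T (z i).1) - g₀ (z i).1) ^ 2 +
            (10 * C₁ + 4 * Fb ^ 2 * (K + 1)) * (n / N ^ 4 + N)} ⊆ B1 ∪ ⋃ q ∈ F, B2 q := by
    intro z hz
    by_contra hcon
    apply hz
    intro p hp
    simp only [Set.mem_union, Set.mem_iUnion, not_or, not_exists, hB1, hB2, Set.mem_ofPred_eq,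
      not_not, not_lt] at hcon
    obtain ⟨hz1, hz2⟩ := hcon
    obtain ⟨q, hq, hclose⟩ := hF3 p hp
    have hq' := hF1 hq
    specialize hz2 q hq
    obtain ⟨V, hV, hVJ, hVg⟩ := hp.2.2.energy
    obtain ⟨V', hV', hVJ', hVg'⟩ := hq'.2.2.energy
    set dV : Fin N → ℝ := fun j =>
      (V (τ (j + 1)) - V (τ j)) + (V' (τ (j + 1)) - V' (τ j)) with hdV
    have hdV0 : ∀ j, 0 ≤ dV j := fun j => add_nonneg
      (sub_nonneg.2 (hV (h.mono (Nat.le_succ _)))) (sub_nonneg.2 (hV' (h.mono (Nat.le_succ _))))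
    have hdVs : ∑ j, dV j ≤ 2 * R ^ 2 := by
      rw [hdV, Finset.sum_add_distrib]
      have := sum_increments_le τ N hVJ
      have := sum_increments_le τ N hVJ'
      linarith
    set U : ℝ → ℝ := fun t => 12 * h₀ ^ 4 + 3 * h₀ ^ 3 * ∑ j : Fin N, dV j * cellInd τ 0 j t with hU
    have hD : ∀ w : 𝒳 × ℝ, (f p w - f q w) ^ 2 ≤ U (T w.1) := by
      intro w
      have := h.prim_sub_sq_le hp.2.2.cont hV hVg hq'.2.2.cont hV' hVg' hh0.le hh hclose (hTab w.1)
      simp only [hf]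
      rw [sub_sub_sub_cancel_right]
      exact this
    have hUm : Measurable fun w : 𝒳 × ℝ => U (T w.1) := by
      refine measurable_const.add (measurable_const.mul (Finset.measurable_sum _ fun j _ =>
        measurable_const.mul ((measurable_cellInd τ 0 j).comp (hT.comp measurable_fst))))
    have hci : ∀ j : ℕ, Integrable (fun w : 𝒳 × ℝ => cellInd τ 0 j (T w.1)) μ := fun j =>
      Integrable.of_bound
        ((measurable_cellInd τ 0 j).comp (hT.comp measurable_fst)).aestronglyMeasurable 1
        (ae_of_all _ fun w => by
          rw [Real.norm_eq_abs, abs_of_nonneg (cellInd_nonneg _ _ _ _)]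
          exact cellInd_le_one _ _ _ _)
    have hTf : Measurable fun w : 𝒳 × ℝ => T w.1 := hT.comp measurable_fst
    have hcm : ∀ j < N, ∫ w, cellInd τ 0 j (T w.1) ∂μ ≤ 2 / N := by
      intro j hj
      have hm := h.mass_le j hj
      rw [Measure.map_apply hTf measurableSet_Ioo] at hm
      have : (fun w : 𝒳 × ℝ => cellInd τ 0 j (T w.1)) =
          ((fun w : 𝒳 × ℝ => T w.1) ⁻¹' Set.Ioo (τ j) (τ (j + 1))).indicator 1 := by
        funext w
        simp [cellInd, Set.indicator, Set.mem_preimage]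
      rw [this, integral_indicator_one (hTf measurableSet_Ioo), measureReal_def]
      exact ENNReal.toReal_le_of_le_ofReal (by positivity) hm
    have hsi : Integrable (fun w : 𝒳 × ℝ => ∑ j : Fin N, dV j * cellInd τ 0 j (T w.1)) μ :=
      integrable_finsetSum _ fun (j : Fin N) _ => (hci j).const_mul (dV j)
    have hUi : Integrable (fun w : 𝒳 × ℝ => U (T w.1)) μ :=
      (integrable_const _).add (hsi.const_mul _)
    have hUint : ∫ w, U (T w.1) ∂μ ≤ C₁ / N ^ 4 := by
      simp only [hU]
      rw [integral_add (integrable_const _) (hsi.const_mul _), integral_const_mul (3 * h₀ ^ 3),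
        integral_finsetSum _ fun (j : Fin N) _ => (hci j).const_mul (dV j)]
      simp only [integral_const, probReal_univ, one_smul, integral_const_mul]
      have h1 : ∑ j : Fin N, dV j * ∫ w, cellInd τ 0 j (T w.1) ∂μ ≤ (2 * R ^ 2) * (2 / N) := by
        calc _ ≤ ∑ j : Fin N, dV j * (2 / N) :=
              Finset.sum_le_sum fun j _ => mul_le_mul_of_nonneg_left (hcm j j.2) (hdV0 j)
          _ = (∑ j, dV j) * (2 / N) := by rw [Finset.sum_mul]
          _ ≤ _ := by gcongr
      calc _ ≤ 12 * h₀ ^ 4 + 3 * h₀ ^ 3 * ((2 * R ^ 2) * (2 / N)) := by gcongr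
        _ = (192 * L ^ 4 + 96 * L ^ 3 * R ^ 2) / N ^ 4 := by
            rw [hh₀]; field_simp; ring
        _ ≤ _ := by
            rw [hC₁]; gcongr; norm_num
    have hUsum : ∑ i, U (T (z i).1) ≤ n * (C₁ / N ^ 4) := by
      simp only [hU, Finset.sum_add_distrib, ← Finset.mul_sum]
      rw [Finset.sum_comm]
      simp only [← Finset.mul_sum, Finset.sum_const, Finset.card_univ, Fintype.card_fin,
        nsmul_eq_mul]
      have h1 : ∑ j : Fin N, dV j * ∑ i, cellInd τ 0 j (T (z i).1) ≤ (2 * R ^ 2) * (6 * n / N) := by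
        calc _ ≤ ∑ j : Fin N, dV j * (6 * n / N) :=
              Finset.sum_le_sum fun j _ => mul_le_mul_of_nonneg_left (hz1 j j.2) (hdV0 j)
          _ = (∑ j, dV j) * (6 * n / N) := by rw [Finset.sum_mul]
          _ ≤ _ := by gcongr
      calc _ ≤ 12 * (n * h₀ ^ 4) + 3 * h₀ ^ 3 * ((2 * R ^ 2) * (6 * n / N)) := by gcongr
        _ = _ := by
            rw [hh₀, hC₁]; field_simp; ring
    -- `f p` is compared with the representative `f q`, for both norms
    have s1 : ∫ w, f p w ^ 2 ∂μ ≤ 2 * ∫ w, f q w ^ 2 ∂μ + 2 * ∫ w, U (T w.1) ∂μ := by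
      rw [← integral_const_mul, ← integral_const_mul, ← integral_add ((hfint q hq').const_mul 2)
        (hUi.const_mul 2)]
      refine integral_mono (hfint p hp) (((hfint q hq').const_mul 2).add (hUi.const_mul 2))
        fun w => ?_
      have := hD w
      simp only
      nlinarith [sq_nonneg (f p w - 2 * f q w)]
    have s2 : ∑ i, f q (z i) ^ 2 ≤ 2 * ∑ i, f p (z i) ^ 2 + 2 * ∑ i, U (T (z i).1) := by
      rw [Finset.mul_sum, Finset.mul_sum, ← Finset.sum_add_distrib]
      refine Finset.sum_le_sum fun i _ => ?_
      have := hD (z i)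
      nlinarith [sq_nonneg (2 * f p (z i) - f q (z i))]
    have s3 : n * ∫ w, f q w ^ 2 ∂μ ≤ 2 * ∑ i, f q (z i) ^ 2 + 2 * ((K + 1) * N) * Fb ^ 2 := by
      rw [integral_div, ← Finset.sum_div] at hz2
      have := mul_le_mul_of_nonneg_right hz2 (sq_nonneg Fb)
      have e1 : n * ((∫ w, f q w ^ 2 ∂μ) / Fb ^ 2) * Fb ^ 2 = n * ∫ w, f q w ^ 2 ∂μ := by
        field_simp
      have e2 : (2 * ((∑ i, f q (z i) ^ 2) / Fb ^ 2) + 2 * ((K + 1) * N)) * Fb ^ 2 =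
          2 * ∑ i, f q (z i) ^ 2 + 2 * ((K + 1) * N) * Fb ^ 2 := by
        field_simp
      linarith
    have hn0 : (0 : ℝ) ≤ n := Nat.cast_nonneg n
    have s4 := mul_le_mul_of_nonneg_left s1 hn0
    have s5 := mul_le_mul_of_nonneg_left hUint hn0
    have s6 : n * (C₁ / N ^ 4) = C₁ * (n / N ^ 4) := by ring
    have s7 : 0 ≤ C₁ * (N : ℝ) := by positivity
    have s8 : 0 ≤ Fb ^ 2 * (K + 1) * ((n : ℝ) / N ^ 4) := by positivity
    change n * ∫ w, f p w ^ 2 ∂μ ≤ 8 * ∑ i, f p (z i) ^ 2 +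
      (10 * C₁ + 4 * Fb ^ 2 * (K + 1)) * (n / N ^ 4 + N)
    rw [s6] at s5 hUsum
    have s9 : (10 * C₁ + 4 * Fb ^ 2 * (K + 1)) * ((n : ℝ) / N ^ 4 + N) =
        10 * (C₁ * (n / N ^ 4)) + 10 * (C₁ * N) + 4 * (Fb ^ 2 * (K + 1) * (n / N ^ 4)) +
          2 * (2 * ((K + 1) * N) * Fb ^ 2) := by ring
    have s10 : (n : ℝ) * (2 * ∫ w, f q w ^ 2 ∂μ + 2 * ∫ w, U (T w.1) ∂μ) =
        2 * (n * ∫ w, f q w ^ 2 ∂μ) + 2 * (n * ∫ w, U (T w.1) ∂μ) := by ring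
    rw [s10] at s4
    rw [s9]
    linarith
  refine (measure_mono hsub).trans ((measure_union_le _ _).trans (add_le_add
    (h.measure_fewPerCell_compl_le hT n) ?_))
  calc _ ≤ ∑ q ∈ F, (Measure.pi fun _ : Fin n => μ) (B2 q) := measure_biUnion_finset_le _ _
    _ ≤ ∑ _q ∈ F, ENNReal.ofReal (Real.exp (-((K + 1) * N))) := Finset.sum_le_sum hB2m
    _ = ENNReal.ofReal (F.card * Real.exp (-((K + 1) * N))) := by
        rw [Finset.sum_const, nsmul_eq_mul, ENNReal.ofReal_mul (Nat.cast_nonneg _),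
          ENNReal.ofReal_natCast]
    _ ≤ ENNReal.ofReal (Real.exp (K * N) * Real.exp (-((K + 1) * N))) := by gcongr
    _ = _ := by rw [← Real.exp_add]; congr 2; ring

end

section

/-! ### Identifiability -/

variable {d : ℕ}

/-- No linear functional other than the multiples of the index is a function of the index on an
event `{index ∈ B}` of positive probability. -/
def IndexNondeg (PX : Measure (EuclideanSpace ℝ (Fin d))) (θ₀ : EuclideanSpace ℝ (Fin d)) : Prop :=
  ∀ v ∉ Submodule.span ℝ {θ₀}, ∀ (φ : ℝ → ℝ) (B : Set ℝ),
    (∀ᵐ x ∂PX, (inner ℝ θ₀ x : ℝ) ∈ B → inner ℝ v x = φ (inner ℝ θ₀ x)) →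
      ∀ᵐ x ∂PX, (inner ℝ θ₀ x : ℝ) ∉ B

/-- On the event `{index ∈ B}` the functional would be constant under almost every conditional law
given the index. -/
theorem NondegenerateGivenIndex.indexNondeg {Ω : Type*} [MeasurableSpace Ω] {P : Measure Ω}
    [IsProbabilityMeasure P] {X : Ω → EuclideanSpace ℝ (Fin d)} (hX : Measurable X)
    {θ₀ : EuclideanSpace ℝ (Fin d)} (h : NondegenerateGivenIndex P X θ₀) :
    IndexNondeg (P.map X) θ₀ := by
  intro v hv φ B hB
  set T : Ω → ℝ := fun ω => inner ℝ θ₀ (X ω) with hT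
  have hTm : Measurable T := by fun_prop
  obtain ⟨N, hN, hNm, hN0⟩ := exists_measurable_superset_of_null (ae_iff.1 hB)
  have hpair : Measurable fun ω => (T ω, X ω) := hTm.prodMk hX
  have hcomp : ∀ᵐ p ∂((P.map T) ⊗ₘ condDistrib X T P), inner ℝ θ₀ p.2 = p.1 ∧ p.2 ∉ N := by
    rw [compProd_map_condDistrib hX.aemeasurable, ae_map_iff hpair.aemeasurable]
    · have h1 : ∀ᵐ ω ∂P, X ω ∉ N := by
        rw [Measure.map_apply hX hNm] at hN0
        exact measure_eq_zero_iff_ae_notMem.1 hN0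
      filter_upwards [h1] with ω hω
      exact ⟨rfl, hω⟩
    · exact (measurableSet_eq_fun (by fun_prop) (by fun_prop)).inter
        (measurable_snd hNm.compl)
  have hae := Measure.ae_ae_of_ae_compProd hcomp
  have hnot : ∀ᵐ t ∂(P.map T), t ∉ B := by
    filter_upwards [hae, h] with t ht hnd htB
    refine hnd v hv ⟨φ t, ?_⟩
    filter_upwards [ht] with x hx
    have : ¬ ¬ ((inner ℝ θ₀ x : ℝ) ∈ B → inner ℝ v x = φ (inner ℝ θ₀ x)) := fun hcon =>
      hx.2 (hN hcon)
    rw [not_not, hx.1] at this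
    exact this htB
  have h2 : P.map T = (P.map X).map fun x => (inner ℝ θ₀ x : ℝ) := by
    rw [Measure.map_map (by fun_prop) hX]; rfl
  rw [h2] at hnot
  exact ae_of_ae_map (f := fun x => (inner ℝ θ₀ x : ℝ)) (p := fun t => t ∉ B)
    (by fun_prop) hnot

variable [NeZero d]

/-- A law is null on lines in the first coordinate direction if it charges no Borel set all of
whose intersections with such lines have length zero. -/
def NullOnLines (PX : Measure (EuclideanSpace ℝ (Fin d))) : Prop :=
  ∀ Z, MeasurableSet Z →
    (∀ x, volume {s : ℝ | x + s • EuclideanSpace.single (0 : Fin d) (1 : ℝ) ∈ Z} = 0) → PX Z = 0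

/-- The index set is split according to the countably many values of the discrete covariates, and
Fubini's theorem is applied to the density of the others. -/
theorem IdentifiableDesign.nullOnLines {Ω : Type*} [MeasurableSpace Ω] {P : Measure Ω}
    {X : Ω → EuclideanSpace ℝ (Fin d)} (hX : Measurable X) {θ₀ : EuclideanSpace ℝ (Fin d)}
    (h : IdentifiableDesign P X θ₀) : NullOnLines (P.map X) := by
  obtain ⟨-, d₁, h1, -, hac, hdisc, -⟩ := h
  intro Z hZ hline
  have h0d : ((0 : Fin d) : ℕ) < d₁ := by simpa using Nat.lt_of_lt_of_le Nat.zero_lt_one h1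
  choose S hS hSae using hdisc
  set Cs : Set ({j : Fin d // d₁ ≤ (j : ℕ)} → ℝ) := Set.univ.pi fun j => S j j.2 with hCs
  have hCsc : Cs.Countable := Set.countable_univ_pi fun j => hS j j.2
  set glue : ({j : Fin d // d₁ ≤ (j : ℕ)} → ℝ) → ({j : Fin d // (j : ℕ) < d₁} → ℝ) →
      EuclideanSpace ℝ (Fin d) := fun c y => WithLp.toLp 2 fun j =>
        if hj : (j : ℕ) < d₁ then y ⟨j, hj⟩ else c ⟨j, not_lt.1 hj⟩ with hglue
  have hgm : ∀ c, Measurable (glue c) := by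
    intro c
    refine (WithLp.measurable_toLp 2 _).comp (measurable_pi_lambda _ fun j => ?_)
    by_cases hj : (j : ℕ) < d₁
    · simpa only [hj, dite_true] using measurable_pi_apply _
    · simpa only [hj, dite_false] using measurable_const
  have hZc : ∀ c, P {ω | (fun j : {j : Fin d // (j : ℕ) < d₁} => X ω j) ∈ glue c ⁻¹' Z} = 0 := by
    intro c
    have hvol : (volume : Measure ({j : Fin d // (j : ℕ) < d₁} → ℝ)) (glue c ⁻¹' Z) = 0 := by
      set j₀ : {j : Fin d // (j : ℕ) < d₁} := ⟨0, h0d⟩ with hj₀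
      have := ae_mem_of_ae_add_linearMap_mem (𝕜 := ℝ)
        (LinearMap.toSpanSingleton ℝ ({j : Fin d // (j : ℕ) < d₁} → ℝ) (Pi.single j₀ 1))
        volume volume (hgm c hZ).compl (fun y => by
          rw [ae_iff]
          convert hline (glue c y) using 3
          ext s
          simp only [Set.mem_compl_iff, not_not, Set.mem_preimage]
          refine iff_of_eq (congrArg (· ∈ Z) ?_)
          ext j
          by_cases hj : (j : ℕ) < d₁
          · by_cases h0 : j = 0
            · subst h0; simp only [hglue, hj₀]; simp [Nat.lt_of_lt_of_le Nat.zero_lt_one h1]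
            · simp [hglue, hj, hj₀, h0]
          · have h0 : j ≠ 0 := by
              rintro rfl
              exact hj h0d
            simp [hglue, hj, h0])
      rw [ae_iff] at this
      simpa only [Set.mem_compl_iff, not_not, Set.ofPred_mem_eq] using this
    have h2 := hac hvol
    rwa [Measure.map_apply (by fun_prop) (hgm c hZ)] at h2
  rw [Measure.map_apply hX hZ]
  have hall : ∀ᵐ ω ∂P, (fun j : {j : Fin d // d₁ ≤ (j : ℕ)} => X ω j) ∈ Cs := by
    simp only [hCs, Set.mem_univ_pi]
    exact ae_all_iff.2 fun j => hSae j j.2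
  have hU : P (⋃ c ∈ Cs,
      {ω | (fun j : {j : Fin d // (j : ℕ) < d₁} => X ω j) ∈ glue c ⁻¹' Z}) = 0 :=
    (measure_biUnion_null_iff hCsc).2 fun c _ => hZc c
  refine measure_mono_null (t := {ω | ¬ (fun j : {j : Fin d // d₁ ≤ (j : ℕ)} => X ω j) ∈ Cs} ∪ _)
    ?_ (measure_union_null (ae_iff.1 hall) hU)
  intro ω hω
  by_cases hc : (fun j : {j : Fin d // d₁ ≤ (j : ℕ)} => X ω j) ∈ Cs
  · refine Or.inr (Set.mem_biUnion hc ?_)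
    have : glue (fun j => X ω j) (fun j => X ω j) = X ω := by
      ext j
      simp [hglue]
    simpa [this] using hω
  · exact Or.inl hc

/-- Along a line, the zeros of a function at which its derivative does not vanish are isolated, so
two functions that agree almost surely have the same first partial derivative almost surely. -/
theorem NullOnLines.ae_slope_eq {PX : Measure (EuclideanSpace ℝ (Fin d))} (hnull : NullOnLines PX)
    {m m₀ g g₀ : ℝ → ℝ} (hm : ∀ t, HasDerivAt m (g t) t) (hm₀ : ∀ t, HasDerivAt m₀ (g₀ t) t)
    (hg : Continuous g) (hg₀ : Continuous g₀) {θ θ₀ : EuclideanSpace ℝ (Fin d)}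
    (h : ∀ᵐ x ∂PX, m (inner ℝ θ x) = m₀ (inner ℝ θ₀ x)) :
    ∀ᵐ x ∂PX, g (inner ℝ θ x) * θ 0 = g₀ (inner ℝ θ₀ x) * θ₀ 0 := by
  have hmc : Continuous m := continuous_iff_continuousAt.2 fun t => (hm t).continuousAt
  have hmc₀ : Continuous m₀ := continuous_iff_continuousAt.2 fun t => (hm₀ t).continuousAt
  set F : EuclideanSpace ℝ (Fin d) → ℝ := fun x => m (inner ℝ θ x) - m₀ (inner ℝ θ₀ x) with hF
  set G : EuclideanSpace ℝ (Fin d) → ℝ :=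
    fun x => g (inner ℝ θ x) * θ 0 - g₀ (inner ℝ θ₀ x) * θ₀ 0 with hG
  have hFc : Continuous F := by fun_prop
  have hGc : Continuous G := by fun_prop
  have hZ : MeasurableSet {x | F x = 0 ∧ G x ≠ 0} :=
    (hFc.measurable (measurableSet_singleton 0)).inter
      (hGc.measurable (measurableSet_singleton 0).compl)
  have hnullZ := hnull _ hZ fun x => by
    set e := EuclideanSpace.single (0 : Fin d) (1 : ℝ) with he
    set A : Set ℝ := {s : ℝ | x + s • e ∈ {x | F x = 0 ∧ G x ≠ 0}} with hA
    have hderiv : ∀ s, HasDerivAt (fun s : ℝ => F (x + s • e)) (G (x + s • e)) s := by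
      intro s
      have hlin : ∀ η : EuclideanSpace ℝ (Fin d),
          HasDerivAt (fun s : ℝ => (inner ℝ η (x + s • e) : ℝ)) (η 0) s := by
        intro η
        have : (fun s : ℝ => (inner ℝ η (x + s • e) : ℝ)) = fun s => inner ℝ η x + s * η 0 := by
          funext s
          rw [inner_add_right, inner_smul_right, he, EuclideanSpace.inner_single_right]
          simp
        rw [this]
        simpa using ((hasDerivAt_id s).mul_const (η 0)).const_add (inner ℝ η x)
      exact ((hm _).comp s (hlin θ)).sub ((hm₀ _).comp s (hlin θ₀))
    refine Set.Countable.measure_zero (Set.Countable.mono (fun s hs => ?_)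
      (countable_setOfPred_isolated_right_within (s := A))) _
    refine ⟨hs, ?_⟩
    have h1 := (hderiv s).eventually_ne (c := 0) hs.2
    rw [eventually_nhdsWithin_iff] at h1
    rw [← empty_mem_iff_bot, mem_nhdsWithin_iff_eventually]
    filter_upwards [h1] with y hy hyA
    exact hy (ne_of_gt hyA.2) hyA.1.1
  filter_upwards [h, measure_eq_zero_iff_ae_notMem.1 hnullZ] with x hx1 hx2
  by_contra hne
  exact hx2 ⟨by simp [hF, hx1], sub_ne_zero.2 hne⟩

theorem eq_of_mem_Theta_of_mem_span {θ θ₀ : EuclideanSpace ℝ (Fin d)} (hθ : θ ∈ Theta d)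
    (hθ₀ : θ₀ ∈ Theta d) (hpos : 0 < θ₀ 0) (h : θ ∈ Submodule.span ℝ {θ₀}) : θ = θ₀ := by
  obtain ⟨r, rfl⟩ := Submodule.mem_span_singleton.1 h
  have h1 := hθ.1
  rw [norm_smul, hθ₀.1, mul_one, Real.norm_eq_abs] at h1
  have h2 : 0 ≤ r := by
    have := hθ.2
    simp only [PiLp.smul_apply, smul_eq_mul] at this
    exact nonneg_of_mul_nonneg_left this hpos
  rw [abs_of_nonneg h2] at h1
  rw [h1, one_smul]

/-- A point at which a convex function has a given value and a given nonzero slope is unique. -/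
theorem eq_of_value_eq_of_slope_eq {m g : ℝ → ℝ} (hm : ∀ t, HasDerivAt m (g t) t)
    (hg : Monotone g) {s t : ℝ} (h1 : m s = m t) (h2 : g s = g t) (h0 : g s ≠ 0) : s = t := by
  wlog hst : s ≤ t generalizing s t with H
  · exact (H h1.symm h2.symm (h2 ▸ h0) (not_le.1 hst).le).symm
  rcases hst.eq_or_lt with h | hlt
  · exact h
  obtain ⟨u, hu, hslope⟩ := exists_hasDerivAt_eq_slope m g hlt
    (fun x _ => (hm x).continuousAt.continuousWithinAt) fun x _ => hm x
  have h3 : g u = g s := le_antisymm (h2 ▸ hg hu.2.le) (hg hu.1.le)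
  rw [h1, sub_self, zero_div] at hslope
  exact absurd (h3 ▸ hslope) h0

/-- A convex single index model determines the direction and, on the index, the slope of the
link. Given the index `θ₀ᵀx = t`, the value and the slope of `m` at `θᵀx` are known, hence so is
`θᵀx` if the slope is not zero; nondegeneracy forces `θ` to be a multiple of `θ₀`. -/
theorem IndexNondeg.identify {PX : Measure (EuclideanSpace ℝ (Fin d))}
    {θ θ₀ : EuclideanSpace ℝ (Fin d)} (hnd : IndexNondeg PX θ₀) (hnull : NullOnLines PX)
    {m m₀ g g₀ : ℝ → ℝ} (hm : ∀ t, HasDerivAt m (g t) t) (hm₀ : ∀ t, HasDerivAt m₀ (g₀ t) t)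
    (hg : Continuous g) (hg₀ : Continuous g₀) (hmono : Monotone g)
    (hθ : θ ∈ Theta d) (hθ₀ : θ₀ ∈ Theta d) (hpos : 0 < θ₀ 0)
    (hne : ¬ ∀ᵐ x ∂PX, g₀ (inner ℝ θ₀ x) = 0)
    (h : ∀ᵐ x ∂PX, m (inner ℝ θ x) = m₀ (inner ℝ θ₀ x)) :
    θ = θ₀ ∧ ∀ᵐ x ∂PX, g (inner ℝ θ₀ x) = g₀ (inner ℝ θ₀ x) := by
  have hslope := hnull.ae_slope_eq hm hm₀ hg hg₀ h
  have hθeq : θ = θ₀ := by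
    refine eq_of_mem_Theta_of_mem_span hθ hθ₀ hpos ?_
    by_contra hspan
    classical
    set φ : ℝ → ℝ := fun t => Classical.epsilon fun s => m s = m₀ t ∧ g s * θ 0 = g₀ t * θ₀ 0
      with hφ
    refine hne ?_
    have := hnd θ hspan φ {t | g₀ t ≠ 0} ?_
    · filter_upwards [this] with x hx
      simpa using hx
    filter_upwards [h, hslope] with x hx1 hx2 hx3
    obtain ⟨hs1, hs2⟩ := Classical.epsilon_spec
      (p := fun s => m s = m₀ (inner ℝ θ₀ x) ∧ g s * θ 0 = g₀ (inner ℝ θ₀ x) * θ₀ 0)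
      ⟨inner ℝ θ x, hx1, hx2⟩
    have hprod : g (inner ℝ θ x) * θ 0 ≠ 0 := hx2 ▸ mul_ne_zero hx3 hpos.ne'
    exact eq_of_value_eq_of_slope_eq hm hmono (hx1.trans hs1.symm)
      (mul_right_cancel₀ (right_ne_zero_of_mul hprod) (hx2.trans hs2.symm))
      (left_ne_zero_of_mul hprod)
  refine ⟨hθeq, ?_⟩
  rw [hθeq] at hslope
  filter_upwards [hslope] with x hx
  exact mul_right_cancel₀ hpos.ne' hx

end

section

/-! ### Stability of the identification -/

variable {a b R : ℝ}

/-- Balls of monotone link functions are sequentially compact for the uniform convergence of the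
functions and of their derivatives. -/
theorem exists_subseq_tendstoUniformlyOn (hab : a < b) (hR : 0 ≤ R) {p : ℕ → ℝ × (ℝ → ℝ)}
    (hp : ∀ k, p k ∈ linkBall a R) (hmono : ∀ k, Monotone (p k).2) :
    ∃ (φ : ℕ → ℕ) (c : ℝ) (g : ℝ → ℝ), StrictMono φ ∧ Continuous g ∧ Monotone g ∧
      TendstoUniformlyOn (fun k => (p (φ k)).2) g atTop (Set.Icc a b) ∧
      TendstoUniformlyOn (fun k => prim a (p (φ k)).1 (p (φ k)).2) (prim a c g) atTop
        (Set.Icc a b) := by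
  set M := R + R * Real.sqrt (b - a) with hM
  set A : Set (BoundedContinuousFunction (Set.Icc a b) ℝ) :=
    {f | Monotone f ∧ (∀ t, f t ∈ Set.Icc (-M) M) ∧
      ∀ s t, dist (f s) (f t) ≤ R * Real.sqrt (dist s t)} with hA
  have hAc : IsCompact (closure A) := by
    refine BoundedContinuousFunction.arzela_ascoli (Set.Icc (-M) M) isCompact_Icc A
      (fun f x hf => hf.2.1 x) ?_
    refine Metric.equicontinuous_of_continuity_modulus (fun r => R * Real.sqrt r) ?_ _
      fun s t f => f.2.2.2 s t
    have : Tendsto (fun r => R * Real.sqrt r) (𝓝 0) (𝓝 (R * Real.sqrt 0)) :=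
      (continuous_const.mul Real.continuous_sqrt).tendsto 0
    simpa using this
  set G : ℕ → BoundedContinuousFunction (Set.Icc a b) ℝ := fun k =>
    BoundedContinuousFunction.mkOfCompact ⟨fun t => (p k).2 t,
      (hp k).2.2.cont.comp continuous_subtype_val⟩ with hG
  have hGA : ∀ k, G k ∈ A := by
    intro k
    refine ⟨fun s t hst => hmono k hst, fun t => ?_, fun s t => ?_⟩
    · rw [Set.mem_Icc, ← abs_le]
      exact ((hp k).2.2.abs_le hR t.2).trans (by linarith [(hp k).2.1])
    · rcases le_total s t with hst | hst
      · have := (hp k).2.2.abs_sub_le hR (s := s) (t := t) hst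
        rw [dist_comm, Real.dist_eq, dist_comm s t, Subtype.dist_eq, Real.dist_eq,
          abs_of_nonneg (sub_nonneg.2 (show (s : ℝ) ≤ t from hst))]
        exact this
      · have := (hp k).2.2.abs_sub_le hR (s := t) (t := s) hst
        rw [Real.dist_eq, Subtype.dist_eq, Real.dist_eq,
          abs_of_nonneg (sub_nonneg.2 (show (t : ℝ) ≤ s from hst))]
        exact this
  obtain ⟨⟨c, f⟩, -, φ, hφ, hlim⟩ := ((isCompact_Icc (a := -R) (b := R)).prod hAc).tendsto_subseq
    (x := fun k => ((p k).1, G k)) fun k => ⟨abs_le.1 (hp k).1, subset_closure (hGA k)⟩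
  have hc : Tendsto (fun k => (p (φ k)).1) atTop (𝓝 c) := (continuous_fst.tendsto _).comp hlim
  have hf : Tendsto (fun k => G (φ k)) atTop (𝓝 f) := (continuous_snd.tendsto _).comp hlim
  rw [BoundedContinuousFunction.tendsto_iff_tendstoUniformly] at hf
  set g : ℝ → ℝ := Set.IccExtend hab.le f with hg
  have hgc : Continuous g := f.continuous.Icc_extend'
  have hfm : Monotone f := by
    intro s t hst
    exact le_of_tendsto_of_tendsto (hf.tendsto_at s) (hf.tendsto_at t)
      (Eventually.of_forall fun k => hmono _ hst)
  have hgu : TendstoUniformlyOn (fun k => (p (φ k)).2) g atTop (Set.Icc a b) := by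
    rw [Metric.tendstoUniformlyOn_iff]
    intro ε hε
    filter_upwards [Metric.tendstoUniformly_iff.1 hf ε hε] with k hk t ht
    have := hk ⟨t, ht⟩
    rw [hg, Set.IccExtend_of_mem _ _ ht]
    exact this
  refine ⟨φ, c, g, hφ, hgc, hfm.IccExtend hab.le, hgu, ?_⟩
  rw [Metric.tendstoUniformlyOn_iff] at hgu ⊢
  intro ε hε
  have hL : 0 < b - a := by linarith
  filter_upwards [hgu (ε / (2 * (b - a))) (by positivity),
    Metric.tendsto_nhds.1 hc (ε / 2) (by positivity)] with k hk hk' t ht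
  have h1 : prim a c g t - prim a (p (φ k)).1 (p (φ k)).2 t =
      (c - (p (φ k)).1) + ∫ u in a..t, (g u - (p (φ k)).2 u) := by
    rw [intervalIntegral.integral_sub (hgc.intervalIntegrable _ _)
      ((hp _).2.2.cont.intervalIntegrable _ _), prim, prim]
    ring
  have h2 : ‖∫ u in a..t, (g u - (p (φ k)).2 u)‖ ≤ ε / (2 * (b - a)) * |t - a| := by
    apply intervalIntegral.norm_integral_le_of_norm_le_const
    intro u hu
    rw [Set.uIoc_of_le ht.1] at hu
    have := hk u ⟨hu.1.le, hu.2.trans ht.2⟩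
    rw [Real.dist_eq] at this
    exact this.le
  have h3 : ε / (2 * (b - a)) * |t - a| ≤ ε / 2 := by
    rw [abs_of_nonneg (by linarith [ht.1])]
    calc _ ≤ ε / (2 * (b - a)) * (b - a) := by gcongr; exact ht.2
      _ = ε / 2 := by field_simp
  rw [Real.dist_eq, h1]
  rw [Real.dist_eq, abs_sub_comm] at hk'
  rw [Real.norm_eq_abs] at h2
  have := abs_add_le (c - (p (φ k)).1) (∫ u in a..t, (g u - (p (φ k)).2 u))
  linarith

/-- Mean value theorem for `prim`, for arguments in any order. -/
theorem exists_slope_eq {g : ℝ → ℝ} (hg : Continuous g) (a c s t : ℝ) :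
    ∃ ξ, |ξ - s| ≤ |t - s| ∧ ξ ∈ Set.uIcc s t ∧
      prim a c g t - prim a c g s = g ξ * (t - s) := by
  have key : ∀ {s t : ℝ}, s < t → ∃ ξ ∈ Set.Ioo s t,
      prim a c g t - prim a c g s = g ξ * (t - s) := by
    intro s t hst
    obtain ⟨ξ, hξ, h⟩ := exists_hasDerivAt_eq_slope (prim a c g) g hst
      (continuous_prim hg a c).continuousOn fun x _ => hasDerivAt_prim hg a c x
    refine ⟨ξ, hξ, ?_⟩
    rw [h, div_mul_cancel₀ _ (by linarith)]
  rcases lt_trichotomy s t with h | rfl | h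
  · obtain ⟨ξ, hξ, he⟩ := key h
    refine ⟨ξ, ?_, Set.Icc_subset_uIcc ⟨hξ.1.le, hξ.2.le⟩, he⟩
    rw [abs_of_pos (by linarith [hξ.1]), abs_of_pos (by linarith)]
    linarith [hξ.2]
  · exact ⟨s, by simp, Set.left_mem_uIcc, by simp⟩
  · obtain ⟨ξ, hξ, he⟩ := key h
    refine ⟨ξ, ?_, Set.Icc_subset_uIcc' ⟨hξ.1.le, hξ.2.le⟩, by linarith⟩
    rw [abs_of_neg (by linarith [hξ.2]), abs_of_neg (by linarith)]
    linarith [hξ.1]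

/-- Convergence in `L²` at a geometric rate implies almost sure convergence. -/
theorem ae_tendsto_zero_of_integral_sq_le {α : Type*} [MeasurableSpace α] {ν : Measure α}
    {h : ℕ → α → ℝ} (hint : ∀ k, Integrable (fun x => h k x ^ 2) ν)
    (hle : ∀ k, ∫ x, h k x ^ 2 ∂ν ≤ (1 / 2) ^ k) :
    ∀ᵐ x ∂ν, Tendsto (fun k => h k x) atTop (𝓝 0) := by
  have h1 : ∫⁻ x, ∑' k, ENNReal.ofReal (h k x ^ 2) ∂ν ≤ 2 := by
    rw [lintegral_tsum fun k => (hint k).1.aemeasurable.ennreal_ofReal]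
    calc _ ≤ ∑' k : ℕ, ENNReal.ofReal ((1 / 2) ^ k) := by
          refine ENNReal.tsum_le_tsum fun k => ?_
          rw [← ofReal_integral_eq_lintegral_ofReal (hint k) (ae_of_all _ fun x => sq_nonneg _)]
          exact ENNReal.ofReal_le_ofReal (hle k)
      _ = ENNReal.ofReal (∑' k : ℕ, (1 / 2 : ℝ) ^ k) :=
          (ENNReal.ofReal_tsum_of_nonneg (fun _ => by positivity) summable_geometric_two).symm
      _ = 2 := by rw [tsum_geometric_two]; norm_num
  have h2 := ae_lt_top' (AEMeasurable.tsum fun k =>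
    (hint k).1.aemeasurable.ennreal_ofReal) (h1.trans_lt ENNReal.ofNat_lt_top).ne
  filter_upwards [h2] with x hx
  have h3 := ENNReal.tendsto_atTop_zero_of_tsum_ne_top hx.ne
  have h4 : Tendsto (fun k => h k x ^ 2) atTop (𝓝 0) := by
    have := (ENNReal.tendsto_toReal ENNReal.zero_ne_top).comp h3
    simpa [Function.comp_def, ENNReal.toReal_ofReal (sq_nonneg _)] using this
  have h5 := (Real.continuous_sqrt.tendsto 0).comp h4
  simp only [Function.comp_def, Real.sqrt_sq_eq_abs, Real.sqrt_zero] at h5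
  exact (tendsto_zero_iff_abs_tendsto_zero _).2 h5

variable {d : ℕ} [NeZero d]

theorem isCompact_Theta : IsCompact (Theta d) := by
  have : Theta d = Metric.sphere 0 1 ∩ {η | 0 ≤ η 0} := by
    ext η; simp [Theta]
  rw [this]
  exact (isCompact_sphere _ _).inter_right
    (isClosed_le continuous_const (PiLp.continuous_apply 2 (fun _ : Fin d => ℝ) 0))

/-- If the index is off by `δ`, the prediction error is at least of order `δ`. Otherwise there are
links `m_k` and indices `θ_k`, with errors negligible compared to `‖θ_k - θ₀‖`. They converge to the
true ones, and a first-order expansion in the index shows that `m₀'(θ₀ᵀx) vᵀx`, for a limit `v` of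
the directions `(θ_k - θ₀) / ‖θ_k - θ₀‖`, is a function of `θ₀ᵀx`. -/
theorem exists_norm_sub_sq_le (hab : a < b) (hR : 0 ≤ R)
    {PX : Measure (EuclideanSpace ℝ (Fin d))} [IsProbabilityMeasure PX]
    {θ₀ : EuclideanSpace ℝ (Fin d)} (hθ₀ : θ₀ ∈ Theta d) (hpos : 0 < θ₀ 0)
    (hnd : IndexNondeg PX θ₀) (hnull : NullOnLines PX)
    (hI : ∀ᵐ x ∂PX, ∀ θ ∈ Theta d, (inner ℝ θ x : ℝ) ∈ Set.Icc a b)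
    {c₀ : ℝ} {g₀ : ℝ → ℝ} (hg₀ : Continuous g₀) (hne : ¬ ∀ᵐ x ∂PX, g₀ (inner ℝ θ₀ x) = 0) :
    ∃ C : ℝ, 0 ≤ C ∧ ∀ p ∈ linkBall a R, Monotone p.2 → ∀ θ ∈ Theta d, ‖θ - θ₀‖ ^ 2 ≤
      C * ∫ x, (prim a p.1 p.2 (inner ℝ θ x) - prim a c₀ g₀ (inner ℝ θ₀ x)) ^ 2 ∂PX := by
  by_contra hcon
  push Not at hcon
  choose p hp hmono θ hθ hlt using fun k : ℕ => hcon (2 ^ k) (by positivity)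
  set m₀ := prim a c₀ g₀ with hm₀
  set δ : ℕ → ℝ := fun k => ‖θ k - θ₀‖ with hδ
  set f : ℕ → EuclideanSpace ℝ (Fin d) → ℝ := fun k x =>
    prim a (p k).1 (p k).2 (inner ℝ (θ k) x) - m₀ (inner ℝ θ₀ x) with hf
  have hδ0 : ∀ k, 0 < δ k := by
    intro k
    refine lt_of_le_of_ne (norm_nonneg _) fun h0 => ?_
    have h1 := hlt k
    have h2 : 0 ≤ ∫ x, f k x ^ 2 ∂PX := integral_nonneg fun x => sq_nonneg _
    have h3 : ‖θ k - θ₀‖ = 0 := h0.symm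
    rw [h3] at h1
    have : 0 ≤ (2 : ℝ) ^ k * ∫ x, f k x ^ 2 ∂PX := by positivity
    simp only [hf] at this
    linarith [zero_pow (M₀ := ℝ) two_ne_zero]
  have hm₀c : Continuous m₀ := continuous_prim hg₀ a c₀
  have hfc : ∀ k, Continuous (f k) := fun k => by
    have := continuous_prim (hp k).2.2.cont a (p k).1
    simp only [hf]
    fun_prop
  obtain ⟨B₀, hB₀⟩ := isCompact_Icc.exists_bound_of_continuousOn (s := Set.Icc a b) hm₀c.continuousOn
  set M := R + (R + R * Real.sqrt (b - a)) * (b - a) + B₀ with hM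
  have hfint : ∀ k, Integrable (fun x => f k x ^ 2) PX := by
    intro k
    refine Integrable.of_bound ((hfc k).pow 2).aestronglyMeasurable (M ^ 2) ?_
    filter_upwards [hI] with x hx
    rw [Real.norm_eq_abs, abs_pow]
    refine pow_le_pow_left₀ (abs_nonneg _) ?_ 2
    have h1 := abs_prim_le hR (hp k) (hx _ (hθ k))
    have h2 := hB₀ _ (hx _ hθ₀)
    rw [Real.norm_eq_abs] at h2
    exact (abs_sub _ _).trans (by rw [hM]; linarith)
  have hconv : ∀ᵐ x ∂PX, Tendsto (fun k => f k x / δ k) atTop (𝓝 0) := by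
    refine ae_tendsto_zero_of_integral_sq_le (fun k => ?_) fun k => ?_
    · simp only [div_pow]
      exact (hfint k).div_const _
    · simp only [div_pow, integral_div]
      rw [div_le_iff₀ (pow_pos (hδ0 k) 2), one_pow, one_div, le_inv_mul_iff₀ (by positivity)]
      exact (hlt k).le
  obtain ⟨φ₁, c, g, hφ₁, hgc, hgm, hgu, hmu⟩ := exists_subseq_tendstoUniformlyOn hab hR hp hmono
  set v : ℕ → EuclideanSpace ℝ (Fin d) := fun k => (δ k)⁻¹ • (θ k - θ₀) with hv
  have hv1 : ∀ k, ‖v k‖ = 1 := fun k => by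
    rw [hv, norm_smul, norm_inv, Real.norm_eq_abs, abs_of_pos (hδ0 k)]
    exact inv_mul_cancel₀ (hδ0 k).ne'
  obtain ⟨⟨θ', v'⟩, ⟨hθ', hv'⟩, φ₂, hφ₂, hlim⟩ :=
    ((isCompact_Theta (d := d)).prod (isCompact_sphere (0 : EuclideanSpace ℝ (Fin d)) 1)).tendsto_subseq
      (x := fun k => (θ (φ₁ k), v (φ₁ k))) fun k => ⟨hθ _, by simp [hv1]⟩
  have hφ₂t := hφ₂.tendsto_atTop
  set φ := φ₁ ∘ φ₂ with hφ
  have hφt : Tendsto φ atTop atTop := hφ₁.tendsto_atTop.comp hφ₂t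
  have hθlim : Tendsto (fun k => θ (φ k)) atTop (𝓝 θ') := (continuous_fst.tendsto _).comp hlim
  have hvlim : Tendsto (fun k => v (φ k)) atTop (𝓝 v') := (continuous_snd.tendsto _).comp hlim
  -- values of the links along convergent indices
  have hlimval : ∀ {F : ℕ → ℝ → ℝ} {F' : ℝ → ℝ}, TendstoUniformlyOn (fun k => F (φ₁ k)) F' atTop
      (Set.Icc a b) → Continuous F' → ∀ {u : ℕ → ℝ} {t : ℝ}, t ∈ Set.Icc a b →
      (∀ k, u k ∈ Set.Icc a b) → Tendsto u atTop (𝓝 t) →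
      Tendsto (fun k => F (φ k) (u k)) atTop (𝓝 (F' t)) := by
    intro F F' hF hF' u t ht hu hut
    have h1 : TendstoUniformlyOn (fun k => F (φ k)) F' atTop (Set.Icc a b) := by
      intro s hs
      exact hφ₂t.eventually (hF s hs)
    exact h1.tendsto_comp hF'.continuousWithinAt
      (tendsto_nhdsWithin_iff.2 ⟨hut, Eventually.of_forall hu⟩)
  have hδ2 : ∀ k, δ k ≤ 2 := fun k => by
    have := norm_sub_le (θ k) θ₀
    rw [(hθ k).1, hθ₀.1] at this
    linarith
  have hlimeq : ∀ᵐ x ∂PX, prim a c g (inner ℝ θ' x) = m₀ (inner ℝ θ₀ x) := by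
    filter_upwards [hconv, hI] with x hx hxI
    have h1 : Tendsto (fun k => f (φ k) x) atTop (𝓝 0) := by
      have h2 : Tendsto (fun k => f k x) atTop (𝓝 0) := by
        refine squeeze_zero_norm (a := fun k => 2 * |f k x / δ k|) (fun k => ?_) ?_
        · rw [Real.norm_eq_abs, abs_div, abs_of_pos (hδ0 k), mul_div_assoc',
            le_div_iff₀ (hδ0 k), mul_comm]
          exact mul_le_mul_of_nonneg_right (hδ2 k) (abs_nonneg _)
        · simpa using (hx.abs.const_mul 2)
      exact h2.comp hφt
    have h3 : Tendsto (fun k => f (φ k) x) atTop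
        (𝓝 (prim a c g (inner ℝ θ' x) - m₀ (inner ℝ θ₀ x))) := by
      refine Tendsto.sub_const ?_ _
      exact hlimval (F := fun k => prim a (p k).1 (p k).2) hmu (continuous_prim hgc a c) (hxI _ hθ')
        (fun k => hxI _ (hθ _)) (hθlim.inner tendsto_const_nhds)
    have := tendsto_nhds_unique h3 h1
    linarith
  obtain ⟨rfl, hgg⟩ := hnd.identify hnull (hasDerivAt_prim hgc a c) (hasDerivAt_prim hg₀ a c₀) hgc
    hg₀ hgm hθ' hθ₀ hpos hne hlimeq
  have hδlim : Tendsto (fun k => δ (φ k)) atTop (𝓝 0) := by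
    have := (hθlim.sub_const θ').norm
    simpa [hδ] using this
  -- the limit direction is tangent to the sphere
  have horth : inner ℝ θ' v' = 0 := by
    have h1 : Tendsto (fun k => (inner ℝ θ' (v (φ k)) : ℝ)) atTop (𝓝 (inner ℝ θ' v')) :=
      tendsto_const_nhds.inner hvlim
    have h2 : ∀ k, (inner ℝ θ' (v k) : ℝ) = -(δ k / 2) := by
      intro k
      have h3 := norm_sub_sq_real (θ k) θ'
      rw [(hθ k).1, hθ'.1, real_inner_comm] at h3
      have h4 : (inner ℝ θ' (θ k - θ') : ℝ) = -(δ k ^ 2 / 2) := by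
        rw [inner_sub_right, real_inner_self_eq_norm_sq, hθ'.1]
        simp only [hδ]
        linarith
      rw [hv]
      simp only
      rw [inner_smul_right, h4]
      have := (hδ0 k).ne'
      field_simp
    simp only [h2] at h1
    have h5 : Tendsto (fun k => -(δ (φ k) / 2)) atTop (𝓝 0) := by
      simpa using (hδlim.div_const 2).neg
    exact tendsto_nhds_unique h1 h5
  have hspan : v' ∉ Submodule.span ℝ {θ'} := by
    intro hmem
    obtain ⟨r, rfl⟩ := Submodule.mem_span_singleton.1 hmem
    rw [inner_smul_right, real_inner_self_eq_norm_sq, hθ'.1] at horth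
    have hr : r = 0 := by simpa using horth
    rw [hr, zero_smul] at hv'
    simp at hv'
  refine hne ?_
  set W : ℝ → ℝ := fun t => limUnder atTop fun k =>
    (prim a (p (φ k)).1 (p (φ k)).2 t - m₀ t) / δ (φ k) with hW
  have := hnd v' hspan (fun t => -(W t) / g₀ t) {t | g₀ t ≠ 0} ?_
  · filter_upwards [this] with x hx
    simpa using hx
  filter_upwards [hconv, hI, hgg] with x hx hxI hxg hx0
  have hT := hxI _ hθ'
  choose ξ hξ1 hξ2 hξ3 using fun k => exists_slope_eq (hp (φ k)).2.2.cont a (p (φ k)).1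
    (inner ℝ θ' x) (inner ℝ (θ (φ k)) x)
  have hξI : ∀ k, ξ k ∈ Set.Icc a b := fun k =>
    Set.uIcc_subset_Icc hT (hxI _ (hθ _)) (hξ2 k)
  have hξlim : Tendsto ξ atTop (𝓝 (inner ℝ θ' x)) := by
    rw [tendsto_iff_dist_tendsto_zero]
    refine squeeze_zero (fun _ => dist_nonneg) (fun k => hξ1 k) ?_
    have h1 : Tendsto (fun k => (inner ℝ (θ (φ k)) x : ℝ)) atTop (𝓝 (inner ℝ θ' x)) :=
      hθlim.inner tendsto_const_nhds
    simpa using (h1.sub_const (inner ℝ θ' x)).abs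
  have hglim := hlimval (F := fun k => (p k).2) hgu hgc hT hξI hξlim
  have hWlim : Tendsto (fun k => (prim a (p (φ k)).1 (p (φ k)).2 (inner ℝ θ' x) -
      m₀ (inner ℝ θ' x)) / δ (φ k)) atTop (𝓝 (-(g₀ (inner ℝ θ' x) * inner ℝ v' x))) := by
    have h1 : Tendsto (fun k => f (φ k) x / δ (φ k) - (p (φ k)).2 (ξ k) * inner ℝ (v (φ k)) x)
        atTop (𝓝 (0 - g (inner ℝ θ' x) * inner ℝ v' x)) :=
      (hx.comp hφt).sub (hglim.mul (hvlim.inner tendsto_const_nhds))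
    rw [hxg, zero_sub] at h1
    refine h1.congr fun k => ?_
    have h2 := hξ3 k
    have h3 := (hδ0 (φ k)).ne'
    simp only [hf, hv]
    rw [inner_smul_left, inner_sub_left]
    simp only [conj_trivial]
    field_simp
    linarith
  have hWeq : W (inner ℝ θ' x) = -(g₀ (inner ℝ θ' x) * inner ℝ v' x) := hWlim.limUnder_eq
  rw [hWeq]
  have hx0' : g₀ (inner ℝ θ' x) ≠ 0 := hx0
  field_simp

/-- The prediction error dominates the errors of the index and of the link function. -/
theorem exists_stability (hab : a < b) (hR : 0 ≤ R)
    {PX : Measure (EuclideanSpace ℝ (Fin d))} [IsProbabilityMeasure PX]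
    {θ₀ : EuclideanSpace ℝ (Fin d)} (hθ₀ : θ₀ ∈ Theta d) (hpos : 0 < θ₀ 0)
    (hnd : IndexNondeg PX θ₀) (hnull : NullOnLines PX)
    (hI : ∀ᵐ x ∂PX, ∀ θ ∈ Theta d, (inner ℝ θ x : ℝ) ∈ Set.Icc a b)
    {B : ℝ} (hB : ∀ᵐ x ∂PX, ‖x‖ ≤ B)
    {c₀ : ℝ} {g₀ : ℝ → ℝ} (hg₀ : Continuous g₀) (hne : ¬ ∀ᵐ x ∂PX, g₀ (inner ℝ θ₀ x) = 0) :
    ∃ C : ℝ, 0 ≤ C ∧ ∀ p ∈ linkBall a R, Monotone p.2 → ∀ θ ∈ Theta d,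
      ‖θ - θ₀‖ ^ 2 ≤
        C * ∫ x, (prim a p.1 p.2 (inner ℝ θ x) - prim a c₀ g₀ (inner ℝ θ₀ x)) ^ 2 ∂PX ∧
      ∫ x, (prim a p.1 p.2 (inner ℝ θ₀ x) - prim a c₀ g₀ (inner ℝ θ₀ x)) ^ 2 ∂PX ≤
        C * ∫ x, (prim a p.1 p.2 (inner ℝ θ x) - prim a c₀ g₀ (inner ℝ θ₀ x)) ^ 2 ∂PX := by
  obtain ⟨C, hC, h⟩ := exists_norm_sub_sq_le hab hR hθ₀ hpos hnd hnull hI (c₀ := c₀) hg₀ hne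
  set G := R + R * Real.sqrt (b - a) with hG
  have hG0 : 0 ≤ G := by positivity
  refine ⟨2 + (1 + 2 * (G * B) ^ 2) * C, by positivity, fun p hp hmono θ hθ => ?_⟩
  have h1 := h p hp hmono θ hθ
  have hint : ∀ η ∈ Theta d, Integrable
      (fun x => (prim a p.1 p.2 (inner ℝ η x) - prim a c₀ g₀ (inner ℝ θ₀ x)) ^ 2) PX := by
    intro η hη
    have hm := continuous_prim hp.2.2.cont a p.1
    have hm₀ := continuous_prim hg₀ a c₀
    obtain ⟨B₁, hB₁⟩ := isCompact_Icc.exists_bound_of_continuousOn (s := Set.Icc a b) hm.continuousOn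
    obtain ⟨B₀, hB₀⟩ := isCompact_Icc.exists_bound_of_continuousOn (s := Set.Icc a b) hm₀.continuousOn
    refine Integrable.of_bound (Continuous.aestronglyMeasurable (by fun_prop)) ((B₁ + B₀) ^ 2) ?_
    filter_upwards [hI] with x hx
    rw [norm_pow]
    refine pow_le_pow_left₀ (norm_nonneg _) ((norm_sub_le _ _).trans
      (add_le_add (hB₁ _ (hx _ hη)) (hB₀ _ (hx _ hθ₀)))) 2
  set I := ∫ x, (prim a p.1 p.2 (inner ℝ θ x) - prim a c₀ g₀ (inner ℝ θ₀ x)) ^ 2 ∂PX with hI'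
  have hI0 : 0 ≤ I := integral_nonneg fun x => sq_nonneg _
  have h2 : ∫ x, (prim a p.1 p.2 (inner ℝ θ₀ x) - prim a c₀ g₀ (inner ℝ θ₀ x)) ^ 2 ∂PX ≤
      2 * I + 2 * (G * B) ^ 2 * ‖θ - θ₀‖ ^ 2 := by
    have h3 : 2 * I + 2 * (G * B) ^ 2 * ‖θ - θ₀‖ ^ 2 =
        ∫ x, (2 * (prim a p.1 p.2 (inner ℝ θ x) - prim a c₀ g₀ (inner ℝ θ₀ x)) ^ 2 +
          2 * (G * B) ^ 2 * ‖θ - θ₀‖ ^ 2) ∂PX := by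
      rw [integral_add ((hint θ hθ).const_mul 2) (integrable_const _), integral_const_mul]
      simp only [integral_const, probReal_univ, one_smul]
      rfl
    rw [h3]
    refine integral_mono_ae (hint θ₀ hθ₀) (((hint θ hθ).const_mul 2).add (integrable_const _)) ?_
    filter_upwards [hI, hB] with x hx hxB
    have h4 := prim_abs_sub_le hp.2.2.cont (a₀ := a) (c := p.1) (G := G)
      (fun u hu => (hp.2.2.abs_le hR hu).trans (by linarith [hp.2.1])) (hx θ hθ) (hx θ₀ hθ₀)
    have h5 : |(inner ℝ θ₀ x : ℝ) - inner ℝ θ x| ≤ ‖θ - θ₀‖ * B := by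
      rw [← inner_sub_left, norm_sub_rev]
      exact (abs_real_inner_le_norm _ _).trans (by gcongr)
    have h6 : |prim a p.1 p.2 (inner ℝ θ₀ x) - prim a p.1 p.2 (inner ℝ θ x)| ≤
        G * (‖θ - θ₀‖ * B) := h4.trans (by gcongr)
    have h7 : (prim a p.1 p.2 (inner ℝ θ₀ x) - prim a p.1 p.2 (inner ℝ θ x)) ^ 2 ≤
        (G * (‖θ - θ₀‖ * B)) ^ 2 := by
      rw [← sq_abs]
      exact pow_le_pow_left₀ (abs_nonneg _) h6 2
    have h8 : (G * (‖θ - θ₀‖ * B)) ^ 2 = (G * B) ^ 2 * ‖θ - θ₀‖ ^ 2 := by ring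
    rw [h8] at h7
    nlinarith [sq_nonneg ((prim a p.1 p.2 (inner ℝ θ x) - prim a c₀ g₀ (inner ℝ θ₀ x)) -
      (prim a p.1 p.2 (inner ℝ θ₀ x) - prim a p.1 p.2 (inner ℝ θ x)))]
  have h9 : 0 ≤ (G * B) ^ 2 * C * I := by positivity
  have h10 : (G * B) ^ 2 * ‖θ - θ₀‖ ^ 2 ≤ (G * B) ^ 2 * (C * I) := by gcongr
  have h11 : 0 ≤ C * I := by positivity
  constructor <;> nlinarith

end

section

/-! ### Consequences of the assumptions on the law of the data -/

theorem exp_le_add_exp_sq (y : ℝ) : Real.exp y ≤ y + Real.exp (y ^ 2) := by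
  have h1 := Real.add_one_le_exp (y ^ 2)
  rcases le_or_gt |y| 1 with h | h
  · have h2 := (abs_le.1 (Real.abs_exp_sub_one_sub_id_le h)).2
    linarith
  · rcases lt_abs.1 h with h | h
    · have : Real.exp y ≤ Real.exp (y ^ 2) := Real.exp_le_exp.2 (by nlinarith)
      linarith
    · have : Real.exp y ≤ 1 := Real.exp_le_one_iff.2 (by linarith)
      nlinarith

/-- A bound of `exp (e s)` that is linear in `e` and `exp (e² / K) - 1`, for small `s`. -/
theorem exp_mul_le_of_sq_le {K s : ℝ} (hK : 0 < K) (hs : s ^ 2 * K ≤ 1) (e : ℝ) :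
    Real.exp (e * s) ≤ 1 + s * e + s ^ 2 * K * (Real.exp (e ^ 2 / K) - 1) := by
  have h1 := exp_le_add_exp_sq (e * s)
  have h2 := convexOn_exp.2 (Set.mem_univ 0) (Set.mem_univ (e ^ 2 / K))
    (sub_nonneg.2 hs) (by positivity : 0 ≤ s ^ 2 * K) (by ring)
  simp only [smul_eq_mul, mul_zero, zero_add, Real.exp_zero, mul_one] at h2
  have h3 : s ^ 2 * K * (e ^ 2 / K) = (e * s) ^ 2 := by field_simp
  rw [h3] at h2
  linarith

/-- A bound of `exp (e s)` for large `s`, by completing the square. -/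
theorem exp_mul_le_exp_mul {K s : ℝ} (hK : 0 < K) (e : ℝ) :
    Real.exp (e * s) ≤ Real.exp (s ^ 2 * K / 4) * (1 + (Real.exp (e ^ 2 / K) - 1)) := by
  rw [add_sub_cancel, ← Real.exp_add]
  apply Real.exp_le_exp.2
  have h1 : e * s = 2 * (e / Real.sqrt K) * (s * Real.sqrt K / 2) := by
    have := (Real.sqrt_pos.2 hK).ne'
    field_simp
  have h2 : e ^ 2 / K = (e / Real.sqrt K) ^ 2 := by rw [div_pow, Real.sq_sqrt hK.le]
  have h3 : s ^ 2 * K / 4 = (s * Real.sqrt K / 2) ^ 2 := by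
    rw [div_pow, mul_pow, Real.sq_sqrt hK.le]; norm_num
  rw [h1, h2, h3]
  nlinarith [sq_nonneg (e / Real.sqrt K - s * Real.sqrt K / 2)]

variable {d : ℕ} {Ω : Type*} [MeasurableSpace Ω] {P : Measure Ω}

/-- The conditional moments of the error bound the conditional expectation of the exponential of
`e b(X) - σ b(X)²`, because this exponential is at most a linear function of `e` and
`exp (e² / K) - 1` with coefficients that are bounded functions of `X`. -/
theorem SubGaussianError.isSubG [IsProbabilityMeasure P] {X : Ω → EuclideanSpace ℝ (Fin d)}
    (hX : Measurable X) {e e' : Ω → ℝ} (he' : Measurable e') (hee : e =ᵐ[P] e')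
    (h : SubGaussianError P X e) : ∃ σ : ℝ, 0 < σ ∧ IsSubG (P.map fun ω => (X ω, e' ω)) σ := by
  obtain ⟨⟨K, hK, hint, hKle⟩, hmean⟩ := h
  have hXle := hX.comap_le
  set ψ : Ω → ℝ := fun ω => Real.exp (e' ω ^ 2 / K) - 1 with hψ
  have hψe : (fun ω => Real.exp (e ω ^ 2 / K) - 1) =ᵐ[P] ψ := by
    filter_upwards [hee] with ω hω
    simp only [hψ, hω]
  have hint' : Integrable (fun ω => Real.exp (e' ω ^ 2 / K)) P := by
    refine hint.congr ?_
    filter_upwards [hee] with ω hω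
    rw [hω]
  have hψi : Integrable ψ P := hint'.sub (integrable_const _)
  have hψm : Measurable ψ := by fun_prop
  have hei : Integrable e' P := by
    refine Integrable.mono' ((integrable_const (1 : ℝ)).add (hint'.const_mul K))
      he'.aestronglyMeasurable (ae_of_all _ fun ω => ?_)
    have h1 := Real.add_one_le_exp (e' ω ^ 2 / K)
    have h2 : K * (e' ω ^ 2 / K) = e' ω ^ 2 := by field_simp
    have h3 : e' ω ^ 2 ≤ K * Real.exp (e' ω ^ 2 / K) := by
      rw [← h2]; exact mul_le_mul_of_nonneg_left (by rw [h2]; linarith) hK.le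
    rw [Real.norm_eq_abs]
    simp only [Pi.add_apply]
    nlinarith [sq_abs (e' ω), sq_nonneg (|e' ω| - 1)]
  have hψcond : ∀ᵐ ω ∂P, (P[ψ | MeasurableSpace.comap X inferInstance]) ω ≤ 1 / K := by
    filter_upwards [hKle, condExp_congr_ae (m := MeasurableSpace.comap X inferInstance) hψe] with ω h1 h2
    rw [← h2, le_div_iff₀ hK]
    linarith
  have hecond : P[e' | MeasurableSpace.comap X inferInstance] =ᵐ[P] 0 := (condExp_congr_ae hee.symm).trans hmean
  refine ⟨K / 4 + 1, by positivity, ?_⟩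
  set σ := K / 4 + 1 with hσ
  intro v b hv hb
  have hpair : Measurable fun ω => (X ω, e' ω) := hX.prodMk he'
  set F : Ω → ℝ := fun ω => Real.exp (e' ω * b (X ω) - σ * b (X ω) ^ 2) with hF
  have hFm : Measurable F := by fun_prop
  rw [lintegral_map (by fun_prop) hpair, lintegral_map (by fun_prop) hpair]
  simp only
  -- the linear bound
  set D : Set (EuclideanSpace ℝ (Fin d)) := {x | b x ^ 2 * K ≤ 1} with hD
  have hDm : MeasurableSet D := measurableSet_le (by fun_prop) measurable_const
  set w : EuclideanSpace ℝ (Fin d) → ℝ := fun x =>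
    D.indicator (fun x => Real.exp (-(σ * b x ^ 2))) x +
      Dᶜ.indicator (fun x => Real.exp (b x ^ 2 * K / 4 - σ * b x ^ 2)) x with hw
  set β : EuclideanSpace ℝ (Fin d) → ℝ :=
    D.indicator (fun x => Real.exp (-(σ * b x ^ 2)) * b x) with hβ
  set γ : EuclideanSpace ℝ (Fin d) → ℝ := fun x =>
    D.indicator (fun x => Real.exp (-(σ * b x ^ 2)) * (b x ^ 2 * K)) x +
      Dᶜ.indicator (fun x => Real.exp (b x ^ 2 * K / 4 - σ * b x ^ 2)) x with hγ
  have hwm : Measurable w := (Measurable.indicator (by fun_prop) hDm).add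
    (Measurable.indicator (by fun_prop) hDm.compl)
  have hβm : Measurable β := Measurable.indicator (by fun_prop) hDm
  have hγm : Measurable γ := (Measurable.indicator (by fun_prop) hDm).add
    (Measurable.indicator (by fun_prop) hDm.compl)
  have hσpos : 0 < σ := by positivity
  have hw1 : ∀ x, |w x| ≤ 1 := by
    intro x
    by_cases hx : x ∈ D
    · simp only [hw, hx, Set.indicator_of_mem, Set.mem_compl_iff, not_true, not_false_iff,
        Set.indicator_of_notMem, add_zero, Real.abs_exp]
      rw [Real.exp_le_one_iff]
      have : 0 ≤ σ * b x ^ 2 := by positivity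
      linarith
    · simp only [hw, hx, Set.indicator_of_mem, Set.mem_compl_iff, not_false_iff,
        Set.indicator_of_notMem, zero_add, Real.abs_exp]
      rw [Real.exp_le_one_iff, hσ]
      nlinarith [sq_nonneg (b x)]
  have hγ0 : ∀ x, 0 ≤ γ x := by
    intro x
    refine add_nonneg (Set.indicator_nonneg (fun y _ => ?_) x)
      (Set.indicator_nonneg (fun y _ => (Real.exp_pos _).le) x)
    positivity
  have hγ1 : ∀ x, |γ x| ≤ 1 := by
    intro x
    rw [abs_of_nonneg (hγ0 x)]
    have hwx := (le_abs_self _).trans (hw1 x)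
    by_cases hx : x ∈ D
    · simp only [hγ, hw, hx, Set.indicator_of_mem, Set.mem_compl_iff, not_true, not_false_iff,
        Set.indicator_of_notMem, add_zero] at hwx ⊢
      calc _ ≤ Real.exp (-(σ * b x ^ 2)) * 1 := by
            gcongr
            exact hx
        _ ≤ 1 := by linarith
    · simpa only [hγ, hw, hx, Set.indicator_of_mem, Set.mem_compl_iff, not_false_iff,
        Set.indicator_of_notMem, zero_add] using hwx
  have hβ1 : ∀ x, |β x| ≤ 1 / K + 1 := by
    intro x
    by_cases hx : x ∈ D
    · simp only [hβ, hx, Set.indicator_of_mem, abs_mul, Real.abs_exp]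
      have h1 : Real.exp (-(σ * b x ^ 2)) ≤ 1 := by
        rw [Real.exp_le_one_iff]
        have : 0 ≤ σ * b x ^ 2 := by positivity
        linarith
      have h2 : b x ^ 2 ≤ 1 / K := (le_div_iff₀ hK).2 hx
      have h3 : |b x| ≤ 1 / K + 1 := by nlinarith [sq_abs (b x), sq_nonneg (|b x| - 1)]
      calc _ ≤ 1 * |b x| := by gcongr
        _ ≤ _ := by linarith
    · simp only [hβ, hx, not_false_iff, Set.indicator_of_notMem, abs_zero]
      positivity
  have hbound : ∀ ω, F ω ≤ w (X ω) + β (X ω) * e' ω + γ (X ω) * ψ ω := by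
    intro ω
    by_cases hx : X ω ∈ D
    · simp only [hw, hβ, hγ, hx, Set.indicator_of_mem, Set.mem_compl_iff, not_true, not_false_iff,
        Set.indicator_of_notMem, add_zero]
      have := exp_mul_le_of_sq_le hK hx (e' ω)
      simp only [hF, sub_eq_add_neg (e' ω * b (X ω)), Real.exp_add]
      have h2 := mul_le_mul_of_nonneg_right this (Real.exp_pos (-(σ * b (X ω) ^ 2))).le
      refine h2.trans (le_of_eq ?_)
      simp only [hψ]
      ring
    · simp only [hw, hβ, hγ, hx, Set.indicator_of_mem, Set.mem_compl_iff, not_false_iff,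
        Set.indicator_of_notMem, zero_add, zero_mul, add_zero]
      have := exp_mul_le_exp_mul hK (s := b (X ω)) (e' ω)
      simp only [hF, sub_eq_add_neg, Real.exp_add]
      have h2 := mul_le_mul_of_nonneg_right this (Real.exp_pos (-(σ * b (X ω) ^ 2))).le
      refine h2.trans (le_of_eq ?_)
      simp only [hψ]
      ring
  have hlin : ∀ x, w x + γ x * (1 / K) ≤ 1 := by
    intro x
    by_cases hx : x ∈ D
    · simp only [hw, hγ, hx, Set.indicator_of_mem, Set.mem_compl_iff, not_true, not_false_iff,
        Set.indicator_of_notMem, add_zero]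
      have h1 := Real.add_one_le_exp (σ * b x ^ 2)
      have h2 : Real.exp (-(σ * b x ^ 2)) + Real.exp (-(σ * b x ^ 2)) * (b x ^ 2 * K) * (1 / K) =
          Real.exp (-(σ * b x ^ 2)) * (1 + b x ^ 2) := by field_simp
      rw [h2, Real.exp_neg, inv_mul_le_iff₀ (Real.exp_pos _), mul_one]
      have h3 : b x ^ 2 ≤ σ * b x ^ 2 := le_mul_of_one_le_left (sq_nonneg _) (by rw [hσ]; linarith)
      linarith
    · simp only [hw, hγ, hx, Set.indicator_of_mem, Set.mem_compl_iff, not_false_iff,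
        Set.indicator_of_notMem, zero_add]
      have h1 : b x ^ 2 * K / 4 - σ * b x ^ 2 = -(b x ^ 2) := by rw [hσ]; ring
      have h2 : 1 / K < b x ^ 2 := (div_lt_iff₀ hK).2 (not_le.1 hx)
      have h3 := Real.add_one_le_exp (b x ^ 2)
      rw [h1, show Real.exp (-(b x ^ 2)) + Real.exp (-(b x ^ 2)) * (1 / K) =
        Real.exp (-(b x ^ 2)) * (1 + 1 / K) by ring, Real.exp_neg,
        inv_mul_le_iff₀ (Real.exp_pos _), mul_one]
      linarith
  have hXm : Measurable[MeasurableSpace.comap X inferInstance] X := comap_measurable X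
  have i1 : Integrable (fun ω => w (X ω)) P :=
    Integrable.of_bound (hwm.comp hX).aestronglyMeasurable 1 (ae_of_all _ fun ω => hw1 _)
  have i2 : Integrable ((fun ω => β (X ω)) * e') P :=
    hei.bdd_mul (hβm.comp hX).aestronglyMeasurable (ae_of_all _ fun ω => hβ1 _)
  have i3 : Integrable ((fun ω => γ (X ω)) * ψ) P :=
    hψi.bdd_mul (hγm.comp hX).aestronglyMeasurable (ae_of_all _ fun ω => hγ1 _)
  have hcond : ∀ᵐ ω ∂P, (P[(fun ω => w (X ω)) + (fun ω => β (X ω)) * e' +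
      (fun ω => γ (X ω)) * ψ | MeasurableSpace.comap X inferInstance]) ω ≤ 1 := by
    filter_upwards [condExp_add (i1.add i2) i3 (MeasurableSpace.comap X inferInstance), condExp_add i1 i2 (MeasurableSpace.comap X inferInstance),
      condExp_mul_of_stronglyMeasurable_left ((hβm.comp hXm).stronglyMeasurable) i2 hei,
      condExp_mul_of_stronglyMeasurable_left ((hγm.comp hXm).stronglyMeasurable) i3 hψi,
      hecond, hψcond] with ω h1 h2 h3 h4 h5 h6
    have h0 : P[fun ω => w (X ω) | MeasurableSpace.comap X inferInstance] = fun ω => w (X ω) :=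
      condExp_of_stronglyMeasurable hXle (hwm.comp hXm).stronglyMeasurable i1
    rw [h1, Pi.add_apply, h2, Pi.add_apply, h0]
    have h3' : (P[(fun ω => β (X ω)) * e' | MeasurableSpace.comap X inferInstance]) ω = 0 := by
      refine h3.trans ?_
      simp [h5]
    have h4' : (P[(fun ω => γ (X ω)) * ψ | MeasurableSpace.comap X inferInstance]) ω = γ (X ω) * (P[ψ | MeasurableSpace.comap X inferInstance]) ω := h4
    rw [h3', h4', add_zero]
    have := mul_le_mul_of_nonneg_left h6 (hγ0 (X ω))
    linarith [hlin (X ω)]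
  -- comparison of two measures on the covariates
  have hle : (P.withDensity fun ω => ENNReal.ofReal (F ω)).map X ≤ P.map X := by
    rw [Measure.le_iff]
    intro S hS
    rw [Measure.map_apply hX hS, Measure.map_apply hX hS, withDensity_apply _ (hX hS)]
    have hS' : MeasurableSet[MeasurableSpace.comap X inferInstance] (X ⁻¹' S) := ⟨S, hS, rfl⟩
    have hI : Integrable ((fun ω => w (X ω)) + (fun ω => β (X ω)) * e' + (fun ω => γ (X ω)) * ψ) P :=
      (i1.add i2).add i3
    calc _ ≤ ∫⁻ ω in X ⁻¹' S, ENNReal.ofReal (((fun ω => w (X ω)) + (fun ω => β (X ω)) * e' +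
          (fun ω => γ (X ω)) * ψ) ω) ∂P :=
          lintegral_mono fun ω => ENNReal.ofReal_le_ofReal (hbound ω)
      _ = ENNReal.ofReal (∫ ω in X ⁻¹' S, ((fun ω => w (X ω)) + (fun ω => β (X ω)) * e' +
          (fun ω => γ (X ω)) * ψ) ω ∂P) := by
          rw [ofReal_integral_eq_lintegral_ofReal hI.integrableOn]
          exact ae_of_all _ fun ω => (Real.exp_pos _).le.trans (hbound ω)
      _ = ENNReal.ofReal (∫ ω in X ⁻¹' S, (P[(fun ω => w (X ω)) + (fun ω => β (X ω)) * e' +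
          (fun ω => γ (X ω)) * ψ | MeasurableSpace.comap X inferInstance]) ω ∂P) := by
          rw [setIntegral_condExp hXle hI hS']
      _ ≤ ENNReal.ofReal (∫ ω in X ⁻¹' S, (1 : ℝ) ∂P) := by
          apply ENNReal.ofReal_le_ofReal
          exact integral_mono_ae integrable_condExp.integrableOn (integrable_const _)
            (ae_restrict_of_ae hcond)
      _ = P (X ⁻¹' S) := by simp [measureReal_def]
  calc ∫⁻ ω, v (X ω) * ENNReal.ofReal (F ω) ∂P
      = ∫⁻ ω, v (X ω) ∂(P.withDensity fun ω => ENNReal.ofReal (F ω)) := by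
        rw [lintegral_withDensity_eq_lintegral_mul _ (by fun_prop)
          (show Measurable fun ω => v (X ω) from hv.comp hX)]
        exact lintegral_congr fun ω => mul_comm _ _
    _ = ∫⁻ x, v x ∂((P.withDensity fun ω => ENNReal.ofReal (F ω)).map X) :=
        (lintegral_map hv hX).symm
    _ ≤ ∫⁻ x, v x ∂(P.map X) := lintegral_mono' hle le_rfl
    _ = ∫⁻ ω, v (X ω) ∂P := lintegral_map hv hX

end

section

variable {d : ℕ} [NeZero d] {Ω : Type*} [MeasurableSpace Ω] {P : Measure Ω}

theorem exists_convexHull_eq_Icc {S : Set ℝ} (hS : IsCompact S) (hne : S.Nonempty) :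
    ∃ a b, a ∈ S ∧ b ∈ S ∧ a ≤ b ∧ convexHull ℝ S = Set.Icc a b := by
  have hle : sInf S ≤ sSup S := le_csSup hS.bddAbove (hS.sInf_mem hne)
  refine ⟨sInf S, sSup S, hS.sInf_mem hne, hS.sSup_mem hne, hle, ?_⟩
  refine le_antisymm (convexHull_min (fun x hx => ⟨csInf_le hS.bddBelow hx, le_csSup hS.bddAbove hx⟩)
    (convex_Icc _ _)) ?_
  rw [← segment_eq_Icc hle]
  exact segment_subset_convexHull (hS.sInf_mem hne) (hS.sSup_mem hne)

theorem inner_eq_sum {d : ℕ} (θ x : EuclideanSpace ℝ (Fin d)) : (inner ℝ θ x : ℝ) = ∑ i, θ i * x i := by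
  simp [PiLp.inner_apply, mul_comm]

/-- The variance of the indices is bounded away from zero. -/
theorem exists_le_variance [IsProbabilityMeasure P] {X : Ω → EuclideanSpace ℝ (Fin d)}
    (hX2 : ∀ i, MemLp (fun ω => X ω i) 2 P) (hcov : (covMatrix P X).PosDef) :
    ∃ v : ℝ, 0 < v ∧ ∀ θ ∈ Theta d, v ≤ Var[fun ω => (inner ℝ θ (X ω) : ℝ); P] := by
  have hvar : ∀ θ : EuclideanSpace ℝ (Fin d), Var[fun ω => (inner ℝ θ (X ω) : ℝ); P] =
      ∑ i, ∑ j, θ i * (covMatrix P X i j * θ j) := by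
    intro θ
    have h1 : (fun ω => (inner ℝ θ (X ω) : ℝ)) = ∑ i, fun ω => θ i * X ω i := by
      funext ω; rw [inner_eq_sum]; simp
    rw [h1, variance_sum fun i => (hX2 i).const_mul (θ i)]
    refine Finset.sum_congr rfl fun i _ => Finset.sum_congr rfl fun j _ => ?_
    rw [covariance_const_mul_left, covariance_const_mul_right, covMatrix, Matrix.of_apply]
    ring
  have hpos : ∀ θ ∈ Theta d, 0 < ∑ i, ∑ j, θ i * (covMatrix P X i j * θ j) := by
    intro θ hθ
    have hne : (fun i => θ i) ≠ 0 := by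
      intro h0
      have : θ = 0 := by ext i; exact congrFun h0 i
      have h1 := hθ.1
      rw [this, norm_zero] at h1
      exact zero_ne_one h1
    have := hcov.dotProduct_mulVec_pos hne
    simpa [dotProduct, Matrix.mulVec, Finset.mul_sum] using this
  have hcont : Continuous fun θ : EuclideanSpace ℝ (Fin d) =>
      ∑ i, ∑ j, θ i * (covMatrix P X i j * θ j) := by fun_prop
  rcases (Theta d).eq_empty_or_nonempty with h | h
  · exact ⟨1, one_pos, by simp [h]⟩
  obtain ⟨θm, hθm, hmin⟩ := (isCompact_Theta (d := d)).exists_isMinOn h hcont.continuousOn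
  exact ⟨_, hpos θm hθm, fun θ hθ => by rw [hvar]; exact hmin hθ⟩

/-- The values of the indices are bounded and not constant. -/
theorem exists_indexSet_eq_Icc [IsProbabilityMeasure P] {X : Ω → EuclideanSpace ℝ (Fin d)}
    (hX : Measurable X) (hcompact : IsCompact (P.map X).support)
    (hcov : (covMatrix P X).PosDef) {θ₀ : EuclideanSpace ℝ (Fin d)} (hθ₀ : θ₀ ∈ Theta d) :
    ∃ a b, a < b ∧ indexSet (P.map X).support = Set.Icc a b ∧
      ∀ x ∈ (P.map X).support, ∀ θ ∈ Theta d, (inner ℝ θ x : ℝ) ∈ Set.Icc a b := by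
  have : IsProbabilityMeasure (P.map X) := Measure.isProbabilityMeasure_map hX.aemeasurable
  obtain ⟨x₀, hx₀⟩ := Measure.nonempty_support (IsProbabilityMeasure.ne_zero (P.map X))
  set S : Set ℝ := {t | ∃ θ ∈ Theta d, ∃ x ∈ (P.map X).support, t = inner ℝ θ x} with hS
  have hSeq : S = (fun q : EuclideanSpace ℝ (Fin d) × EuclideanSpace ℝ (Fin d) =>
      (inner ℝ q.1 q.2 : ℝ)) '' (Theta d ×ˢ (P.map X).support) := by
    ext t
    constructor
    · rintro ⟨θ, hθ, x, hx, rfl⟩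
      exact ⟨(θ, x), ⟨hθ, hx⟩, rfl⟩
    · rintro ⟨⟨θ, x⟩, ⟨hθ, hx⟩, rfl⟩
      exact ⟨θ, hθ, x, hx, rfl⟩
  have hSc : IsCompact S := by
    rw [hSeq]
    exact ((isCompact_Theta (d := d)).prod hcompact).image (by fun_prop)
  obtain ⟨a, b, ha, hb, hab, heq⟩ := exists_convexHull_eq_Icc hSc ⟨_, θ₀, hθ₀, x₀, hx₀, rfl⟩
  have hmem : ∀ x ∈ (P.map X).support, ∀ θ ∈ Theta d, (inner ℝ θ x : ℝ) ∈ Set.Icc a b :=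
    fun x hx θ hθ => heq ▸ subset_convexHull ℝ S ⟨θ, hθ, x, hx, rfl⟩
  refine ⟨a, b, lt_of_le_of_ne hab fun hab' => ?_, heq, hmem⟩
  have hae : ∀ᵐ ω ∂P, X ω ∈ (P.map X).support :=
    ae_of_ae_map hX.aemeasurable (Measure.support_mem_ae (μ := P.map X))
  obtain ⟨B, hB⟩ := hcompact.isBounded.exists_norm_le
  obtain ⟨v, hv, hvar⟩ := exists_le_variance (P := P) (X := X) (fun i => by
    refine MemLp.of_bound (by fun_prop) B ?_
    filter_upwards [hae] with ω hω
    exact (PiLp.norm_apply_le (X ω) i).trans (hB _ hω)) hcov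
  have h0 : Var[fun ω => (inner ℝ θ₀ (X ω) : ℝ); P] = 0 := by
    have h1 : (fun ω => (inner ℝ θ₀ (X ω) : ℝ)) =ᵐ[P] fun _ => a := by
      filter_upwards [hae] with ω hω
      have := hmem _ hω θ₀ hθ₀
      rw [← hab', Set.Icc_self] at this
      exact this
    rw [variance_congr h1, variance_eq_integral aemeasurable_const]
    simp
  have := hvar θ₀ hθ₀
  linarith

/-- Linear functions of an index have a second moment that is comparable to the size of their
coefficients. -/
theorem exists_le_integral_linear_sq {PX : Measure (EuclideanSpace ℝ (Fin d))}
    [IsProbabilityMeasure PX] {a b v : ℝ} (hab : a ≤ b) (hv : 0 < v)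
    (hI : ∀ᵐ x ∂PX, ∀ θ ∈ Theta d, (inner ℝ θ x : ℝ) ∈ Set.Icc a b)
    (hvar : ∀ θ ∈ Theta d, v ≤ Var[fun x => (inner ℝ θ x : ℝ); PX]) :
    ∃ κ : ℝ, 0 < κ ∧ ∀ θ ∈ Theta d, ∀ c s : ℝ,
      κ * (c ^ 2 + s ^ 2) ≤ ∫ x, (c + s * (inner ℝ θ x - a)) ^ 2 ∂PX := by
  set L := b - a with hL
  have hL0 : 0 ≤ L := by linarith
  refine ⟨(2 + (2 * L ^ 2 + 1) / v)⁻¹, by positivity, fun θ hθ c s => ?_⟩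
  have hmeas : AEStronglyMeasurable (fun x : EuclideanSpace ℝ (Fin d) => (inner ℝ θ x : ℝ) - a) PX :=
    Continuous.aestronglyMeasurable (by fun_prop)
  have hLp : MemLp (fun x : EuclideanSpace ℝ (Fin d) => (inner ℝ θ x : ℝ) - a) 2 PX := by
    refine MemLp.of_bound hmeas L ?_
    filter_upwards [hI] with x hx
    have := hx θ hθ
    rw [Real.norm_eq_abs, abs_of_nonneg (by linarith [this.1])]
    linarith [this.2]
  have hint := hLp.integrable one_le_two
  have hsq := hLp.integrable_sq
  set E := ∫ x, ((inner ℝ θ x : ℝ) - a) ∂PX with hE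
  set Q := ∫ x, ((inner ℝ θ x : ℝ) - a) ^ 2 ∂PX with hQ
  have hE0 : 0 ≤ E := integral_nonneg_of_ae (by
    filter_upwards [hI] with x hx
    have := (hx θ hθ).1
    simp only [Pi.zero_apply]
    linarith)
  have hE1 : E ≤ L := by
    have : E ≤ ∫ _x : EuclideanSpace ℝ (Fin d), L ∂PX := integral_mono_ae hint (integrable_const _) (by
      filter_upwards [hI] with x hx
      have := (hx θ hθ).2
      linarith)
    simpa using this
  have hV : v ≤ Q - E ^ 2 := by
    have h1 := variance_eq_sub hLp
    have h2 : Var[fun x => (inner ℝ θ x : ℝ) - a; PX] = Var[fun x => (inner ℝ θ x : ℝ); PX] :=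
      variance_sub_const (Continuous.aestronglyMeasurable (by fun_prop)) a
    rw [h2] at h1
    exact (hvar θ hθ).trans h1.le
  have heq : ∫ x, (c + s * (inner ℝ θ x - a)) ^ 2 ∂PX = c ^ 2 + 2 * c * s * E + s ^ 2 * Q := by
    have : (fun x : EuclideanSpace ℝ (Fin d) => (c + s * (inner ℝ θ x - a)) ^ 2) = fun x =>
        (c ^ 2 + 2 * c * s * (inner ℝ θ x - a)) + s ^ 2 * (inner ℝ θ x - a) ^ 2 := by
      funext x; ring
    have i1 : Integrable (fun x : EuclideanSpace ℝ (Fin d) =>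
        c ^ 2 + 2 * c * s * ((inner ℝ θ x : ℝ) - a)) PX := (integrable_const _).add (hint.const_mul _)
    rw [this, integral_add i1 (hsq.const_mul _),
      integral_add (integrable_const _) (hint.const_mul _), integral_const_mul, integral_const_mul]
    simp [hE, hQ]
  rw [heq, inv_mul_le_iff₀ (by positivity)]
  set I := c ^ 2 + 2 * c * s * E + s ^ 2 * Q with hI'
  have h1 : (c + s * E) ^ 2 + s ^ 2 * v ≤ I := by
    nlinarith [mul_le_mul_of_nonneg_left hV (sq_nonneg s)]
  have h2 : c ^ 2 ≤ 2 * (c + s * E) ^ 2 + 2 * (s ^ 2 * L ^ 2) := by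
    have : (s * E) ^ 2 ≤ s ^ 2 * L ^ 2 := by
      rw [mul_pow]; gcongr
    nlinarith [sq_nonneg (c + 2 * (s * E))]
  have h3 : s ^ 2 ≤ I / v := by
    rw [le_div_iff₀ hv]; nlinarith [sq_nonneg (c + s * E)]
  have h4 : (2 + (2 * L ^ 2 + 1) / v) * I = 2 * I + (2 * L ^ 2 + 1) * (I / v) := by ring
  have h5 : (2 * L ^ 2 + 1) * s ^ 2 ≤ (2 * L ^ 2 + 1) * (I / v) := by gcongr
  rw [h4]
  nlinarith [mul_nonneg (sq_nonneg s) hv.le]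

/-- If the slope of the true link vanishes almost surely, the weighted moment matrix is zero. -/
theorem not_ae_slope_eq_zero {X : Ω → EuclideanSpace ℝ (Fin d)} (hX : Measurable X) {D : Set ℝ}
    {m₀ g₀ : ℝ → ℝ} {θ₀ : EuclideanSpace ℝ (Fin d)}
    (hD : ∀ᵐ ω ∂P, (inner ℝ θ₀ (X ω) : ℝ) ∈ D) (hg₀ : ∀ t ∈ D, derivWithin m₀ D t = g₀ t)
    (h : IsUnit (weightedMoment P X D m₀ θ₀)) :
    ¬ ∀ᵐ x ∂(P.map X), g₀ (inner ℝ θ₀ x) = 0 := by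
  intro h0
  have h1 := ae_of_ae_map hX.aemeasurable h0
  have h2 : weightedMoment P X D m₀ θ₀ = 0 := by
    ext i j
    rw [weightedMoment, Matrix.of_apply, Matrix.zero_apply]
    refine integral_eq_zero_of_ae ?_
    filter_upwards [hD, h1] with ω hω1 hω2
    rw [hg₀ _ hω1, hω2]
    simp
  rw [h2] at h
  exact not_isUnit_zero h

/-- A `1 / n`-net of the parameter space of polynomial size. -/
theorem exists_net_Theta (d : ℕ) [NeZero d] {n : ℕ} (hn : 0 < n) :
    ∃ F : Finset (EuclideanSpace ℝ (Fin d)), (↑F ⊆ Theta d) ∧ F.card ≤ (2 * n + 1) ^ d ∧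
      ∀ θ ∈ Theta d, ∃ θ' ∈ F, ‖θ - θ'‖ ≤ d / n := by
  have hn' : (0 : ℝ) < n := by exact_mod_cast hn
  obtain ⟨F, hF1, hF2, hF3⟩ := exists_finset_representatives (Theta d)
    (fun θ (i : Fin d) => ⌊θ i / (1 / (n : ℝ))⌋)
    (Fintype.piFinset fun _ => Finset.Icc (-(n : ℤ)) n) (by
      intro θ hθ
      rw [Fintype.mem_piFinset]
      intro i
      have h1 : |θ i| ≤ 1 := by
        rw [← Real.norm_eq_abs, ← hθ.1]
        exact PiLp.norm_apply_le θ i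
      rw [abs_le] at h1
      rw [Finset.mem_Icc, Int.le_floor, div_div_eq_mul_div, div_one]
      constructor
      · push_cast; nlinarith
      · have : ⌊θ i * n⌋ ≤ ⌊(n : ℝ)⌋ := Int.floor_le_floor (by nlinarith)
        simpa using this)
  refine ⟨F, hF1, hF2.trans (le_of_eq ?_), fun θ hθ => ?_⟩
  · rw [Fintype.card_piFinset]
    simp only [Int.card_Icc, Finset.prod_const, Finset.card_univ, Fintype.card_fin]
    congr 1
    omega
  obtain ⟨θ', hθ', heq⟩ := hF3 θ hθ
  refine ⟨θ', hθ', ?_⟩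
  have hi : ∀ i, |(θ - θ') i| ≤ 1 / n := fun i =>
    abs_sub_le_of_floor_eq (by positivity) (congrFun heq i).symm
  rw [EuclideanSpace.norm_eq, Real.sqrt_le_left (by positivity)]
  have hd : (1 : ℝ) ≤ d := by exact_mod_cast NeZero.one_le
  calc ∑ i, ‖(θ - θ') i‖ ^ 2 ≤ ∑ _i : Fin d, (1 / (n : ℝ)) ^ 2 := by
        refine Finset.sum_le_sum fun i _ => ?_
        rw [Real.norm_eq_abs]
        exact pow_le_pow_left₀ (abs_nonneg _) (hi i) 2
    _ = d * (1 / (n : ℝ)) ^ 2 := by simp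
    _ ≤ (d * d) * (1 / (n : ℝ)) ^ 2 := by gcongr; nlinarith
    _ = (d / n : ℝ) ^ 2 := by ring

end

section

/-! ### The event on which the estimators are analysed -/

section Sample

variable {𝒳 : Type*} [MeasurableSpace 𝒳] {a b σ κ R C : ℝ} {M₀ T : 𝒳 → ℝ}
  {μ : Measure (𝒳 × ℝ)} {n N : ℕ}

/-- The bounds for one index `T` that the analysis of a sample `z` uses: the noise is controlled on
the functions `m ∘ T - M₀`, their population norm is controlled by the empirical one, and the
empirical second moments of linear functions of `T` are bounded from below. -/
structure IsGoodSample (a b σ κ R C : ℝ) (M₀ T : 𝒳 → ℝ) (μ : Measure (𝒳 × ℝ)) (N : ℕ) {n : ℕ}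
    (z : Fin n → 𝒳 × ℝ) : Prop where
  noise : ∀ (J c : ℝ) (g : ℝ → ℝ), 0 ≤ J → IsLink J g →
    |∑ i, (z i).2 * (prim a c g (T (z i).1) - M₀ (z i).1)| ≤
      Real.sqrt (32 * σ * N) * Real.sqrt (∑ i, (prim a c g (T (z i).1) - M₀ (z i).1) ^ 2) +
      25 * Real.sqrt (σ * n) * ((2 * (b - a) / N) * Real.sqrt (2 * (b - a) / N)) * J
  norm : ∀ p ∈ linkBall a R, n * ∫ w, (prim a p.1 p.2 (T w.1) - M₀ w.1) ^ 2 ∂μ ≤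
    8 * ∑ i, (prim a p.1 p.2 (T (z i).1) - M₀ (z i).1) ^ 2 + C * (n / N ^ 4 + N)
  linear : ∀ c s : ℝ, κ * n * (c ^ 2 + s ^ 2) ≤ 16 * ∑ i, (c + s * (T (z i).1 - a)) ^ 2

theorem prim_const (a c s t : ℝ) : prim a c (fun _ => s) t = c + s * (t - a) := by
  simp [prim, mul_comm]

theorem isLink_const (s : ℝ) {J : ℝ} : IsLink J fun _ => s :=
  ⟨continuous_const, fun _ => 0, monotone_const, fun _ _ => by simpa using sq_nonneg J,
    fun _ _ _ => by simp⟩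

/-- The norm comparison for linear functions of unit size bounds their empirical second moments. -/
theorem linear_of_norm_le {CL : ℝ} {z : Fin n → 𝒳 × ℝ}
    (hlin : ∀ c s : ℝ, κ * (c ^ 2 + s ^ 2) ≤ ∫ w, (c + s * (T w.1 - a)) ^ 2 ∂μ)
    (hsmall : CL * (n / N ^ 4 + N) ≤ κ * n / 2)
    (h : ∀ p ∈ linkBall a 1, n * ∫ w, (prim a p.1 p.2 (T w.1) - 0) ^ 2 ∂μ ≤
      8 * ∑ i, (prim a p.1 p.2 (T (z i).1) - 0) ^ 2 + CL * (n / N ^ 4 + N)) (c s : ℝ) :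
    κ * n * (c ^ 2 + s ^ 2) ≤ 16 * ∑ i, (c + s * (T (z i).1 - a)) ^ 2 := by
  rcases (add_nonneg (sq_nonneg c) (sq_nonneg s)).eq_or_lt with h0 | hpos
  · rw [← h0, mul_zero]
    exact mul_nonneg (by norm_num) (Finset.sum_nonneg fun i _ => sq_nonneg _)
  set r := Real.sqrt (c ^ 2 + s ^ 2) with hr
  have hr0 : 0 < r := Real.sqrt_pos.2 hpos
  have hr2 : r ^ 2 = c ^ 2 + s ^ 2 := Real.sq_sqrt hpos.le
  have hle : ∀ y : ℝ, y ^ 2 ≤ c ^ 2 + s ^ 2 → |y / r| ≤ 1 := by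
    intro y hy
    rw [abs_div, abs_of_pos hr0, div_le_one hr0]
    exact Real.abs_le_sqrt hy
  have h1 := h (c / r, fun _ => s / r) ⟨hle c (by nlinarith [sq_nonneg s]),
    hle s (by nlinarith [sq_nonneg c]), isLink_const _⟩
  have h2 := hlin (c / r) (s / r)
  simp only [prim_const, sub_zero] at h1
  have h3 : (c / r) ^ 2 + (s / r) ^ 2 = 1 := by
    rw [div_pow, div_pow, ← add_div, ← hr2, div_self (by positivity)]
  rw [h3, mul_one] at h2
  have h4 : ∑ i, (c / r + s / r * (T (z i).1 - a)) ^ 2 =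
      (∑ i, (c + s * (T (z i).1 - a)) ^ 2) / r ^ 2 := by
    rw [Finset.sum_div]
    refine Finset.sum_congr rfl fun i _ => ?_
    field_simp
  rw [h4] at h1
  have h5 : κ * n ≤ n * ∫ w, (c / r + s / r * (T w.1 - a)) ^ 2 ∂μ := by
    rw [mul_comm]; exact mul_le_mul_of_nonneg_left h2 (Nat.cast_nonneg n)
  have h6 : κ * n ≤ 16 * ((∑ i, (c + s * (T (z i).1 - a)) ^ 2) / r ^ 2) := by linarith
  rw [← hr2]
  calc κ * n * r ^ 2 ≤ 16 * ((∑ i, (c + s * (T (z i).1 - a)) ^ 2) / r ^ 2) * r ^ 2 := by gcongr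
    _ = _ := by field_simp

/-- The bounds hold for one index with high probability: uniform control of the noise, and the norm
comparison for links of size `R` and, with `M₀ = 0`, for linear functions of unit size. -/
theorem exists_measure_not_isGoodSample_le (hab : a < b) (hR : 0 ≤ R) : ∃ C CL : ℝ,
    0 ≤ C ∧ 0 ≤ CL ∧ ∀ (σ κ : ℝ) (μ : Measure (𝒳 × ℝ)) [IsProbabilityMeasure μ],
      0 < σ → IsSubG μ σ → ∀ M₀ : 𝒳 → ℝ, Measurable M₀ → (∀ x, |M₀ x| ≤ R) →
      ∀ T : 𝒳 → ℝ, Measurable T → (∀ x, T x ∈ Set.Ico a b) →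
      (∀ c s : ℝ, κ * (c ^ 2 + s ^ 2) ≤ ∫ w, (c + s * (T w.1 - a)) ^ 2 ∂μ) →
      ∀ n N : ℕ, 0 < n → 0 < N → N ^ 2 ≤ 2 * n → CL * (n / N ^ 4 + N) ≤ κ * n / 2 →
      (Measure.pi fun _ : Fin n => μ) {z | ¬ IsGoodSample a b σ κ R C M₀ T μ N z} ≤
        ENNReal.ofReal ((3 * N + 4) * Real.exp (-N)) := by
  obtain ⟨C, hC, hnorm⟩ := exists_norm_comparison (𝒳 := 𝒳) hab hR
  obtain ⟨CL, hCL, hlinear⟩ := exists_norm_comparison (𝒳 := 𝒳) hab zero_le_one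
  refine ⟨C, CL, hC, hCL, ?_⟩
  intro σ κ μ _ hσ hμ M₀ hM₀ hM₀R T hT hTab hlin n N hn hN hNn hsmall
  have hTm : Measurable fun w : 𝒳 × ℝ => T w.1 := hT.comp measurable_fst
  have : IsProbabilityMeasure (μ.map fun w => T w.1) :=
    Measure.isProbabilityMeasure_map hTm.aemeasurable
  obtain ⟨τ, hτ⟩ := exists_isKnots hab (μ.map fun w => T w.1)
    ((ae_map_iff hTm.aemeasurable measurableSet_Iic).2 (ae_of_all _ fun w => (hTab w.1).2.le)) hN
  have h1 := hμ.measure_noise_le hσ hab hT hTab hM₀ hτ hN hn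
  have h2 := hnorm μ T M₀ hT hTab hM₀ hM₀R N n τ hN hτ
  have h3 := hlinear μ T (fun _ => 0) hT hTab measurable_const (by simp) N n τ hN hτ
  set ex := ENNReal.ofReal (Real.exp (-N)) with hex
  have hexp : ENNReal.ofReal (Real.exp (-(n * (2 / N)))) ≤ ex := by
    apply ENNReal.ofReal_le_ofReal
    apply Real.exp_le_exp.2
    have hN' : (0 : ℝ) < N := by exact_mod_cast hN
    have : (N : ℝ) ^ 2 ≤ 2 * n := by exact_mod_cast hNn
    rw [neg_le_neg_iff, mul_div_assoc', le_div_iff₀ hN']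
    nlinarith
  refine (measure_mono (t := _ ∪ (_ ∪ _)) ?_).trans ((measure_union_le _ _).trans (add_le_add
    h1 ((measure_union_le _ _).trans (add_le_add h2 h3)))) |>.trans ?_
  · intro z hz
    by_contra hcon
    simp only [Set.mem_union, not_or, Set.mem_ofPred_eq, not_not] at hcon
    exact hz ⟨hcon.1, hcon.2.1, linear_of_norm_le hlin hsmall hcon.2.2⟩
  · calc _ ≤ ((N : ℝ≥0∞) * ex + 2 * ex) + ((N * ex + ex) + (N * ex + ex)) := by gcongr
      _ = (3 * N + 4) * ex := by ring
      _ = _ := by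
        rw [hex, ENNReal.ofReal_mul (by positivity), ENNReal.ofReal_add (by positivity) (by norm_num),
          ENNReal.ofReal_mul (by norm_num), ENNReal.ofReal_natCast]
        norm_num

/-- The mean of the squared errors is bounded. -/
theorem IsSubG.measure_sum_sq_le [IsProbabilityMeasure μ] (hμ : IsSubG μ σ) (hσ : 0 < σ) (n : ℕ) :
    (Measure.pi fun _ : Fin n => μ) {z | 16 * σ * n < ∑ i, (z i).2 ^ 2} ≤
      ENNReal.ofReal (Real.exp (-n)) := by
  classical
  refine (measure_mono ?_).trans (hμ.measure_span_le' hσ (n := n) (ι := Fin n)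
    (ψ := fun _ k i => if k = i then 1 else 0) (fun k i => measurable_const) n)
  intro z hz
  refine ⟨fun k => (z k).2, ?_⟩
  have h0 : 0 < ∑ i, (z i).2 ^ 2 := lt_of_le_of_lt (by positivity) hz
  simp only [mul_ite, mul_one, mul_zero, Finset.sum_ite_eq', Finset.mem_univ, if_true,
    Fintype.card_fin]
  simp only [← sq]
  rw [sq (∑ i, (z i).2 ^ 2)]
  refine mul_lt_mul_of_pos_right (lt_of_le_of_lt (le_of_eq ?_) hz) h0
  ring

end Sample

variable {d : ℕ}

/-- The index `θᵀx`, with values outside `[a, b]` moved to the nearest endpoint. -/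
def clampIndex (a b : ℝ) (θ x : EuclideanSpace ℝ (Fin d)) : ℝ := max a (min b (inner ℝ θ x))

theorem clampIndex_mem {a b : ℝ} (hab : a ≤ b) (θ x : EuclideanSpace ℝ (Fin d)) :
    clampIndex a b θ x ∈ Set.Icc a b :=
  ⟨le_max_left _ _, max_le hab (min_le_left _ _)⟩

theorem clampIndex_eq {a b : ℝ} {θ x : EuclideanSpace ℝ (Fin d)}
    (h : (inner ℝ θ x : ℝ) ∈ Set.Icc a b) : clampIndex a b θ x = inner ℝ θ x := by
  rw [clampIndex, min_eq_right h.2, max_eq_right h.1]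

theorem measurable_clampIndex (a b : ℝ) (θ : EuclideanSpace ℝ (Fin d)) :
    Measurable (clampIndex a b θ) := by
  unfold clampIndex
  fun_prop

variable [NeZero d]

/-- The bounds hold with high probability for all indices in a `1 / n`-net of the parameter space, by a
union bound over polynomially many indices. -/
theorem exists_net_isGoodSample {a b R : ℝ} (hab : a < b) (hR : 0 ≤ R) : ∃ C CL : ℝ,
    0 ≤ C ∧ 0 ≤ CL ∧ ∀ (σ κ : ℝ) (μ : Measure (EuclideanSpace ℝ (Fin d) × ℝ))
      [IsProbabilityMeasure μ], 0 < σ → IsSubG μ σ →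
      (∀ᵐ w ∂μ, ∀ θ ∈ Theta d, (inner ℝ θ w.1 : ℝ) ∈ Set.Icc a b) →
      (∀ θ ∈ Theta d, ∀ c s : ℝ,
        κ * (c ^ 2 + s ^ 2) ≤ ∫ w, (c + s * (inner ℝ θ w.1 - a)) ^ 2 ∂μ) →
      ∀ M₀ : EuclideanSpace ℝ (Fin d) → ℝ, Measurable M₀ → (∀ x, |M₀ x| ≤ R) →
      ∀ n N : ℕ, 0 < n → 0 < N → N ^ 2 ≤ 2 * n → CL * (n / N ^ 4 + N) ≤ κ * n / 2 →
      (Measure.pi fun _ : Fin n => μ) {z | ¬ ((∑ i, (z i).2 ^ 2 ≤ 16 * σ * n) ∧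
        ∀ θ ∈ Theta d, ∃ θ' ∈ Theta d, ‖θ - θ'‖ ≤ d / n ∧
          IsGoodSample a (b + 1) σ κ R C M₀ (clampIndex a b θ') μ N z)} ≤
        ENNReal.ofReal (Real.exp (-n) + (2 * n + 1) ^ d * ((3 * N + 4) * Real.exp (-N))) := by
  obtain ⟨C, CL, hC, hCL, h⟩ := exists_measure_not_isGoodSample_le
    (𝒳 := EuclideanSpace ℝ (Fin d)) (show a < b + 1 by linarith) hR
  refine ⟨C, CL, hC, hCL, ?_⟩
  intro σ κ μ _ hσ hμ hI hlin M₀ hM₀ hM₀R n N hn hN hNn hsmall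
  obtain ⟨F, hF1, hF2, hF3⟩ := exists_net_Theta d hn
  have hθ : ∀ θ ∈ F, (Measure.pi fun _ : Fin n => μ)
      {z | ¬ IsGoodSample a (b + 1) σ κ R C M₀ (clampIndex a b θ) μ N z} ≤
        ENNReal.ofReal ((3 * N + 4) * Real.exp (-N)) := by
    intro θ hθ
    refine h σ κ μ hσ hμ M₀ hM₀ hM₀R _ (measurable_clampIndex a b θ) (fun x => ?_) (fun c s => ?_)
      n N hn hN hNn hsmall
    · have := clampIndex_mem hab.le θ x
      exact ⟨this.1, by linarith [this.2]⟩
    · refine (hlin θ (hF1 hθ) c s).trans (le_of_eq (integral_congr_ae ?_))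
      filter_upwards [hI] with w hw
      rw [clampIndex_eq (hw θ (hF1 hθ))]
  refine (measure_mono (t := {z | 16 * σ * n < ∑ i, (z i).2 ^ 2} ∪ ⋃ θ ∈ F,
    {z | ¬ IsGoodSample a (b + 1) σ κ R C M₀ (clampIndex a b θ) μ N z}) ?_).trans ?_
  · intro z hz
    by_contra hcon
    simp only [Set.mem_union, Set.mem_iUnion, not_or, not_exists, Set.mem_ofPred_eq,
      not_not, not_lt] at hcon
    refine hz ⟨hcon.1, fun θ hθ => ?_⟩
    obtain ⟨θ', hθ', hd⟩ := hF3 θ hθ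
    exact ⟨θ', hF1 hθ', hd, hcon.2 θ' hθ'⟩
  · refine (measure_union_le _ _).trans ?_
    rw [ENNReal.ofReal_add (Real.exp_pos _).le (by positivity)]
    refine add_le_add (hμ.measure_sum_sq_le hσ n) ?_
    calc _ ≤ ∑ θ ∈ F, (Measure.pi fun _ : Fin n => μ)
          {z | ¬ IsGoodSample a (b + 1) σ κ R C M₀ (clampIndex a b θ) μ N z} :=
          measure_biUnion_finset_le _ _
      _ ≤ ∑ _θ ∈ F, ENNReal.ofReal ((3 * N + 4) * Real.exp (-N)) := Finset.sum_le_sum hθ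
      _ = ENNReal.ofReal (F.card * ((3 * N + 4) * Real.exp (-N))) := by
          rw [Finset.sum_const, nsmul_eq_mul, ENNReal.ofReal_mul (Nat.cast_nonneg _),
            ENNReal.ofReal_natCast]
      _ ≤ _ := by
          apply ENNReal.ofReal_le_ofReal
          have : (F.card : ℝ) ≤ (2 * n + 1) ^ d := by exact_mod_cast hF2
          gcongr

end

section

/-! ### The basic inequality -/

/-- A quadratic inequality for the prediction error `A` and the roughness `J`, with a linear right
side of small order `k ≤ K l`, is solved by absorbing the linear terms. -/
theorem sq_add_sq_le_of_le {A J G k l c₁ c₂ K J₀ : ℝ} (hA : 0 ≤ A) (hJ : 0 ≤ J)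
    (hk : 0 ≤ k) (hk1 : k ≤ 1) (hc₁ : 0 ≤ c₁) (hc₂ : 0 ≤ c₂) (hkl : k ≤ K * l)
    (h : A ^ 2 + l ^ 2 * J ^ 2 ≤ c₁ * (k * A + k ^ 2 * J + k ^ 2 * G) + l ^ 2 * J₀ ^ 2)
    (hG : G ≤ c₂ * (A + 1 + J)) :
    A ^ 2 + l ^ 2 * J ^ 2 ≤ (2 * (c₁ ^ 2 + (c₁ * c₂) ^ 2 + c₁ * c₂) * K ^ 2 +
      (c₁ + c₁ * c₂) ^ 2 * K ^ 4 + 2 * J₀ ^ 2) * l ^ 2 := by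
  have h1 : c₁ * (k ^ 2 * G) ≤ c₁ * c₂ * (k ^ 2 * A) + c₁ * c₂ * k ^ 2 + c₁ * c₂ * (k ^ 2 * J) := by
    calc c₁ * (k ^ 2 * G) ≤ c₁ * (k ^ 2 * (c₂ * (A + 1 + J))) := by gcongr
      _ = _ := by ring
  have hkk : k ^ 2 ≤ K ^ 2 * l ^ 2 := by rw [← mul_pow]; exact pow_le_pow_left₀ hk hkl 2
  have h2 : c₁ * (k * A) ≤ A ^ 2 / 4 + c₁ ^ 2 * k ^ 2 := by nlinarith [sq_nonneg (A / 2 - c₁ * k)]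
  have h3 : c₁ * c₂ * (k ^ 2 * A) ≤ A ^ 2 / 4 + (c₁ * c₂) ^ 2 * k ^ 2 := by
    have : c₁ * c₂ * (k ^ 2 * A) ≤ c₁ * c₂ * (k * A) := by
      gcongr
      nlinarith
    nlinarith [sq_nonneg (A / 2 - c₁ * c₂ * k)]
  have h4 : (c₁ + c₁ * c₂) * (k ^ 2 * J) ≤
      l ^ 2 * J ^ 2 / 2 + (c₁ + c₁ * c₂) ^ 2 * K ^ 4 * l ^ 2 / 2 := by
    calc _ ≤ (c₁ + c₁ * c₂) * (K ^ 2 * l ^ 2 * J) := by gcongr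
      _ ≤ _ := by nlinarith [sq_nonneg (l * J - (c₁ + c₁ * c₂) * K ^ 2 * l)]
  have h5 : (c₁ ^ 2 + (c₁ * c₂) ^ 2 + c₁ * c₂) * k ^ 2 ≤
      (c₁ ^ 2 + (c₁ * c₂) ^ 2 + c₁ * c₂) * (K ^ 2 * l ^ 2) := by gcongr
  nlinarith

/-- The empirical norm of a uniformly small perturbation. -/
theorem sqrt_sum_sq_le_of_abs_sub_le {n : ℕ} {f f' : Fin n → ℝ} {δ : ℝ} (hδ : 0 ≤ δ)
    (h : ∀ i, |f i - f' i| ≤ δ) :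
    Real.sqrt (∑ i, f' i ^ 2) ≤ Real.sqrt (∑ i, f i ^ 2) + Real.sqrt n * δ := by
  have h1 := sqrt_sum_sub_sq_le f fun i => f i - f' i
  simp only [sub_sub_cancel] at h1
  refine h1.trans (add_le_add le_rfl ?_)
  rw [Real.sqrt_le_left (by positivity), mul_pow, Real.sq_sqrt (Nat.cast_nonneg n)]
  calc ∑ i, (f i - f' i) ^ 2 ≤ ∑ _i : Fin n, δ ^ 2 := Finset.sum_le_sum fun i _ => by
        rw [← sq_abs]; exact pow_le_pow_left₀ (abs_nonneg _) (h i) 2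
    _ = n * δ ^ 2 := by simp

variable {a b : ℝ}

/-- The value and the slope of a link at `a` are controlled by its empirical norm, because the
empirical second moments of linear functions are bounded from below. -/
theorem coef_le {κ M J c A' : ℝ} {g : ℝ → ℝ} {n : ℕ} {t M₀ : Fin n → ℝ} (hn : 0 < n) (hab : a ≤ b)
    (hM : 0 ≤ M) (hJ : 0 ≤ J) (hg : IsLink J g) (ht : ∀ i, t i ∈ Set.Icc a b)
    (hM₀ : ∀ i, |M₀ i| ≤ M)
    (hlin : κ * n * (c ^ 2 + g a ^ 2) ≤ 16 * ∑ i, (c + g a * (t i - a)) ^ 2)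
    (hA' : Real.sqrt (∑ i, (prim a c g (t i) - M₀ i) ^ 2) ≤ Real.sqrt n * A') :
    Real.sqrt κ * Real.sqrt (c ^ 2 + g a ^ 2) ≤
      4 * (A' + (M + J * ((b - a) * Real.sqrt (b - a)))) := by
  have hn' : (0 : ℝ) < n := by exact_mod_cast hn
  have hsn : 0 < Real.sqrt n := Real.sqrt_pos.2 hn'
  have hL : 0 ≤ b - a := by linarith
  have hr : ∀ i, |(prim a c g (t i) - M₀ i) - (c + g a * (t i - a))| ≤
      M + J * ((b - a) * Real.sqrt (b - a)) := by
    intro i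
    have h1 := prim_taylor_abs_le hg.cont (a := a) (c := c) (B := J * Real.sqrt (b - a)) (ht i).1
      (fun u hu => (hg.abs_sub_le hJ hu.1).trans (by
        gcongr; exact hu.2.trans (ht i).2))
    rw [prim_self] at h1
    have h2 : (t i - a) * (J * Real.sqrt (b - a)) ≤ (b - a) * (J * Real.sqrt (b - a)) := by
      gcongr
      exact (ht i).2
    have h3 : (prim a c g (t i) - M₀ i) - (c + g a * (t i - a)) =
        (prim a c g (t i) - c - g a * (t i - a)) - M₀ i := by ring
    rw [h3]
    refine (abs_sub _ _).trans ?_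
    have := hM₀ i
    nlinarith
  have h1 := sqrt_sum_sq_le_of_abs_sub_le (by positivity) hr
  have h2 : Real.sqrt (κ * n * (c ^ 2 + g a ^ 2)) ≤
      4 * Real.sqrt (∑ i, (c + g a * (t i - a)) ^ 2) := by
    calc _ ≤ Real.sqrt (4 ^ 2 * ∑ i, (c + g a * (t i - a)) ^ 2) :=
          Real.sqrt_le_sqrt (by norm_num; exact hlin)
      _ = _ := by rw [Real.sqrt_mul (by norm_num), Real.sqrt_sq (by norm_num)]
  rw [mul_comm κ, mul_assoc, Real.sqrt_mul hn'.le, Real.sqrt_mul' _ (by positivity)] at h2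
  have h3 : Real.sqrt n * (Real.sqrt κ * Real.sqrt (c ^ 2 + g a ^ 2)) ≤
      Real.sqrt n * (4 * (A' + (M + J * ((b - a) * Real.sqrt (b - a))))) := by linarith
  exact le_of_mul_le_mul_left h3 hsn

/-- The rates: with `u = n^{1/5}` and a number `N` of cells of order `u`, the noise terms are of
order `u⁻²` times the error and `u⁻⁴` times the roughness. -/
theorem noise_rate_le {σ L u : ℝ} {n N : ℕ} (hσ : 0 ≤ σ) (hL : 0 ≤ L) (hu : 1 ≤ u) (hn : u ^ 5 = n)
    (hN1 : u ≤ N) (hN2 : N ≤ 2 * u) :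
    Real.sqrt (32 * σ * N) * Real.sqrt n ≤ n * (8 * Real.sqrt σ * (1 / u ^ 2)) ∧
    Real.sqrt (σ * n) * ((2 * L / N) * Real.sqrt (2 * L / N)) ≤
      n * (Real.sqrt (8 * σ * L ^ 3) * (1 / u ^ 2) ^ 2) := by
  have hu0 : 0 < u := by linarith
  have hN0 : (0 : ℝ) < N := by linarith
  have hn0 : (0 : ℝ) ≤ n := Nat.cast_nonneg n
  constructor
  · rw [← Real.sqrt_mul (by positivity), Real.sqrt_le_left (by positivity)]
    have : (n * (8 * Real.sqrt σ * (1 / u ^ 2))) ^ 2 = 64 * σ * (n ^ 2 / u ^ 4) := by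
      rw [mul_pow, mul_pow, mul_pow, Real.sq_sqrt hσ]; field_simp; ring
    rw [this]
    have h2 : (n : ℝ) ^ 2 / u ^ 4 = u * n := by
      rw [← hn]; field_simp
    rw [h2]
    calc 32 * σ * N * n ≤ 32 * σ * (2 * u) * n := by gcongr
      _ = _ := by ring
  · have h1 : (2 * L / N) * Real.sqrt (2 * L / N) = Real.sqrt ((2 * L / N) ^ 3) := by
      have h0 : 0 ≤ 2 * L / N := by positivity
      rw [show (2 * L / N) ^ 3 = (2 * L / N) ^ 2 * (2 * L / N) by ring, Real.sqrt_mul (by positivity),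
        Real.sqrt_sq h0]
    rw [h1, ← Real.sqrt_mul (by positivity), Real.sqrt_le_left (by positivity)]
    have h2 : (n * (Real.sqrt (8 * σ * L ^ 3) * (1 / u ^ 2) ^ 2)) ^ 2 =
        8 * σ * L ^ 3 * (n ^ 2 / u ^ 8) := by
      rw [mul_pow, mul_pow, Real.sq_sqrt (by positivity)]; field_simp
    have h3 : (n : ℝ) ^ 2 / u ^ 8 = n / u ^ 3 := by
      rw [← hn]; field_simp
    rw [h2, h3]
    calc σ * n * (2 * L / N) ^ 3 ≤ σ * n * (2 * L / u) ^ 3 := by gcongr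
      _ = _ := by field_simp; ring

/-- The bound for the size `ρ` of the coefficients, where the perturbation `δ` is absorbed in the left
side. -/
theorem le_mul_of_mul_le_add {q ρ A M J w x δ : ℝ} (hq : 0 < q) (hA : 0 ≤ A) (hM : 0 ≤ M)
    (hJ : 0 ≤ J) (hw : 0 ≤ w) (hx : 0 ≤ x) (h1 : q * ρ ≤ 4 * (A + δ + (M + J * x)))
    (h2 : 8 * δ ≤ q * (ρ + J * w)) : ρ ≤ (8 / q * (1 + M + x) + w) * (A + 1 + J) := by
  have h4 : ρ ≤ 8 / q * (A + M + J * x) + J * w := by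
    have : 8 / q * (A + M + J * x) + J * w = (8 * (A + M + J * x) + q * (J * w)) / q := by
      field_simp
    rw [this, le_div_iff₀ hq]
    linarith
  have h5 : A + M + J * x ≤ (1 + M + x) * (A + 1 + J) := by
    nlinarith [mul_nonneg hM hA, mul_nonneg hM hJ, mul_nonneg hx hA]
  have h6 : J * w ≤ w * (A + 1 + J) := by nlinarith [mul_nonneg hw hA]
  have h7 : 8 / q * (A + M + J * x) ≤ 8 / q * ((1 + M + x) * (A + 1 + J)) := by gcongr
  linarith

/-- Consequences of the basic inequality for one sample. The noise is controlled at the indices `t'`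
from the net, the criterion is compared at the estimated indices `t`, at distance `B / n`. Let `A` be
the empirical error at `t` and `k = u⁻² = n^{-2/5}`. The cross term is of order
`k A + k² (J + G)`, where `G` bounds the slopes; the slopes are at most of order `A + 1 + J`, since
linear functions are controlled by their empirical norm. As `k = O(l)`, the inequality bounds both
`A / l` and `J`. -/
theorem exists_basic_bound (hab : a ≤ b) {σ κ B M J₀ K : ℝ} (hσ : 0 < σ) (hκ : 0 < κ) (hB : 0 ≤ B)
    (hM : 0 ≤ M) : ∃ C : ℝ, 0 ≤ C ∧ ∀ (n N : ℕ) (u l : ℝ), 1 ≤ u → u ^ 5 = n →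
      u ≤ N → N ≤ 2 * u → 8 * B * (1 / u ^ 2) ≤ Real.sqrt κ → 0 < l → l ≤ 1 →
      1 / u ^ 2 ≤ K * l → ∀ (e M₀ t t' : Fin n → ℝ) (c J : ℝ) (g : ℝ → ℝ), 0 ≤ J → IsLink J g →
      (∀ i, t i ∈ Set.Icc a b) → (∀ i, t' i ∈ Set.Icc a b) → (∀ i, |t i - t' i| ≤ B / n) →
      (∀ i, |M₀ i| ≤ M) →
      (|∑ i, e i * (prim a c g (t' i) - M₀ i)| ≤
        Real.sqrt (32 * σ * N) * Real.sqrt (∑ i, (prim a c g (t' i) - M₀ i) ^ 2) +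
        25 * Real.sqrt (σ * n) *
          ((2 * (b + 1 - a) / N) * Real.sqrt (2 * (b + 1 - a) / N)) * J) →
      (κ * n * (c ^ 2 + g a ^ 2) ≤ 16 * ∑ i, (c + g a * (t' i - a)) ^ 2) →
      (∑ i, e i ^ 2 ≤ 16 * σ * n) →
      (∑ i, (e i - (prim a c g (t i) - M₀ i)) ^ 2 + n * (l ^ 2 * J ^ 2) ≤
        ∑ i, e i ^ 2 + n * (l ^ 2 * J₀ ^ 2)) →
      ∑ i, (prim a c g (t' i) - M₀ i) ^ 2 ≤ n * (C * l ^ 2) ∧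
        J ≤ C ∧ |c| ≤ C ∧ |g a| ≤ C := by
  obtain ⟨s, hs⟩ : ∃ s, s = Real.sqrt σ := ⟨_, rfl⟩
  obtain ⟨q, hq⟩ : ∃ q, q = Real.sqrt κ := ⟨_, rfl⟩
  have hs0 : 0 < s := hs ▸ Real.sqrt_pos.2 hσ
  have hq0 : 0 < q := hq ▸ Real.sqrt_pos.2 hκ
  obtain ⟨L, hL⟩ : ∃ L, L = b - a := ⟨_, rfl⟩
  have hL0 : 0 ≤ L := by linarith
  obtain ⟨w, hw⟩ : ∃ w, w = Real.sqrt L := ⟨_, rfl⟩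
  have hw0 : 0 ≤ w := hw ▸ Real.sqrt_nonneg _
  obtain ⟨D, hD⟩ : ∃ D, D = Real.sqrt (8 * σ * (b + 1 - a) ^ 3) := ⟨_, rfl⟩
  have hD0 : 0 ≤ D := hD ▸ Real.sqrt_nonneg _
  obtain ⟨Cρ, hCρ⟩ : ∃ Cρ, Cρ = 8 / q * (1 + M + L * w) + w := ⟨_, rfl⟩
  have hCρ0 : 0 ≤ Cρ := by rw [hCρ]; positivity
  obtain ⟨c₁, hc₁⟩ : ∃ c₁, c₁ = 2 * (8 * s + 8 * s * B + 25 * D + 4 * s * B) := ⟨_, rfl⟩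
  have hc₁0 : 0 ≤ c₁ := by rw [hc₁]; positivity
  obtain ⟨c₂, hc₂⟩ : ∃ c₂, c₂ = Cρ + w := ⟨_, rfl⟩
  have hc₂0 : 0 ≤ c₂ := by rw [hc₂]; positivity
  obtain ⟨c₃, hc₃⟩ : ∃ c₃, c₃ = 2 * (c₁ ^ 2 + (c₁ * c₂) ^ 2 + c₁ * c₂) * K ^ 2 +
    (c₁ + c₁ * c₂) ^ 2 * K ^ 4 + 2 * J₀ ^ 2 := ⟨_, rfl⟩
  have hc₃0 : 0 ≤ c₃ := by rw [hc₃]; positivity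
  obtain ⟨r₃, hr₃⟩ : ∃ r₃, r₃ = Real.sqrt c₃ := ⟨_, rfl⟩
  have hsq3 : 0 ≤ r₃ := hr₃ ▸ Real.sqrt_nonneg _
  obtain ⟨E, hE⟩ : ∃ E, E = Cρ * (2 * r₃ + 1) := ⟨_, rfl⟩
  have hE0 : 0 ≤ E := by rw [hE]; positivity
  obtain ⟨C, hC⟩ : ∃ C, C = 2 * c₃ + 2 * ((c₂ * (2 * r₃ + 1)) * (B * K)) ^ 2 + r₃ + E := ⟨_, rfl⟩
  have hC0 : 0 ≤ C := by rw [hC]; positivity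
  refine ⟨C, hC0, ?_⟩
  intro n N u l hu hun hN1 hN2 hBu hl hl1 hKl e M₀ t t' c J g hJ hg ht ht' htt hM₀ hnoise hlin he hbas
  rw [← hq] at hBu
  have hu0 : 0 < u := by linarith
  have hn' : (0 : ℝ) < n := by rw [← hun]; positivity
  have hn : 0 < n := by exact_mod_cast hn'
  set k := 1 / u ^ 2 with hk
  have hk0 : 0 < k := by positivity
  have hk1 : k ≤ 1 := by
    rw [hk, div_le_one (by positivity)]; exact one_le_pow₀ hu
  have hkk : k ^ 2 ≤ k := pow_le_of_le_one hk0.le hk1 two_ne_zero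
  have hnk : 1 / (n : ℝ) ≤ k ^ 2 := by
    rw [← hun, hk, div_pow, one_pow, ← pow_mul]
    exact one_div_le_one_div_of_le (by positivity) (pow_le_pow_right₀ hu (by norm_num))
  set f : Fin n → ℝ := fun i => prim a c g (t i) - M₀ i with hf
  set f' : Fin n → ℝ := fun i => prim a c g (t' i) - M₀ i with hf'
  set G := |g a| + J * w with hG
  have hG0 : 0 ≤ G := by positivity
  set δ := G * (B / n) with hδ
  have hδ0 : 0 ≤ δ := by positivity
  have hBn : B / n ≤ B * k ^ 2 := by
    rw [div_eq_mul_one_div]; gcongr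
  have hδk : δ ≤ B * (k ^ 2 * G) := by
    calc δ ≤ G * (B * k ^ 2) := by rw [hδ]; gcongr
      _ = _ := by ring
  have hff : ∀ i, |f i - f' i| ≤ δ := by
    intro i
    simp only [hf, hf', sub_sub_sub_cancel_right]
    exact (prim_abs_sub_le hg.cont (G := G)
      (fun v hv => (hg.abs_le hJ hv).trans (by rw [hG, hw, hL])) (ht' i) (ht i)).trans
      (mul_le_mul_of_nonneg_left (htt i) hG0)
  set sn := Real.sqrt n with hsn
  have hsn0 : 0 < sn := Real.sqrt_pos.2 hn'
  have hsn2 : sn * sn = n := Real.mul_self_sqrt hn'.le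
  set A := Real.sqrt (∑ i, f i ^ 2) / sn with hA
  have hA0 : 0 ≤ A := by positivity
  have hAeq : Real.sqrt (∑ i, f i ^ 2) = sn * A := by rw [hA]; field_simp
  have hA2 : ∑ i, f i ^ 2 = n * A ^ 2 := by
    have := Real.mul_self_sqrt (Finset.sum_nonneg fun i (_ : i ∈ Finset.univ) => sq_nonneg (f i))
    rw [hAeq] at this
    rw [← this, ← hsn2]; ring
  have hA' : Real.sqrt (∑ i, f' i ^ 2) ≤ sn * (A + δ) := by
    rw [mul_add, ← hAeq]
    exact sqrt_sum_sq_le_of_abs_sub_le hδ0 hff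
  clear_value A
  -- the value and the slope at `a`
  set ρ := Real.sqrt (c ^ 2 + g a ^ 2) with hρ
  have hcρ : |c| ≤ ρ := Real.abs_le_sqrt (le_add_of_nonneg_right (sq_nonneg _))
  have hgρ : |g a| ≤ ρ := Real.abs_le_sqrt (le_add_of_nonneg_left (sq_nonneg _))
  have hρbound : ρ ≤ Cρ * (A + 1 + J) := by
    have h1 := coef_le hn hab hM hJ hg ht' hM₀ hlin hA'
    rw [← hL, ← hw, ← hq, ← hρ] at h1
    have h2 : 8 * δ ≤ q * (ρ + J * w) := by
      calc 8 * δ ≤ 8 * (B * (k ^ 2 * G)) := by gcongr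
        _ ≤ 8 * (B * (k * G)) := by
            gcongr
        _ = (8 * B * k) * G := by ring
        _ ≤ q * (ρ + J * w) := by
            rw [hG]; gcongr
    rw [hCρ]
    exact le_mul_of_mul_le_add hq0 hA0 hM hJ hw0 (by positivity) h1 h2
  have hGbound : G ≤ c₂ * (A + 1 + J) := by
    calc G ≤ Cρ * (A + 1 + J) + w * (A + 1 + J) := by
          rw [hG]
          refine add_le_add (hgρ.trans hρbound) ?_
          rw [mul_comm]
          gcongr
          linarith
      _ = _ := by rw [hc₂]; ring
  -- the basic inequality
  have hcross : ∑ i, e i * f i ≤ n * (8 * s * k * (A + δ) + 25 * D * (k ^ 2 * J) + 4 * s * δ) := by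
    obtain ⟨r1, r2⟩ := noise_rate_le (σ := σ) (L := b + 1 - a) hσ.le (by linarith) hu hun hN1 hN2
    rw [← hs] at r1
    rw [← hD] at r2
    have h1 : ∑ i, e i * f i = ∑ i, e i * f' i + ∑ i, e i * (f i - f' i) := by
      rw [← Finset.sum_add_distrib]
      exact Finset.sum_congr rfl fun i _ => by ring
    have h2 : ∑ i, e i * (f i - f' i) ≤ n * (4 * s * δ) := by
      have hcs := Real.sum_mul_le_sqrt_mul_sqrt Finset.univ e fun i => f i - f' i
      have h3 : Real.sqrt (∑ i, e i ^ 2) ≤ 4 * s * sn := by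
        calc _ ≤ Real.sqrt (4 ^ 2 * (σ * n)) := Real.sqrt_le_sqrt (by linarith)
          _ = _ := by
            rw [Real.sqrt_mul (by norm_num), Real.sqrt_sq (by norm_num), Real.sqrt_mul hσ.le, ← hs, ← hsn]
            ring
      have h4 : Real.sqrt (∑ i, (f i - f' i) ^ 2) ≤ sn * δ := by
        rw [Real.sqrt_le_left (by positivity), mul_pow, Real.sq_sqrt hn'.le]
        calc ∑ i, (f i - f' i) ^ 2 ≤ ∑ _i : Fin n, δ ^ 2 := Finset.sum_le_sum fun i _ => by
              rw [← sq_abs]; exact pow_le_pow_left₀ (abs_nonneg _) (hff i) 2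
          _ = n * δ ^ 2 := by simp
      calc _ ≤ _ := hcs
        _ ≤ (4 * s * sn) * (sn * δ) := by gcongr
        _ = (sn * sn) * (4 * s * δ) := by ring
        _ = _ := by rw [hsn2]
    have h5 : ∑ i, e i * f' i ≤ n * (8 * s * k * (A + δ)) + n * (25 * D * (k ^ 2 * J)) := by
      refine (le_abs_self _).trans (hnoise.trans (add_le_add ?_ ?_))
      · calc _ ≤ Real.sqrt (32 * σ * N) * (sn * (A + δ)) := by gcongr
          _ = Real.sqrt (32 * σ * N) * sn * (A + δ) := by ring
          _ ≤ n * (8 * s * k) * (A + δ) := by gcongr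
          _ = _ := by ring
      · calc _ = 25 * (Real.sqrt (σ * n) *
              ((2 * (b + 1 - a) / N) * Real.sqrt (2 * (b + 1 - a) / N))) * J := by ring
          _ ≤ 25 * (n * (D * k ^ 2)) * J := by gcongr
          _ = _ := by ring
    rw [h1]
    linarith
  have hquad : A ^ 2 + l ^ 2 * J ^ 2 ≤ c₁ * (k * A + k ^ 2 * J + k ^ 2 * G) + l ^ 2 * J₀ ^ 2 := by
    have h1 : ∑ i, (e i - f i) ^ 2 = ∑ i, e i ^ 2 - 2 * ∑ i, e i * f i + ∑ i, f i ^ 2 := by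
      rw [Finset.mul_sum, ← Finset.sum_sub_distrib, ← Finset.sum_add_distrib]
      exact Finset.sum_congr rfl fun i _ => by ring
    have h2 : ∑ i, (e i - f i) ^ 2 + n * (l ^ 2 * J ^ 2) ≤
        ∑ i, e i ^ 2 + n * (l ^ 2 * J₀ ^ 2) := hbas
    rw [h1, hA2] at h2
    have h3 : n * (A ^ 2 + l ^ 2 * J ^ 2) ≤ n * (2 * (8 * s * k * (A + δ) + 25 * D * (k ^ 2 * J) +
        4 * s * δ) + l ^ 2 * J₀ ^ 2) := by linarith
    have h4 := le_of_mul_le_mul_left h3 hn'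
    refine h4.trans (add_le_add ?_ le_rfl)
    have h5 : s * k * δ ≤ s * (B * (k ^ 2 * G)) := by
      calc s * k * δ ≤ s * 1 * δ := by gcongr
        _ ≤ s * (B * (k ^ 2 * G)) := by rw [mul_one]; gcongr
    have h6 : s * δ ≤ s * (B * (k ^ 2 * G)) := by gcongr
    have p1 : 0 ≤ (s * B + D) * (k * A) := by positivity
    have p2 : 0 ≤ (s + s * B) * (k ^ 2 * J) := by positivity
    have p3 : 0 ≤ (s + D) * (k ^ 2 * G) := by positivity
    have e1 : c₁ * (k * A + k ^ 2 * J + k ^ 2 * G) =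
        16 * (s * k * A) + 50 * (D * (k ^ 2 * J)) + 24 * (s * (B * (k ^ 2 * G))) +
        (24 * (s * B * (k * A)) + 50 * (D * (k * A))) +
        (16 * (s * (k ^ 2 * J)) + 24 * (s * B * (k ^ 2 * J))) +
        (16 * (s * (k ^ 2 * G)) + 50 * (D * (k ^ 2 * G))) := by rw [hc₁]; ring
    have q1 : 0 ≤ s * B * (k * A) := by positivity
    have q2 : 0 ≤ D * (k * A) := by positivity
    have q3 : 0 ≤ s * (k ^ 2 * J) := by positivity
    have q4 : 0 ≤ s * B * (k ^ 2 * J) := by positivity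
    have q5 : 0 ≤ s * (k ^ 2 * G) := by positivity
    have q6 : 0 ≤ D * (k ^ 2 * G) := by positivity
    rw [e1]
    linarith
  have hfin := sq_add_sq_le_of_le hA0 hJ hk0.le hk1 hc₁0 hc₂0 hKl hquad hGbound
  rw [← hc₃] at hfin
  have hl2 : 0 < l ^ 2 := by positivity
  have hJc : J ≤ r₃ := by
    rw [hr₃]
    apply Real.le_sqrt_of_sq_le
    have : l ^ 2 * J ^ 2 ≤ l ^ 2 * c₃ := by linarith [sq_nonneg A]
    exact le_of_mul_le_mul_left this hl2
  have hAl : A ^ 2 ≤ c₃ * l ^ 2 := by linarith [mul_nonneg hl2.le (sq_nonneg J)]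
  have hAc : A ≤ r₃ := by
    rw [hr₃]
    apply Real.le_sqrt_of_sq_le
    exact hAl.trans (mul_le_of_le_one_right hc₃0 (pow_le_one₀ hl.le hl1))
  have hρE : ρ ≤ E := hρbound.trans
    (by rw [hE]; exact mul_le_mul_of_nonneg_left (by linarith) hCρ0)
  have hGE : G ≤ c₂ * (2 * r₃ + 1) := hGbound.trans
    (mul_le_mul_of_nonneg_left (by linarith) hc₂0)
  have hT0 : 0 ≤ ((c₂ * (2 * r₃ + 1)) * (B * K)) ^ 2 := sq_nonneg _
  refine ⟨?_, by linarith, by linarith, by linarith⟩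
  have h1 : ∑ i, f' i ^ 2 ≤ n * (A + δ) ^ 2 := by
    have h2 := pow_le_pow_left₀ (Real.sqrt_nonneg _) hA' 2
    rwa [Real.sq_sqrt (Finset.sum_nonneg fun i _ => sq_nonneg _), mul_pow, Real.sq_sqrt hn'.le] at h2
  refine h1.trans (mul_le_mul_of_nonneg_left ?_ hn'.le)
  have h2 : δ ≤ (c₂ * (2 * r₃ + 1)) * (B * K) * l := by
    calc δ ≤ B * (k ^ 2 * G) := hδk
      _ ≤ B * (k * G) := by
          gcongr
      _ ≤ B * ((K * l) * (c₂ * (2 * r₃ + 1))) := by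
          have := hk0.le.trans hKl
          gcongr
      _ = _ := by ring
  have h3 : δ ^ 2 ≤ ((c₂ * (2 * r₃ + 1)) * (B * K)) ^ 2 * l ^ 2 := by
    rw [← mul_pow]; exact pow_le_pow_left₀ hδ0 h2 2
  have h4 : 0 ≤ (r₃ + E) * l ^ 2 := by positivity
  have h5 : C * l ^ 2 = 2 * (c₃ * l ^ 2) +
      2 * (((c₂ * (2 * r₃ + 1)) * (B * K)) ^ 2 * l ^ 2) +
      (r₃ + E) * l ^ 2 := by rw [hC]; ring
  have h6 : (A + δ) ^ 2 ≤ 2 * A ^ 2 + 2 * δ ^ 2 := by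
    have := sq_nonneg (A - δ)
    linarith [this, add_sq A δ, sub_sq A δ]
  linarith

end

section

/-! ### The rate of convergence on a good sample -/

variable {d : ℕ} {a b : ℝ}

/-- With `u = n^{1/5}` cells the remainder of the norm comparison is of order `u⁻⁴`. -/
theorem norm_rate_le {u : ℝ} {n N : ℕ} (hu : 1 ≤ u) (hn : u ^ 5 = n) (hN1 : u ≤ N)
    (hN2 : N ≤ 2 * u) : (n : ℝ) / N ^ 4 + N ≤ n * (3 * (1 / u ^ 2) ^ 2) := by
  have hu0 : 0 < u := by linarith
  have h1 : (n : ℝ) / N ^ 4 ≤ n / u ^ 4 := by gcongr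
  have h2 : (n : ℝ) / u ^ 4 = u := by rw [← hn]; field_simp
  have h3 : (n : ℝ) * (3 * (1 / u ^ 2) ^ 2) = 3 * u := by rw [← hn]; field_simp
  linarith

theorem measurable_prim_inner {g : ℝ → ℝ} (hg : Continuous g) (a c : ℝ)
    (θ : EuclideanSpace ℝ (Fin d)) : Measurable fun x => prim a c g (inner ℝ θ x) :=
  (continuous_prim hg a c).measurable.comp (by fun_prop)

variable [NeZero d]

/-- The empirical bound for a nearby index `θ'` from the net, the norm comparison and the Lipschitz
continuity of the link give the population bound for `θ`. -/
theorem integral_sq_le_of_norm {PX : Measure (EuclideanSpace ℝ (Fin d))} [IsProbabilityMeasure PX]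
    {θ θ' θ₀ : EuclideanSpace ℝ (Fin d)} {R B δ E : ℝ} (hR : 0 ≤ R)
    (hI : ∀ᵐ x ∂PX, ∀ θ ∈ Theta d, (inner ℝ θ x : ℝ) ∈ Set.Icc a b)
    (hB : ∀ᵐ x ∂PX, ‖x‖ ≤ B) (hθ : θ ∈ Theta d) (hθ' : θ' ∈ Theta d)
    (hθ₀ : θ₀ ∈ Theta d)
    (hδ : ‖θ - θ'‖ ≤ δ) {p : ℝ × (ℝ → ℝ)} (hp : p ∈ linkBall a R) {c₀ : ℝ} {g₀ : ℝ → ℝ}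
    (hg₀ : Continuous g₀) (hM : ∀ t ∈ Set.Icc a b, |prim a c₀ g₀ t| ≤ R)
    (hE : ∫ x, (prim a p.1 p.2 (inner ℝ θ' x) - prim a c₀ g₀ (inner ℝ θ₀ x)) ^ 2 ∂PX ≤ E) :
    ∫ x, (prim a p.1 p.2 (inner ℝ θ x) - prim a c₀ g₀ (inner ℝ θ₀ x)) ^ 2 ∂PX ≤
      2 * E + 2 * ((R + R * Real.sqrt (b - a)) * (B * δ)) ^ 2 := by
  set M := R + (R + R * Real.sqrt (b - a)) * (b - a) with hMdef
  have hlink := hp.2.2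
  have hm : AEStronglyMeasurable (fun x => (prim a p.1 p.2 (inner ℝ θ' x) -
      prim a c₀ g₀ (inner ℝ θ₀ x)) ^ 2) PX :=
    (((measurable_prim_inner hlink.cont a p.1 θ').sub
      (measurable_prim_inner hg₀ a c₀ θ₀)).pow_const 2).aestronglyMeasurable
  have hint : Integrable (fun x => (prim a p.1 p.2 (inner ℝ θ' x) -
      prim a c₀ g₀ (inner ℝ θ₀ x)) ^ 2) PX := by
    refine Integrable.of_bound hm ((M + R) ^ 2) ?_
    filter_upwards [hI] with x hx
    rw [Real.norm_eq_abs, abs_pow]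
    refine pow_le_pow_left₀ (abs_nonneg _) ((abs_sub _ _).trans (add_le_add ?_ ?_)) 2
    · exact abs_prim_le hR hp (hx θ' hθ')
    · exact hM _ (hx θ₀ hθ₀)
  set D := (R + R * Real.sqrt (b - a)) * (B * δ) with hD
  have hpt : ∀ᵐ x ∂PX, (prim a p.1 p.2 (inner ℝ θ x) - prim a c₀ g₀ (inner ℝ θ₀ x)) ^ 2 ≤
      2 * (prim a p.1 p.2 (inner ℝ θ' x) - prim a c₀ g₀ (inner ℝ θ₀ x)) ^ 2 + 2 * D ^ 2 := by
    filter_upwards [hI, hB] with x hx hxB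
    have h1 : |prim a p.1 p.2 (inner ℝ θ x) - prim a p.1 p.2 (inner ℝ θ' x)| ≤ D := by
      refine (prim_abs_sub_le hlink.cont (G := R + R * Real.sqrt (b - a)) (fun u hu =>
        (hlink.abs_le hR hu).trans (by linarith [hp.2.1])) (hx θ' hθ') (hx θ hθ)).trans ?_
      rw [hD]
      refine mul_le_mul_of_nonneg_left ?_ (by positivity)
      rw [← inner_sub_left, mul_comm B]
      exact (abs_real_inner_le_norm _ _).trans
        (mul_le_mul hδ hxB (norm_nonneg _) ((norm_nonneg _).trans hδ))
    have h2 := sq_le_sq' (abs_le.1 h1).1 (abs_le.1 h1).2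
    nlinarith [sq_nonneg ((prim a p.1 p.2 (inner ℝ θ x) - prim a p.1 p.2 (inner ℝ θ' x)) -
      (prim a p.1 p.2 (inner ℝ θ' x) - prim a c₀ g₀ (inner ℝ θ₀ x)))]
  have hint2 : Integrable (fun x => 2 * (prim a p.1 p.2 (inner ℝ θ' x) -
      prim a c₀ g₀ (inner ℝ θ₀ x)) ^ 2) PX := hint.const_mul 2
  calc _ ≤ ∫ x, (2 * (prim a p.1 p.2 (inner ℝ θ' x) - prim a c₀ g₀ (inner ℝ θ₀ x)) ^ 2 +
        2 * D ^ 2) ∂PX :=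
        integral_mono_of_nonneg (ae_of_all _ fun x => sq_nonneg _)
          (hint2.add (integrable_const _)) hpt
    _ = 2 * (∫ x, (prim a p.1 p.2 (inner ℝ θ' x) - prim a c₀ g₀ (inner ℝ θ₀ x)) ^ 2 ∂PX) +
        2 * D ^ 2 := by
        rw [integral_add hint2 (integrable_const _), integral_const_mul (2 : ℝ)]
        simp
    _ ≤ _ := by linarith

/-- On a good sample any solution of the basic inequality has the rate of the smoothing
parameter. -/
theorem exists_rate_of_isGoodSample (hab : a < b)
    {PX : Measure (EuclideanSpace ℝ (Fin d))} [IsProbabilityMeasure PX]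
    {θ₀ : EuclideanSpace ℝ (Fin d)} (hθ₀ : θ₀ ∈ Theta d) (hpos : 0 < θ₀ 0)
    (hnd : IndexNondeg PX θ₀) (hnull : NullOnLines PX)
    (hI : ∀ᵐ x ∂PX, ∀ θ ∈ Theta d, (inner ℝ θ x : ℝ) ∈ Set.Icc a b)
    {B : ℝ} (hB0 : 0 ≤ B) (hB : ∀ᵐ x ∂PX, ‖x‖ ≤ B)
    {c₀ : ℝ} {g₀ : ℝ → ℝ} (hg₀ : Continuous g₀) (hne : ¬ ∀ᵐ x ∂PX, g₀ (inner ℝ θ₀ x) = 0)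
    {σ κ J₀ K : ℝ} (hσ : 0 < σ) (hκ : 0 < κ) :
    ∃ R : ℝ, 0 ≤ R ∧ (∀ x, |prim a c₀ g₀ (clampIndex a b θ₀ x)| ≤ R) ∧
      ∀ C : ℝ, 0 ≤ C → ∃ C' : ℝ, 0 ≤ C' ∧
      ∀ μ : Measure (EuclideanSpace ℝ (Fin d) × ℝ), μ.map Prod.fst = PX →
      ∀ (n N : ℕ) (u l : ℝ), 1 ≤ u → u ^ 5 = n → u ≤ N → N ≤ 2 * u →
      8 * (d * B) * (1 / u ^ 2) ≤ Real.sqrt κ → 0 < l → l ≤ 1 → 1 / u ^ 2 ≤ K * l →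
      ∀ z : Fin n → EuclideanSpace ℝ (Fin d) × ℝ,
      (∀ i, ‖(z i).1‖ ≤ B) → (∀ i, ∀ θ ∈ Theta d, (inner ℝ θ (z i).1 : ℝ) ∈ Set.Icc a b) →
      (∑ i, (z i).2 ^ 2 ≤ 16 * σ * n) →
      (∀ θ ∈ Theta d, ∃ θ' ∈ Theta d, ‖θ - θ'‖ ≤ d / n ∧
        IsGoodSample a (b + 1) σ κ R C (fun x => prim a c₀ g₀ (clampIndex a b θ₀ x))
          (clampIndex a b θ') μ N z) →
      ∀ θ ∈ Theta d, ∀ (c J : ℝ) (g : ℝ → ℝ), 0 ≤ J → IsLink J g → Monotone g →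
      (∑ i, ((z i).2 - (prim a c g (inner ℝ θ (z i).1) -
          prim a c₀ g₀ (inner ℝ θ₀ (z i).1))) ^ 2 + n * (l ^ 2 * J ^ 2) ≤
        ∑ i, (z i).2 ^ 2 + n * (l ^ 2 * J₀ ^ 2)) →
      ‖θ - θ₀‖ ≤ C' * l ∧
      Real.sqrt (∫ x, (prim a c g (inner ℝ θ₀ x) - prim a c₀ g₀ (inner ℝ θ₀ x)) ^ 2 ∂PX) ≤
        C' * l := by
  obtain ⟨M, hM⟩ := isCompact_Icc.exists_bound_of_continuousOn (f := prim a c₀ g₀)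
    (continuous_prim hg₀ a c₀).continuousOn (s := Set.Icc a b)
  have hM0 : 0 ≤ M := (norm_nonneg _).trans (hM a (Set.left_mem_Icc.2 hab.le))
  simp only [Real.norm_eq_abs] at hM
  have hdB : 0 ≤ d * B := by positivity
  obtain ⟨C₁, hC₁, hbasic⟩ := exists_basic_bound (J₀ := J₀) (K := K) hab.le hσ hκ hdB hM0
  set R := max C₁ M with hRdef
  have hR : 0 ≤ R := hC₁.trans (le_max_left _ _)
  have hM₀ : ∀ x, |prim a c₀ g₀ (clampIndex a b θ₀ x)| ≤ R := fun x =>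
    (hM _ (clampIndex_mem hab.le θ₀ x)).trans (le_max_right _ _)
  refine ⟨R, hR, hM₀, fun C hC => ?_⟩
  obtain ⟨Cs, hCs, hstab⟩ := exists_stability hab hR hθ₀ hpos hnd hnull hI hB (c₀ := c₀) hg₀ hne
  set G := R + R * Real.sqrt (b - a) with hG
  have hG0 : 0 ≤ G := by positivity
  set E := 8 * C₁ + 3 * C * K ^ 2 with hE
  have hE0 : 0 ≤ E := by positivity
  set E' := 2 * E + 2 * (G * (d * B) * K) ^ 2 with hE'
  have hE'0 : 0 ≤ E' := by positivity
  refine ⟨Real.sqrt (Cs * E'), Real.sqrt_nonneg _, ?_⟩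
  intro μ hμ n N u l hu hun hN1 hN2 hBu hl hl1 hKl z hzB hzI he hgood θ hθ c J g hJ hg hmono hbas
  have hu0 : 0 < u := by linarith
  have hn' : (0 : ℝ) < n := by rw [← hun]; positivity
  obtain ⟨θ', hθ', hd, hgs⟩ := hgood θ hθ
  have hcl : ∀ θ ∈ Theta d, ∀ i, clampIndex a b θ (z i).1 = inner ℝ θ (z i).1 :=
    fun θ hθ i => clampIndex_eq (hzI i θ hθ)
  have hnoise := hgs.noise J c g hJ hg
  have hlin := hgs.linear c (g a)
  simp only [hcl θ' hθ', hcl θ₀ hθ₀] at hnoise hlin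
  obtain ⟨hb1, hb2, hb3, hb4⟩ := hbasic n N u l hu hun hN1 hN2 hBu hl hl1 hKl (fun i => (z i).2)
    (fun i => prim a c₀ g₀ (inner ℝ θ₀ (z i).1)) (fun i => inner ℝ θ (z i).1)
    (fun i => inner ℝ θ' (z i).1) c J g hJ hg (fun i => hzI i θ hθ) (fun i => hzI i θ' hθ')
    (fun i => by
      rw [← inner_sub_left]
      refine (abs_real_inner_le_norm _ _).trans ?_
      calc ‖θ - θ'‖ * ‖(z i).1‖ ≤ d / n * B := by gcongr; exact hzB i
        _ = _ := by ring)
    (fun i => hM _ (hzI i θ₀ hθ₀)) hnoise hlin he hbas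
  have hC₁R : C₁ ≤ R := le_max_left _ _
  have hp : ((c, g) : ℝ × (ℝ → ℝ)) ∈ linkBall a R :=
    ⟨hb3.trans hC₁R, hb4.trans hC₁R, hg.mono hJ (hb2.trans hC₁R)⟩
  have hnorm := hgs.norm (c, g) hp
  simp only [hcl θ' hθ', hcl θ₀ hθ₀] at hnorm
  have hk : (1 / u ^ 2) ^ 2 ≤ K ^ 2 * l ^ 2 := by
    rw [← mul_pow]; exact pow_le_pow_left₀ (by positivity) hKl 2
  have hint : ∫ x, (prim a c g (inner ℝ θ' x) - prim a c₀ g₀ (inner ℝ θ₀ x)) ^ 2 ∂PX ≤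
      E * l ^ 2 := by
    have h1 : ∫ x, (prim a c g (inner ℝ θ' x) - prim a c₀ g₀ (inner ℝ θ₀ x)) ^ 2 ∂PX =
        ∫ w, (prim a c g (clampIndex a b θ' w.1) - prim a c₀ g₀ (clampIndex a b θ₀ w.1)) ^ 2 ∂μ := by
      have hmeas : AEStronglyMeasurable (fun x => (prim a c g (clampIndex a b θ' x) -
          prim a c₀ g₀ (clampIndex a b θ₀ x)) ^ 2) (μ.map Prod.fst) :=
        ((((continuous_prim hg.cont a c).measurable.comp (measurable_clampIndex a b θ')).sub
          ((continuous_prim hg₀ a c₀).measurable.comp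
            (measurable_clampIndex a b θ₀))).pow_const 2).aestronglyMeasurable
      rw [← integral_map measurable_fst.aemeasurable hmeas, hμ]
      refine integral_congr_ae ?_
      filter_upwards [hI] with x hx
      simp only [clampIndex_eq (hx θ' hθ'), clampIndex_eq (hx θ₀ hθ₀)]
    rw [h1]
    refine le_of_mul_le_mul_left ?_ hn'
    refine hnorm.trans ?_
    have h2 : C * ((n : ℝ) / N ^ 4 + N) ≤ C * (n * (3 * (K ^ 2 * l ^ 2))) := by
      refine mul_le_mul_of_nonneg_left ((norm_rate_le hu hun hN1 hN2).trans ?_) hC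
      gcongr
    have h3 : n * (E * l ^ 2) = 8 * (n * (C₁ * l ^ 2)) + C * (n * (3 * (K ^ 2 * l ^ 2))) := by
      rw [hE]; ring
    rw [h3]
    linarith
  have hpred := integral_sq_le_of_norm hR hI hB hθ hθ' hθ₀ hd hp hg₀
    (fun t ht => (hM t ht).trans (le_max_right _ _)) hint
  have hnk : (1 : ℝ) / n ≤ K * l := by
    refine le_trans ?_ hKl
    rw [← hun]
    exact one_div_le_one_div_of_le (by positivity) (pow_le_pow_right₀ hu (by norm_num))
  have hpred' : ∫ x, (prim a c g (inner ℝ θ x) - prim a c₀ g₀ (inner ℝ θ₀ x)) ^ 2 ∂PX ≤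
      E' * l ^ 2 := by
    have h1 : (G * (B * (d / n))) ^ 2 ≤ (G * (d * B) * K * l) ^ 2 := by
      refine pow_le_pow_left₀ (by positivity) ?_ 2
      calc G * (B * (d / n)) = G * (d * B) * (1 / n) := by ring
        _ ≤ G * (d * B) * (K * l) := by gcongr
        _ = _ := by ring
    have h2 : E' * l ^ 2 = 2 * (E * l ^ 2) + 2 * (G * (d * B) * K * l) ^ 2 := by rw [hE']; ring
    rw [h2]
    linarith
  obtain ⟨hs1, hs2⟩ := hstab (c, g) hp hmono θ hθ
  have hfin : Cs * ∫ x, (prim a c g (inner ℝ θ x) - prim a c₀ g₀ (inner ℝ θ₀ x)) ^ 2 ∂PX ≤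
      (Real.sqrt (Cs * E') * l) ^ 2 := by
    rw [mul_pow, Real.sq_sqrt (by positivity), mul_assoc]
    gcongr
  constructor
  · exact le_of_sq_le_sq (hs1.trans hfin) (by positivity)
  · exact (Real.sqrt_le_left (by positivity)).2 (hs2.trans hfin)

/-! ### The penalized least squares estimator -/

/-- Comparing the estimator with the true parameters gives the basic inequality. -/
theorem IsPLSE.exists_prim (hab : a < b) {n : ℕ} (hn : 0 < n)
    {x : ℕ → EuclideanSpace ℝ (Fin d)} {y : ℕ → ℝ} {lam : ℝ} (hlam : lam ≠ 0) {m m₀ : ℝ → ℝ}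
    {θ θ₀ : EuclideanSpace ℝ (Fin d)} (h : IsPLSE (Set.Icc a b) n x y lam m θ)
    (hm₀ : m₀ ∈ LinkClass (Set.Icc a b)) (hr : roughnessSq (Set.Icc a b) m₀ < ∞)
    (hθ₀ : θ₀ ∈ Theta d) :
    ∃ (c J : ℝ) (g : ℝ → ℝ), 0 ≤ J ∧ IsLink J g ∧ Monotone g ∧
      (∀ t ∈ Set.Icc a b, m t = prim a c g t) ∧
      ∑ i : Fin n, (y i - m (inner ℝ θ (x i))) ^ 2 + n * (|lam| ^ 2 * J ^ 2) ≤
        ∑ i : Fin n, (y i - m₀ (inner ℝ θ₀ (x i))) ^ 2 +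
          n * (|lam| ^ 2 * Real.sqrt (roughnessSq (Set.Icc a b) m₀).toReal ^ 2) := by
  obtain ⟨hm, hθ, hmin⟩ := h
  have hn' : (0 : ℝ) < n := by exact_mod_cast hn
  have h1 := hmin m₀ hm₀ θ₀ hθ₀
  rw [penLoss, penLoss] at h1
  have hlam2 : 0 < lam ^ 2 := by positivity
  have hfin0 : ENNReal.ofReal (empLoss n x y m₀ θ₀) +
      ENNReal.ofReal (lam ^ 2) * roughnessSq (Set.Icc a b) m₀ < ∞ :=
    ENNReal.add_lt_top.2 ⟨ENNReal.ofReal_lt_top, ENNReal.mul_lt_top ENNReal.ofReal_lt_top hr⟩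
  have hfin : roughnessSq (Set.Icc a b) m < ∞ := by
    by_contra hcon
    rw [not_lt, top_le_iff] at hcon
    rw [hcon, ENNReal.mul_top (by simpa using hlam), add_top, top_le_iff] at h1
    exact hfin0.ne h1
  obtain ⟨c, g, hg, hmono, heq, -⟩ := exists_prim_of_mem_linkClass hab hm hfin
  refine ⟨c, _, g, Real.sqrt_nonneg _, hg, hmono, heq, ?_⟩
  have hemp : ∀ m θ, 0 ≤ empLoss n x y m θ := fun m θ =>
    mul_nonneg (by positivity) (Finset.sum_nonneg fun i _ => sq_nonneg _)
  have h2 := ENNReal.toReal_mono hfin0.ne h1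
  rw [ENNReal.toReal_add ENNReal.ofReal_ne_top
      (ENNReal.mul_ne_top ENNReal.ofReal_ne_top hfin.ne),
    ENNReal.toReal_add ENNReal.ofReal_ne_top (ENNReal.mul_ne_top ENNReal.ofReal_ne_top hr.ne),
    ENNReal.toReal_mul, ENNReal.toReal_mul, ENNReal.toReal_ofReal (hemp _ _),
    ENNReal.toReal_ofReal (hemp _ _), ENNReal.toReal_ofReal hlam2.le] at h2
  rw [Real.sq_sqrt ENNReal.toReal_nonneg, Real.sq_sqrt ENNReal.toReal_nonneg, sq_abs]
  have h3 := mul_le_mul_of_nonneg_left h2 hn'.le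
  have h4 : ∀ m θ, n * empLoss n x y m θ = ∑ i : Fin n, (y i - m (inner ℝ θ (x i))) ^ 2 := by
    intro m θ
    rw [empLoss, ← mul_assoc, mul_one_div_cancel hn'.ne', one_mul,
      Finset.sum_range fun i => (y i - m (inner ℝ θ (x i))) ^ 2]
  rwa [mul_add, mul_add, h4, h4] at h3

/-! ### Rates and limits -/

/-- The number of cells `N = ⌈n^{1/5}⌉`. -/
theorem ceil_rpow_bounds {n : ℕ} (hn : 1 ≤ n) :
    1 ≤ (n : ℝ) ^ (1 / 5 : ℝ) ∧ ((n : ℝ) ^ (1 / 5 : ℝ)) ^ 5 = n ∧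
      (n : ℝ) ^ (1 / 5 : ℝ) ≤ ⌈(n : ℝ) ^ (1 / 5 : ℝ)⌉₊ ∧
      (⌈(n : ℝ) ^ (1 / 5 : ℝ)⌉₊ : ℝ) ≤ 2 * (n : ℝ) ^ (1 / 5 : ℝ) := by
  have hn' : (1 : ℝ) ≤ n := by exact_mod_cast hn
  have h1 : 1 ≤ (n : ℝ) ^ (1 / 5 : ℝ) := Real.one_le_rpow hn' (by norm_num)
  refine ⟨h1, ?_, Nat.le_ceil _, ?_⟩
  · rw [← Real.rpow_natCast, ← Real.rpow_mul (by linarith)]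
    norm_num
  · have := Nat.ceil_lt_add_one (show 0 ≤ (n : ℝ) ^ (1 / 5 : ℝ) by linarith)
    linarith

theorem tendsto_rpow_fifth : Tendsto (fun n : ℕ => (n : ℝ) ^ (1 / 5 : ℝ)) atTop atTop :=
  (tendsto_rpow_atTop (by norm_num)).comp tendsto_natCast_atTop_atTop

/-- The exceptional probability is exponentially small in a power of `n`. -/
theorem tendsto_exp_bound (d : ℕ) : Tendsto (fun n : ℕ => Real.exp (-n) +
    (2 * n + 1) ^ d * ((3 * (⌈(n : ℝ) ^ (1 / 5 : ℝ)⌉₊ : ℝ) + 4) *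
      Real.exp (-(⌈(n : ℝ) ^ (1 / 5 : ℝ)⌉₊ : ℝ)))) atTop (𝓝 0) := by
  have hN : Tendsto (fun n : ℕ => (⌈(n : ℝ) ^ (1 / 5 : ℝ)⌉₊ : ℝ)) atTop atTop :=
    tendsto_atTop_mono (fun n => Nat.le_ceil _) tendsto_rpow_fifth
  have h1 : Tendsto (fun n : ℕ => Real.exp (-(n : ℝ))) atTop (𝓝 0) :=
    Real.tendsto_exp_neg_atTop_nhds_zero.comp tendsto_natCast_atTop_atTop
  have h2 := ((Real.tendsto_pow_mul_exp_neg_atTop_nhds_zero (5 * d + 1)).comp hN).const_mul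
    ((3 : ℝ) ^ d * 7)
  rw [mul_zero] at h2
  have h3 := h1.add h2
  rw [add_zero] at h3
  refine squeeze_zero' (Eventually.of_forall fun n => by positivity) ?_ h3
  filter_upwards [eventually_ge_atTop 1] with n hn
  obtain ⟨hu, hun, hN1, -⟩ := ceil_rpow_bounds hn
  have hn' : (1 : ℝ) ≤ n := by exact_mod_cast hn
  refine add_le_add le_rfl ?_
  simp only [Function.comp]
  set N : ℝ := (⌈(n : ℝ) ^ (1 / 5 : ℝ)⌉₊ : ℝ) with hNdef
  have hN1' : 1 ≤ N := hu.trans hN1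
  have hnN : (n : ℝ) ≤ N ^ 5 := by rw [← hun]; gcongr
  calc (2 * (n : ℝ) + 1) ^ d * ((3 * N + 4) * Real.exp (-N))
      ≤ (3 * N ^ 5) ^ d * ((7 * N) * Real.exp (-N)) := by
        gcongr
        · linarith
        · linarith
    _ = _ := by rw [mul_pow, ← pow_mul]; ring

/-- For large `n` the number of cells is small enough for the deviation bounds. -/
theorem eventually_rates {CL κ B : ℝ} (hCL : 0 ≤ CL) (hκ : 0 < κ) : ∀ᶠ n : ℕ in atTop,
    ⌈(n : ℝ) ^ (1 / 5 : ℝ)⌉₊ ^ 2 ≤ 2 * n ∧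
    CL * ((n : ℝ) / (⌈(n : ℝ) ^ (1 / 5 : ℝ)⌉₊ : ℝ) ^ 4 + (⌈(n : ℝ) ^ (1 / 5 : ℝ)⌉₊ : ℝ)) ≤
      κ * n / 2 ∧
    8 * B * (1 / ((n : ℝ) ^ (1 / 5 : ℝ)) ^ 2) ≤ Real.sqrt κ := by
  have hinv : Tendsto (fun n : ℕ => 1 / ((n : ℝ) ^ (1 / 5 : ℝ)) ^ 2) atTop (𝓝 0) := by
    have := (tendsto_inv_atTop_zero.comp
      ((tendsto_pow_atTop (two_ne_zero)).comp tendsto_rpow_fifth))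
    refine this.congr fun n => ?_
    simp [Function.comp]
  have h1 := hinv.const_mul (8 * B)
  rw [mul_zero] at h1
  have h2 := (hinv.pow 2).const_mul (CL * 3)
  rw [zero_pow two_ne_zero, mul_zero] at h2
  filter_upwards [eventually_ge_atTop 1, tendsto_rpow_fifth.eventually_ge_atTop 2,
    h1.eventually_le_const (Real.sqrt_pos.2 hκ), h2.eventually_le_const (half_pos hκ)]
    with n hn hn2 hn3 hn4
  obtain ⟨hu, hun, hN1, hN2⟩ := ceil_rpow_bounds hn
  refine ⟨?_, ?_, hn3⟩
  · have h3 : ((⌈(n : ℝ) ^ (1 / 5 : ℝ)⌉₊ : ℝ)) ^ 2 ≤ 2 * n := by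
      calc _ ≤ (2 * (n : ℝ) ^ (1 / 5 : ℝ)) ^ 2 := by gcongr
        _ = 2 * (2 * ((n : ℝ) ^ (1 / 5 : ℝ)) ^ 2) := by ring
        _ ≤ 2 * n := by
          conv_rhs => rw [← hun]
          generalize (n : ℝ) ^ (1 / 5 : ℝ) = u at *
          have h8 : (2 : ℝ) ^ 3 ≤ u ^ 3 := pow_le_pow_left₀ (by norm_num) hn2 3
          have : 2 * u ^ 2 ≤ u ^ 3 * u ^ 2 := by gcongr; linarith
          calc _ ≤ 2 * (u ^ 3 * u ^ 2) := by gcongr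
            _ = _ := by ring
    exact_mod_cast h3
  · calc _ ≤ CL * (n * (3 * (1 / ((n : ℝ) ^ (1 / 5 : ℝ)) ^ 2) ^ 2)) := by
          gcongr
          exact norm_rate_le hu hun hN1 hN2
      _ = n * (CL * 3 * (1 / ((n : ℝ) ^ (1 / 5 : ℝ)) ^ 2) ^ 2) := by ring
      _ ≤ n * (κ / 2) := by gcongr
      _ = _ := by ring

end

section

/-! ### The distribution of the sample -/

variable {Ω : Type*} [MeasurableSpace Ω] {P : Measure Ω}

/-- Exceptional events for an i.i.d. sample are bounded under the product measure. The outer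
measure form needs no measurability of `s`. -/
theorem measure_sample_mem_le [IsProbabilityMeasure P] {α : Type*} [MeasurableSpace α] {Z : ℕ → Ω → α}
    (hZ : ∀ i, Measurable (Z i)) (hindep : iIndepFun Z P)
    (hident : ∀ i, IdentDistrib (Z i) (Z 0) P P) (n : ℕ) (s : Set (Fin n → α)) :
    P {ω | (fun i : Fin n => Z i ω) ∈ s} ≤ (Measure.pi fun _ : Fin n => P.map (Z 0)) s := by
  have h1 : iIndepFun (fun i : Fin n => Z i) P := hindep.precomp Fin.val_injective
  have h2 := (iIndepFun_iff_map_fun_eq_pi_map fun i : Fin n => (hZ i).aemeasurable).1 h1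
  have h3 : (fun i : Fin n => P.map (Z i)) = fun _ => P.map (Z 0) :=
    funext fun i => (hident i).map_eq
  rw [h3] at h2
  rw [← h2]
  exact Measure.le_map_apply (f := fun ω (i : Fin n) => Z i ω)
    (measurable_pi_lambda _ fun i : Fin n => hZ i).aemeasurable s

/-- A joint bound of order `V` in probability for two sequences. -/
theorem isBigOp_and_isBigOp {U U' V : ℕ → Ω → ℝ} (hU : ∀ n ω, 0 ≤ U n ω) (hU' : ∀ n ω, 0 ≤ U' n ω)
    (h : ∀ ε : ℝ, 0 < ε → ∃ C : ℝ, ∀ᶠ n in atTop,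
      P {ω | ¬ (U n ω ≤ C * |V n ω| ∧ U' n ω ≤ C * |V n ω|)} ≤ ENNReal.ofReal ε) :
    IsBigOp P U V ∧ IsBigOp P U' V := by
  constructor <;> intro ε hε <;> obtain ⟨C, hC⟩ := h ε hε <;>
    refine ⟨C, hC.mono fun n hn => (measure_mono fun ω hω hcon => ?_).trans hn⟩
  · rw [Set.mem_ofPred_eq, abs_of_nonneg (hU n ω)] at hω
    exact hω.not_ge hcon.1
  · rw [Set.mem_ofPred_eq, abs_of_nonneg (hU' n ω)] at hω
    exact hω.not_ge hcon.2

end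

end ConvexSingleIndex

end

/-! ### Convergence of the estimators at the rate of the smoothing parameter -/

theorem mainTheorem8 {d : ℕ} [NeZero d] {Ω : Type*} [MeasurableSpace Ω]
    (P : Measure Ω) [IsProbabilityMeasure P]
    -- i.i.d. observations `(X i, Y i)` from the convex single index model
    (X : ℕ → Ω → EuclideanSpace ℝ (Fin d)) (Y : ℕ → Ω → ℝ)
    (hX : ∀ i, Measurable (X i)) (hY : ∀ i, Measurable (Y i))
    (hindep : iIndepFun (fun i ω => (X i ω, Y i ω)) P)
    (hident : ∀ i, IdentDistrib (fun ω => (X i ω, Y i ω)) (fun ω => (X 0 ω, Y 0 ω)) P P)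
    (θ₀ : EuclideanSpace ℝ (Fin d)) (hθ₀ : θ₀ ∈ ConvexSingleIndex.Theta d) (m₀ : ℝ → ℝ)
    (D : Set ℝ) (hD : D = ConvexSingleIndex.indexSet (P.map (X 0)).support)
    -- the covariate distribution
    (hdesign : ConvexSingleIndex.IdentifiableDesign P (X 0) θ₀)
    (hcompact : IsCompact (P.map (X 0)).support)
    -- the error `Y - m₀(θ₀ᵀX)`
    (herr : ConvexSingleIndex.SubGaussianError P (X 0)
      (fun ω => Y 0 ω - m₀ (inner ℝ θ₀ (X 0 ω))))
    (hmoment : IsUnit (ConvexSingleIndex.weightedMoment P (X 0) D m₀ θ₀))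
    (hcov : (ConvexSingleIndex.covMatrix P (X 0)).PosDef)
    -- the true link function
    (hm₀ : m₀ ∈ ConvexSingleIndex.LinkClass D)
    (hm₀_bdd : ∃ M₀ : ℝ, ∀ t ∈ D, |m₀ t| ≤ M₀)
    (hm₀_rough : ConvexSingleIndex.roughnessSq D m₀ < ∞)
    -- the smoothing parameter
    (lam : ℕ → Ω → ℝ) (hlam : ∀ n, Measurable (lam n)) (hlam_ne : ∀ n ω, lam n ω ≠ 0)
    (hlam_lower : ConvexSingleIndex.IsBigOp P (fun n ω => (lam n ω)⁻¹)
      (fun n _ => (n : ℝ) ^ (2 / 5 : ℝ)))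
    (hlam_upper : ConvexSingleIndex.IsLittleOp P lam (fun n _ => (n : ℝ) ^ (-(1 / 4) : ℝ)))
    (hnondeg : ConvexSingleIndex.NondegenerateGivenIndex P (X 0) θ₀)
    -- the penalized least squares estimators
    (mhat : ℕ → Ω → ℝ → ℝ) (θhat : ℕ → Ω → EuclideanSpace ℝ (Fin d))
    (hest : ∀ n, 1 ≤ n → ∀ᵐ ω ∂P, ConvexSingleIndex.IsPLSE D n (fun i => X i ω)
      (fun i => Y i ω) (lam n ω) (mhat n ω) (θhat n ω)) :
    ConvexSingleIndex.IsBigOp P (fun n ω => ‖θhat n ω - θ₀‖) lam ∧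
    ConvexSingleIndex.IsBigOp P
      (fun n ω => ConvexSingleIndex.l2Norm (P.map (X 0))
        (fun x => mhat n ω (inner ℝ θ₀ x) - m₀ (inner ℝ θ₀ x))) lam := by
  have hPX : IsProbabilityMeasure (P.map (X 0)) :=
    Measure.isProbabilityMeasure_map (hX 0).aemeasurable
  obtain ⟨a, b, hab, hDab, hIcc⟩ :=
    ConvexSingleIndex.exists_indexSet_eq_Icc (hX 0) hcompact hcov hθ₀
  rw [hDab] at hD
  subst hD
  obtain ⟨c₀, g₀, hg₀, -, hm₀eq, hm₀deriv⟩ :=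
    ConvexSingleIndex.exists_prim_of_mem_linkClass hab hm₀ hm₀_rough
  have hsupp : ∀ᵐ x ∂(P.map (X 0)), x ∈ (P.map (X 0)).support := Measure.support_mem_ae
  have hI : ∀ᵐ x ∂(P.map (X 0)), ∀ θ ∈ ConvexSingleIndex.Theta d,
      (inner ℝ θ x : ℝ) ∈ Set.Icc a b := by
    filter_upwards [hsupp] with x hx using hIcc x hx
  obtain ⟨B, hB⟩ := hcompact.isBounded.exists_norm_le
  have hBae : ∀ᵐ x ∂(P.map (X 0)), ‖x‖ ≤ B := by
    filter_upwards [hsupp] with x hx using hB x hx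
  have hB0 : 0 ≤ B := by
    obtain ⟨x, hx⟩ := hBae.exists
    exact (norm_nonneg x).trans hx
  have hXsupp : ∀ i, ∀ᵐ ω ∂P, X i ω ∈ (P.map (X 0)).support := fun i => by
    refine ae_of_ae_map (hX i).aemeasurable ?_
    have h : P.map (X i) = P.map (X 0) := ((hident i).comp measurable_fst).map_eq
    rwa [h]
  -- Linear functions of the indices have second moments bounded from below.
  have hLp : ∀ j, MemLp (fun ω => X 0 ω j) 2 P := fun j => by
    refine MemLp.of_bound (Measurable.aestronglyMeasurable (by fun_prop)) B ?_
    filter_upwards [hXsupp 0] with ω hω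
    exact (PiLp.norm_apply_le _ j).trans (hB _ hω)
  obtain ⟨v, hv, hvar⟩ := ConvexSingleIndex.exists_le_variance hLp hcov
  obtain ⟨κ, hκ, hlin⟩ := ConvexSingleIndex.exists_le_integral_linear_sq hab.le hv hI
    (fun θ hθ => by
      rw [variance_map (Measurable.aemeasurable (by fun_prop)) (hX 0).aemeasurable]
      exact hvar θ hθ)
  have hne := ConvexSingleIndex.not_ae_slope_eq_zero (hX 0)
    (by filter_upwards [hXsupp 0] with ω hω using hIcc _ hω θ₀ hθ₀) hm₀deriv hmoment
  -- The regression function, with the index moved into `[a, b]`. Unlike `m₀`, of which nothing is known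
  -- outside `[a, b]`, it is measurable and bounded.
  set M₀ : EuclideanSpace ℝ (Fin d) → ℝ := fun x =>
    ConvexSingleIndex.prim a c₀ g₀ (ConvexSingleIndex.clampIndex a b θ₀ x) with hM₀
  have hM₀m : Measurable M₀ := (ConvexSingleIndex.continuous_prim hg₀.cont a c₀).measurable.comp
    (ConvexSingleIndex.measurable_clampIndex a b θ₀)
  have hM₀eq : ∀ x ∈ (P.map (X 0)).support, M₀ x = m₀ (inner ℝ θ₀ x) := fun x hx => by
    rw [hM₀]
    simp only
    rw [ConvexSingleIndex.clampIndex_eq (hIcc x hx θ₀ hθ₀), hm₀eq _ (hIcc x hx θ₀ hθ₀)]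
  have hM₀prim : ∀ x ∈ (P.map (X 0)).support,
      M₀ x = ConvexSingleIndex.prim a c₀ g₀ (inner ℝ θ₀ x) := fun x hx => by
    rw [hM₀eq x hx, hm₀eq _ (hIcc x hx θ₀ hθ₀)]
  -- The sample of covariates and errors.
  set Z : ℕ → Ω → EuclideanSpace ℝ (Fin d) × ℝ := fun i ω => (X i ω, Y i ω - M₀ (X i ω)) with hZ
  have hΦ : Measurable fun w : EuclideanSpace ℝ (Fin d) × ℝ => (w.1, w.2 - M₀ w.1) := by
    fun_prop
  have hZm : ∀ i, Measurable (Z i) := fun i => hΦ.comp ((hX i).prodMk (hY i))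
  have hZindep : iIndepFun Z P := hindep.comp _ fun _ => hΦ
  have hZident : ∀ i, IdentDistrib (Z i) (Z 0) P P := fun i => (hident i).comp hΦ
  have hμ : IsProbabilityMeasure (P.map (Z 0)) :=
    Measure.isProbabilityMeasure_map (hZm 0).aemeasurable
  have hμfst : (P.map (Z 0)).map Prod.fst = P.map (X 0) :=
    Measure.map_map measurable_fst (hZm 0)
  obtain ⟨σ, hσ, hsubG⟩ := herr.isSubG (hX 0) (e' := fun ω => Y 0 ω - M₀ (X 0 ω))
    ((hY 0).sub (hM₀m.comp (hX 0))) (by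
      filter_upwards [hXsupp 0] with ω hω
      rw [hM₀eq _ hω])
  have hIμ : ∀ᵐ w ∂(P.map (Z 0)), ∀ θ ∈ ConvexSingleIndex.Theta d,
      (inner ℝ θ w.1 : ℝ) ∈ Set.Icc a b :=
    ae_of_ae_map (f := Prod.fst) measurable_fst.aemeasurable (by rw [hμfst]; exact hI)
  have hlinμ : ∀ θ ∈ ConvexSingleIndex.Theta d, ∀ c s : ℝ, κ * (c ^ 2 + s ^ 2) ≤
      ∫ w, (c + s * (inner ℝ θ w.1 - a)) ^ 2 ∂(P.map (Z 0)) := fun θ hθ c s => by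
    have h1 : ∫ w, (c + s * (inner ℝ θ w.1 - a)) ^ 2 ∂(P.map (Z 0)) =
        ∫ x, (c + s * (inner ℝ θ x - a)) ^ 2 ∂((P.map (Z 0)).map Prod.fst) :=
      (integral_map (f := fun x : EuclideanSpace ℝ (Fin d) => (c + s * (inner ℝ θ x - a)) ^ 2)
        measurable_fst.aemeasurable (Continuous.aestronglyMeasurable (by fun_prop))).symm
    rw [h1, hμfst]
    exact hlin θ hθ c s
  refine ConvexSingleIndex.isBigOp_and_isBigOp (fun _ _ => norm_nonneg _)
    (fun _ _ => Real.sqrt_nonneg _) fun ε hε => ?_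
  -- The bound `lam⁻¹ ≤ K n^{2/5}` fixes `K`. The constants follow in this order: the radius `R` of the
  -- ball of links that contains the estimators, the constant `C` of the norm comparison on this ball,
  -- and the constant `C'` of the rate.
  obtain ⟨K, hK⟩ := hlam_lower (ε / 2) (half_pos hε)
  obtain ⟨R, hR, hM₀R, hrate⟩ := ConvexSingleIndex.exists_rate_of_isGoodSample hab hθ₀ hdesign.1
    (hnondeg.indexNondeg (hX 0)) (hdesign.nullOnLines (hX 0)) hI hB0 hBae hg₀.cont hne
    (J₀ := Real.sqrt (ConvexSingleIndex.roughnessSq (Set.Icc a b) m₀).toReal) (K := K) hσ hκ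
  obtain ⟨C, CL, hC, hCL, hgood⟩ := ConvexSingleIndex.exists_net_isGoodSample (d := d) hab hR
  obtain ⟨C', hC', hfinal⟩ := hrate C hC
  refine ⟨C', ?_⟩
  set N : ℕ → ℕ := fun n => ⌈(n : ℝ) ^ (1 / 5 : ℝ)⌉₊ with hN
  set good : (n : ℕ) → Set (Fin n → EuclideanSpace ℝ (Fin d) × ℝ) := fun n =>
    {z | (∑ i, (z i).2 ^ 2 ≤ 16 * σ * n) ∧ ∀ θ ∈ ConvexSingleIndex.Theta d,
      ∃ θ' ∈ ConvexSingleIndex.Theta d, ‖θ - θ'‖ ≤ d / n ∧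
        ConvexSingleIndex.IsGoodSample a (b + 1) σ κ R C M₀
          (ConvexSingleIndex.clampIndex a b θ') (P.map (Z 0)) (N n) z} with hgooddef
  have hsmall : ∀ᶠ n : ℕ in atTop, P {ω | 1 * |(n : ℝ) ^ (-(1 / 4) : ℝ)| < |lam n ω|} +
      P {ω | (fun i : Fin n => Z i ω) ∈ (good n)ᶜ} ≤ ENNReal.ofReal (ε / 2) := by
    have h1 := ENNReal.tendsto_ofReal (ConvexSingleIndex.tendsto_exp_bound d)
    have h2 := (hlam_upper 1 one_pos).add h1
    rw [ENNReal.ofReal_zero, add_zero] at h2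
    filter_upwards [h2.eventually_le_const (ENNReal.ofReal_pos.2 (half_pos hε)),
      ConvexSingleIndex.eventually_rates (B := d * B) hCL hκ, eventually_ge_atTop 1]
      with n hn1 hn2 hn3
    refine le_trans (add_le_add le_rfl ?_) hn1
    obtain ⟨hu, -, hN1, -⟩ := ConvexSingleIndex.ceil_rpow_bounds hn3
    have hNpos : 0 < N n := by
      have : (0 : ℝ) < N n := by linarith
      exact_mod_cast this
    exact (ConvexSingleIndex.measure_sample_mem_le hZm hZindep hZident n _).trans
      (hgood σ κ (P.map (Z 0)) hσ hsubG hIμ hlinμ M₀ hM₀m hM₀R n (N n) hn3 hNpos hn2.1 hn2.2.1)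
  filter_upwards [hK, hsmall, ConvexSingleIndex.eventually_rates (B := d * B) hCL hκ,
    eventually_ge_atTop 1] with n hKn hsn hrn hn1
  obtain ⟨hu, hun, hN1, hN2⟩ := ConvexSingleIndex.ceil_rpow_bounds hn1
  have hn' : (1 : ℝ) ≤ n := by exact_mod_cast hn1
  -- Outside a null set, the rates can fail only if one of the bounds for `lam` fails or the sample is
  -- not good.
  have hle : P {ω | ¬ (‖θhat n ω - θ₀‖ ≤ C' * |lam n ω| ∧
      ConvexSingleIndex.l2Norm (P.map (X 0))
        (fun x => mhat n ω (inner ℝ θ₀ x) - m₀ (inner ℝ θ₀ x)) ≤ C' * |lam n ω|)} ≤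
      P ({ω | K * |(n : ℝ) ^ (2 / 5 : ℝ)| < |(lam n ω)⁻¹|} ∪
        ({ω | 1 * |(n : ℝ) ^ (-(1 / 4) : ℝ)| < |lam n ω|} ∪
          {ω | (fun i : Fin n => Z i ω) ∈ (good n)ᶜ})) := by
    refine measure_mono_ae ?_
    filter_upwards [hest n hn1, ae_all_iff.2 hXsupp] with ω hω hXω
    refine fun hbad => ?_
    by_contra hcon
    apply hbad
    have hlow : |(lam n ω)⁻¹| ≤ K * |(n : ℝ) ^ (2 / 5 : ℝ)| := not_lt.1 fun h => hcon (Or.inl h)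
    have hup : |lam n ω| ≤ 1 * |(n : ℝ) ^ (-(1 / 4) : ℝ)| :=
      not_lt.1 fun h => hcon (Or.inr (Or.inl h))
    have hz : (fun i : Fin n => Z i ω) ∈ good n := by_contra fun h => hcon (Or.inr (Or.inr h))
    have hl : 0 < |lam n ω| := abs_pos.2 (hlam_ne n ω)
    have hl1 : |lam n ω| ≤ 1 := by
      rw [one_mul, abs_of_nonneg (Real.rpow_nonneg (by linarith) _ :
        0 ≤ (n : ℝ) ^ (-(1 / 4) : ℝ))] at hup
      exact hup.trans (Real.rpow_le_one_of_one_le_of_nonpos hn' (by norm_num))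
    have hKl : 1 / ((n : ℝ) ^ (1 / 5 : ℝ)) ^ 2 ≤ K * |lam n ω| := by
      have h1 : ((n : ℝ) ^ (1 / 5 : ℝ)) ^ 2 = (n : ℝ) ^ (2 / 5 : ℝ) := by
        rw [← Real.rpow_natCast, ← Real.rpow_mul (by linarith)]
        norm_num
      have h2 : 0 < (n : ℝ) ^ (2 / 5 : ℝ) := Real.rpow_pos_of_pos (by linarith) _
      rw [abs_of_pos h2, abs_inv, inv_le_iff_one_le_mul₀ hl] at hlow
      rw [h1, div_le_iff₀ h2]
      linarith
    obtain ⟨c, J, g, hJ, hg, hmono, heq, hbas⟩ :=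
      hω.exists_prim hab hn1 (hlam_ne n ω) hm₀ hm₀_rough hθ₀
    obtain ⟨h1, h2⟩ := hfinal (P.map (Z 0)) hμfst n (N n) _ |lam n ω| hu hun hN1 hN2 hrn.2.2 hl
      hl1 hKl (fun i => Z i ω) (fun i => hB _ (hXω i)) (fun i θ hθ => hIcc _ (hXω i) θ hθ)
      hz.1 hz.2 (θhat n ω) hω.2.1 c J g hJ hg hmono (by
        refine le_trans (le_of_eq ?_) (hbas.trans (le_of_eq ?_))
        · congr 1
          refine Finset.sum_congr rfl fun i _ => ?_
          simp only [hZ]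
          rw [heq _ (hIcc _ (hXω i) _ hω.2.1), ← hM₀prim _ (hXω i)]
          ring
        · congr 1
          refine Finset.sum_congr rfl fun i _ => ?_
          simp only [hZ]
          rw [hM₀eq _ (hXω i)])
    refine ⟨h1, le_trans (le_of_eq ?_) h2⟩
    rw [ConvexSingleIndex.l2Norm]
    congr 1
    refine integral_congr_ae ?_
    filter_upwards [hI] with x hx
    rw [heq _ (hx θ₀ hθ₀), hm₀eq _ (hx θ₀ hθ₀)]
  calc _ ≤ _ := hle
    _ ≤ _ := (measure_union_le _ _).trans (add_le_add hKn ((measure_union_le _ _).trans hsn))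
    _ = ENNReal.ofReal ε := by
      rw [← ENNReal.ofReal_add (by positivity) (by positivity), add_halves]
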